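/- Conventions. We work with finitary type theories in the sense of Bauer, Haselwarter and Petkovi\'c: expressions are built from symbols and metavariables with arities; a metavariable context $\Xi=[M_1{:}\mathcal B_1,\dots,M_n{:}\mathcal B_n]$ assigns to distinct metavariables abstracted boundaries $\mathcal B_i$, the $i$-th one closed and over $M_1,\dots,M_{i-1}$, and $|\Xi|=\{M_1,\dots,M_n\}$; $\mathcal B[e]$ is the judgement obtained by filling the boundary $\mathcal B$ with the head $e$. A raw type theory is a family of raw rules $\Xi\Rightarrow \mathbf b[e]$ (syntactically valid judgements $\Xi;\cdot\vdash \mathbf b[e]$ with $\mathbf b$ a non-abstracted boundary); it generates a deductive system from the instances of its rules, the congruence rules of its object rules, and the variable, metavariable, abstraction, equality and boundary rules. It is finitary if for each rule $\vdash\Xi\ \mathsf{mctx}$ and $\Xi;\cdot\vdash \mathbf b$ are derivable, and standard if moreover every object rule is a symbol rule $\Xi\Rightarrow \mathbf b[\mathsf S(\widehat M_1,\dots,\widehat M_n)]$ with $\mathsf S$ not occurring in $\Xi$ or $\mathbf b$, and every symbol has precisely one such rule. Here $\widehat M=\{\vec x\}M(\vec x)$ for an object metavariable and $\widehat M=\{\vec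 x\}\star$ for an equality metavariable. An instantiation $I=\langle M_1\mapsto e_1,\dots,M_n\mapsto e_n\rangle$ of $\Xi$ over $\Theta;\Gamma$ consists of arguments $e_i$ over $\Theta;\Gamma$ with the arity of $\mathcal B_i$; $I_*$ denotes its action and $I_{(i)}$ its restriction to $M_1,\dots,M_{i-1}$. It is derivable if $\Theta;\Gamma\vdash (I_{(i)*}\mathcal B_i)[e_i]$ is derivable for all $i$. Composition is $(J\circ I)(M)=J_*(I(M))$. Patterns over $\Xi$ are given by: type patterns $P::=M()\mid \mathsf S(q_1,\dots,q_n)$ ($M$ a type metavariable and $\mathsf S$ a type symbol), term patterns $p::=\mathsf S(q_1,\dots,q_n)$ ($\mathsf S$ a term symbol), argument patterns $q::=\{\vec x\}M(\vec x)\mid P\mid p$, where in $\mathsf S(q_1,\dots,q_n)$ the sets $\mathrm{mv}(q_i)$ of metavariables are pairwise disjoint. Natural for variables: the relation $\Theta;\Gamma\Vdash\mathcal J$ on object judgements is generated by: $\Theta;\Gamma\Vdash a:\Gamma(a)$; $\Theta;\Gamma\Vdash\{x{:}A\}\mathcal J$ if $\Theta;\Gamma,a{:}A\Vdash\mathcal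 J[a/x]$ for some $a\notin|\Gamma|$; if $\Theta(M)=\{\vec x{:}\vec A\}\mathbf b$ with $\mathbf b=(\Box\ \mathsf{type})$ or $\mathbf b=(\Box:B)$ and $\Theta;\Gamma\Vdash t_i:A_i[t_1/x_1,\dots,t_{i-1}/x_{i-1}]$ for all $i$, then $\Theta;\Gamma\Vdash (\mathbf b[\vec t/\vec x])[M(\vec t)]$; and if the rule of $\mathsf S$ has premises $[M_1{:}\mathcal B_1,\dots,M_n{:}\mathcal B_n]$, $K=\langle M_i\mapsto e_i\rangle_i$ and $\Theta;\Gamma\Vdash(K_{(i)*}\mathcal B_i)[e_i]$ for every object boundary $\mathcal B_i$, then $\Theta;\Gamma\Vdash\mathbf b'[\mathsf S(e_1,\dots,e_n)]$ for any non-abstracted object boundary $\mathbf b'$. A rule $\Xi\Rightarrow\mathcal J$ is natural for variables if $\Xi;\cdot\Vdash\mathcal J$. For $\Psi=[M_1{:}\mathcal B_1,\dots,M_n{:}\mathcal B_n]$ the basic instantiation $\beta=\langle M_k\mapsto e\rangle_\Psi$ sends $M_k$ to $e$ and every other $M_i$ to $\widehat M_i$. It is an instantiation of $\Psi$ over the metavariable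 context $\Psi\langle M_k\mapsto e\rangle$ obtained from $[M_j{:}\beta_{(j)*}\mathcal B_j]_{j}$ by deleting $M_k$. Given an instantiation $I$ of $\Xi$ over $\Theta;\cdot$ with $|\Xi|\cap|\Theta|=\emptyset$ and a sequence $\vec N=(N_1,\dots,N_m)$ of distinct elements of $|\Xi|$, define the context $C(\vec N)$ and the instantiation $F(\vec N)$ of $\Xi$ over $C(\vec N);\cdot$ by $C()=[\Theta,\Xi]$, $F()=\langle M\mapsto\widehat M\rangle_{M\in|\Xi|}$, $C(\vec N,N)=C(\vec N)\langle N\mapsto I(N)\rangle$ and $F(\vec N,N)=\langle N\mapsto I(N)\rangle_{C(\vec N)}\circ F(\vec N)$. Lemma. In a standard type theory, let $\Xi\Rightarrow\mathbf b[p]$ be a derivable object rule which is natural for variables, where $p$ is a (type or term) pattern over $\Xi$, and let $I$ be an instantiation of $\Xi$ over $\Theta;\cdot$ such that $|\Xi|\cap|\Theta|=\emptyset$ and $\Theta;\cdot\vdash I_*(\mathbf b[p])$ is derivable. Let $\vec N=(N_1,\dots,N_m)$ be a sequence of distinct metavariables with $\{N_1,\dots,N_m\}\subseteq|\Xi|$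 and $\mathrm{mv}(\mathbf b)\subseteq\{N_1,\dots,N_m\}\cup\mathrm{mv}(p)$, such that both $\vdash C(\vec N)\ \mathsf{mctx}$ and $F(\vec N)$ are derivable. Then $\vec N$ can be extended to a sequence $\vec N'=(N_1,\dots,N_\ell)$, $\ell\ge m$, of distinct metavariables such that $\{N_1,\dots,N_\ell\}=\{N_1,\dots,N_m\}\cup\mathrm{mv}(p)$ and both $\vdash C(\vec N')\ \mathsf{mctx}$ and $F(\vec N')$ are derivable. -/

import Mathlib

/-!
# Finitary type theories

Raw syntax is locally nameless: free variables and metavariables are named by natural numbers,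
bound variables are de Bruijn indices.  In an abstraction over `x₁, …, xₙ` the innermost variable
`xₙ` has index `0` and `x₁` has index `n - 1`.  Syntactic validity is a separate predicate, and
every derivable judgement or boundary is required to be syntactically valid.
-/

universe u v

namespace FTT

/-! ## Signatures -/

/-- Syntactic classes. -/
inductive Cls
  | ty
  | tm
  | eqTy
  | eqTm

/-- The object classes are those of types and terms. -/
def Cls.IsObj : Cls → Prop
  | .ty => True
  | .tm => True
  | .eqTy => False
  | .eqTm => False

/-- Symbol arity: the class of the resulting expression, and the metavariable arity
(class and number of bound variables) of each argument. -/
structure SymArity where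
  cls : Cls
  isObj : cls.IsObj
  args : List (Cls × ℕ)

structure Signature where
  Sym : Type u
  arity : Sym → SymArity

/-! ## Expressions and arguments -/

/-- Raw expressions and arguments. -/
inductive Arg (S : Signature.{u}) : Type u
  | fvar (a : ℕ)
  | bvar (i : ℕ)
  | sym (s : S.Sym) (es : Fin (S.arity s).args.length → Arg S)
  | mvar (M n : ℕ) (ts : Fin n → Arg S)
  | dummyTy
  | dummyTm
  | abstr (e : Arg S)

namespace Arg

variable {S : Signature.{u}}

/-- The extension of a renaming of indices under one binder. -/
def upRen (ρ : ℕ → ℕ) : ℕ → ℕ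
  | 0 => 0
  | i + 1 => ρ i + 1

/-- Renaming of bound variables. -/
def rename : (ℕ → ℕ) → Arg S → Arg S
  | _, fvar a => fvar a
  | ρ, bvar i => bvar (ρ i)
  | ρ, sym s es => sym s fun i => (es i).rename ρ
  | ρ, mvar M n ts => mvar M n fun i => (ts i).rename ρ
  | _, dummyTy => dummyTy
  | _, dummyTm => dummyTm
  | ρ, abstr e => abstr (e.rename (upRen ρ))

/-- The extension of a substitution under one binder. -/
def up (σ : ℕ → Arg S) : ℕ → Arg S
  | 0 => bvar 0
  | i + 1 => (σ i).rename Nat.succ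

/-- Capture-avoiding simultaneous substitution for bound variables. -/
def subst : (ℕ → Arg S) → Arg S → Arg S
  | _, fvar a => fvar a
  | σ, bvar i => σ i
  | σ, sym s es => sym s fun i => (es i).subst σ
  | σ, mvar M n ts => mvar M n fun i => (ts i).subst σ
  | _, dummyTy => dummyTy
  | _, dummyTm => dummyTm
  | σ, abstr e => abstr (e.subst (up σ))

/-- The substitution `[t/x]` for the innermost bound variable `x`. -/
def single (t : Arg S) : ℕ → Arg S
  | 0 => t
  | i + 1 => bvar i

/-- The substitution `[t₁/x₁, …, tₙ/xₙ]` for the `n` innermost bound variables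
(`xₙ` has index `0`). -/
def vec {n : ℕ} (ts : Fin n → Arg S) (i : ℕ) : Arg S :=
  if h : i < n then ts (Fin.rev ⟨i, h⟩) else bvar (i - n)

/-- The substitution `[t₁/x₁, …, tⱼ/xⱼ]` given by the first `j` entries of `t₁, …, tₙ`. -/
def vecUpto {n : ℕ} (ts : Fin n → Arg S) (j : Fin n) : ℕ → Arg S :=
  vec fun i : Fin j => ts (Fin.castLE j.isLt.le i)

/-- Iterated abstraction. -/
def abstrs : ℕ → Arg S → Arg S
  | 0, e => e
  | n + 1, e => abstr (abstrs n e)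

/-- Removal of one abstraction (the identity on non-abstractions). -/
def body : Arg S → Arg S
  | abstr e => e
  | e => e

/-- Removal of `n` abstractions. -/
def strip : ℕ → Arg S → Arg S
  | 0, e => e
  | n + 1, e => strip n e.body

/-- The set of metavariables of an argument. -/
def mv : Arg S → Set ℕ
  | fvar _ => ∅
  | bvar _ => ∅
  | sym _ es => ⋃ i, (es i).mv
  | mvar M _ ts => {M} ∪ ⋃ i, (ts i).mv
  | dummyTy => ∅
  | dummyTm => ∅
  | abstr e => e.mv

/-- The set of symbols of an argument. -/
def syms : Arg S → Set S.Sym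
  | fvar _ => ∅
  | bvar _ => ∅
  | sym s es => {s} ∪ ⋃ i, (es i).syms
  | mvar _ _ ts => ⋃ i, (ts i).syms
  | dummyTy => ∅
  | dummyTm => ∅
  | abstr e => e.syms

/-- `Valid ar V k (c, n) e`: the argument `e` is syntactically valid and has arity `(c, n)`, where
`ar` assigns arities to the available metavariables, `V` is the set of available free variables,
and `k` is the number of bound variables in scope. -/
inductive Valid (ar : ℕ → Option (Cls × ℕ)) (V : Set ℕ) : ℕ → Cls × ℕ → Arg S → Prop
  | fvar {k a : ℕ} : a ∈ V → Valid ar V k (.tm, 0) (fvar a)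
  | bvar {k i : ℕ} : i < k → Valid ar V k (.tm, 0) (bvar i)
  | sym {k : ℕ} {s : S.Sym} {es : Fin (S.arity s).args.length → Arg S} :
      (∀ i, Valid ar V k ((S.arity s).args.get i) (es i)) →
      Valid ar V k ((S.arity s).cls, 0) (sym s es)
  | mvar {k M n : ℕ} {c : Cls} {ts : Fin n → Arg S} :
      ar M = some (c, n) → c.IsObj → (∀ i, Valid ar V k (.tm, 0) (ts i)) →
      Valid ar V k (c, 0) (mvar M n ts)
  | dummyTy {k : ℕ} : Valid ar V k (.eqTy, 0) dummyTy
  | dummyTm {k : ℕ} : Valid ar V k (.eqTm, 0) dummyTm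
  | abstr {k n : ℕ} {c : Cls} {e : Arg S} :
      Valid ar V (k + 1) (c, n) e → Valid ar V k (c, n + 1) (abstr e)

/-- The generic application of a metavariable of a given arity. -/
def genApp (M : ℕ) : Cls × ℕ → Arg S
  | (.ty, n) => abstrs n (mvar M n fun i => bvar (Fin.rev i))
  | (.tm, n) => abstrs n (mvar M n fun i => bvar (Fin.rev i))
  | (.eqTy, n) => abstrs n dummyTy
  | (.eqTm, n) => abstrs n dummyTm

end Arg

/-- An instantiation: a list `⟨M₁ ↦ e₁, …, Mₙ ↦ eₙ⟩` representing a map. -/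
abbrev Inst (S : Signature.{u}) := List (ℕ × Arg S)

/-- The action of an instantiation on an argument. -/
def Arg.act {S : Signature.{u}} (I : Inst S) : Arg S → Arg S
  | .fvar a => .fvar a
  | .bvar i => .bvar i
  | .sym s es => .sym s fun i => (es i).act I
  | .mvar M n ts =>
    match I.lookup M with
    | some e => (e.strip n).subst (Arg.vec fun i => (ts i).act I)
    | none => .mvar M n fun i => (ts i).act I
  | .dummyTy => .dummyTy
  | .dummyTm => .dummyTm
  | .abstr e => .abstr (e.act I)

/-! ## Judgements and boundaries -/

/-- Judgement theses.  The dummy head of an equation is left implicit. -/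
inductive Thesis (S : Signature.{u}) : Type u
  | isTy (A : Arg S)
  | tm (t A : Arg S)
  | eqTy (A B : Arg S)
  | eqTm (s t A : Arg S)

/-- Boundary theses. -/
inductive Bdry (S : Signature.{u}) : Type u
  | ty
  | tm (A : Arg S)
  | eqTy (A B : Arg S)
  | eqTm (s t A : Arg S)

/-- Abstracted judgements. -/
inductive AJdg (S : Signature.{u}) : Type u
  | thesis (j : Thesis S)
  | abstr (A : Arg S) (J : AJdg S)

/-- Abstracted boundaries. -/
inductive ABdry (S : Signature.{u}) : Type u
  | thesis (b : Bdry S)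
  | abstr (A : Arg S) (B : ABdry S)

section Ops

variable {S : Signature.{u}}

/-- Apply a function to the expressions of a judgement thesis. -/
def Thesis.map (f : Arg S → Arg S) : Thesis S → Thesis S
  | isTy A => isTy (f A)
  | tm t A => tm (f t) (f A)
  | eqTy A B => eqTy (f A) (f B)
  | eqTm s t A => eqTm (f s) (f t) (f A)

/-- Apply a function to the expressions of a boundary thesis. -/
def Bdry.map (f : Arg S → Arg S) : Bdry S → Bdry S
  | ty => ty
  | tm A => tm (f A)
  | eqTy A B => eqTy (f A) (f B)
  | eqTm s t A => eqTm (f s) (f t) (f A)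

def AJdg.subst : (ℕ → Arg S) → AJdg S → AJdg S
  | σ, thesis j => thesis (j.map (Arg.subst σ))
  | σ, abstr A J => abstr (A.subst σ) (J.subst (Arg.up σ))

def ABdry.subst : (ℕ → Arg S) → ABdry S → ABdry S
  | σ, thesis b => thesis (b.map (Arg.subst σ))
  | σ, abstr A B => abstr (A.subst σ) (B.subst (Arg.up σ))

def ABdry.act (I : Inst S) : ABdry S → ABdry S
  | thesis b => thesis (b.map (Arg.act I))
  | abstr A B => abstr (A.act I) (B.act I)

def Bdry.cls : Bdry S → Cls
  | ty => .ty
  | tm _ => .tm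
  | eqTy _ _ => .eqTy
  | eqTm _ _ _ => .eqTm

/-- The metavariable arity of an abstracted boundary. -/
def ABdry.arity : ABdry S → Cls × ℕ
  | thesis b => (b.cls, 0)
  | abstr _ B => (B.arity.1, B.arity.2 + 1)

/-- Object boundaries. -/
def Bdry.IsObj (b : Bdry S) : Prop := b.cls.IsObj

def ABdry.IsObj (B : ABdry S) : Prop := B.arity.1.IsObj

/-- The metavariables of a boundary thesis. -/
def Bdry.mv : Bdry S → Set ℕ
  | ty => ∅
  | tm A => A.mv
  | eqTy A B => A.mv ∪ B.mv
  | eqTm s t A => s.mv ∪ t.mv ∪ A.mv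

/-- The symbols of a boundary thesis. -/
def Bdry.syms : Bdry S → Set S.Sym
  | ty => ∅
  | tm A => A.syms
  | eqTy A B => A.syms ∪ B.syms
  | eqTm s t A => s.syms ∪ t.syms ∪ A.syms

/-- The symbols of an abstracted boundary. -/
def ABdry.syms : ABdry S → Set S.Sym
  | thesis b => b.syms
  | abstr A B => A.syms ∪ B.syms

/-- Filling a boundary thesis with a head (the head of an equation is a dummy, left implicit). -/
def Bdry.plug : Bdry S → Arg S → Thesis S
  | ty, A => .isTy A
  | tm A, t => .tm t A
  | eqTy A B, _ => .eqTy A B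
  | eqTm s t A, _ => .eqTm s t A

/-- Filling an abstracted boundary with a head.  It is only used on heads of the arity of the
boundary, so that `Arg.body` is applied to abstractions only. -/
def ABdry.plug : ABdry S → Arg S → AJdg S
  | thesis b, e => .thesis (b.plug e)
  | abstr A B, e => .abstr A (B.plug e.body)

/-- Turning an object boundary into an equation; it is only used on object boundaries. -/
def Bdry.plugEq : Bdry S → Arg S → Arg S → Thesis S
  | ty, A, B => .eqTy A B
  | tm A, s, t => .eqTm s t A
  | eqTy A B, _, _ => .eqTy A B
  | eqTm s t A, _, _ => .eqTm s t A

/-- Turning an abstracted object boundary into an abstracted equation. -/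
def ABdry.plugEq : ABdry S → Arg S → Arg S → AJdg S
  | thesis b, e, f => .thesis (b.plugEq e f)
  | abstr A B, e, f => .abstr A (B.plugEq e.body f.body)

/-- The abstracted boundary with a given list of types of the abstracted variables. -/
def ABdry.abstrs : List (Arg S) → Bdry S → ABdry S
  | [], b => thesis b
  | A :: As, b => abstr A (abstrs As b)

end Ops

/-! ## Contexts, hypothetical judgements and boundaries -/

/-- Metavariable contexts. -/
abbrev MCtx (S : Signature.{u}) := List (ℕ × ABdry S)

/-- Variable contexts. -/
abbrev VCtx (S : Signature.{u}) := List (ℕ × Arg S)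

/-- The domain of a list of pairs. -/
def dom {X : Type u} (L : List (ℕ × X)) : Set ℕ := {a | a ∈ L.map Prod.fst}

section Validity

variable {S : Signature.{u}}

/-- The metavariable arities assigned by a metavariable context. -/
def MCtx.ar (Θ : MCtx S) (M : ℕ) : Option (Cls × ℕ) := (Θ.lookup M).map ABdry.arity

/-- The expression `A` is a syntactically valid type expression. -/
abbrev ValidTy (ar : ℕ → Option (Cls × ℕ)) (V : Set ℕ) (k : ℕ) (A : Arg S) : Prop :=
  A.Valid ar V k (.ty, 0)

/-- The expression `t` is a syntactically valid term expression. -/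
abbrev ValidTm (ar : ℕ → Option (Cls × ℕ)) (V : Set ℕ) (k : ℕ) (t : Arg S) : Prop :=
  t.Valid ar V k (.tm, 0)

def Thesis.Valid (ar : ℕ → Option (Cls × ℕ)) (V : Set ℕ) (k : ℕ) : Thesis S → Prop
  | isTy A => ValidTy ar V k A
  | tm t A => ValidTm ar V k t ∧ ValidTy ar V k A
  | eqTy A B => ValidTy ar V k A ∧ ValidTy ar V k B
  | eqTm s t A => ValidTm ar V k s ∧ ValidTm ar V k t ∧ ValidTy ar V k A

def Bdry.Valid (ar : ℕ → Option (Cls × ℕ)) (V : Set ℕ) (k : ℕ) : Bdry S → Prop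
  | ty => True
  | tm A => ValidTy ar V k A
  | eqTy A B => ValidTy ar V k A ∧ ValidTy ar V k B
  | eqTm s t A => ValidTm ar V k s ∧ ValidTm ar V k t ∧ ValidTy ar V k A

def AJdg.Valid (ar : ℕ → Option (Cls × ℕ)) (V : Set ℕ) : ℕ → AJdg S → Prop
  | k, thesis j => j.Valid ar V k
  | k, abstr A J => ValidTy ar V k A ∧ J.Valid ar V (k + 1)

def ABdry.Valid (ar : ℕ → Option (Cls × ℕ)) (V : Set ℕ) : ℕ → ABdry S → Prop
  | k, thesis b => b.Valid ar V k
  | k, abstr A B => ValidTy ar V k A ∧ B.Valid ar V (k + 1)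

/-- Syntactically valid metavariable contexts: the metavariables are distinct and each boundary is
closed and valid over the preceding part of the context. -/
def MCtx.Valid (Θ : MCtx S) : Prop :=
  (Θ.map Prod.fst).Nodup ∧
    ∀ (k M : ℕ) (B : ABdry S), Θ[k]? = some (M, B) → B.Valid (MCtx.ar (Θ.take k)) ∅ 0

/-- Syntactically valid variable contexts over a metavariable context. -/
def VCtx.Valid (Θ : MCtx S) (Γ : VCtx S) : Prop :=
  (Γ.map Prod.fst).Nodup ∧
    ∀ (k a : ℕ) (A : Arg S), Γ[k]? = some (a, A) → ValidTy Θ.ar (dom (Γ.take k)) 0 A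

/-- Hypothetical judgements and hypothetical boundaries. -/
inductive Hyp (S : Signature.{u}) : Type u
  | jdg (Θ : MCtx S) (Γ : VCtx S) (J : AJdg S)
  | bdry (Θ : MCtx S) (Γ : VCtx S) (B : ABdry S)

def Hyp.Valid : Hyp S → Prop
  | jdg Θ Γ J => Θ.Valid ∧ Γ.Valid Θ ∧ J.Valid Θ.ar (dom Γ) 0
  | bdry Θ Γ B => Θ.Valid ∧ Γ.Valid Θ ∧ B.Valid Θ.ar (dom Γ) 0

/-- `I` is an instantiation of `Ξ` over `Θ; Γ`. -/
def IsInst (I : Inst S) (Ξ Θ : MCtx S) (Γ : VCtx S) : Prop :=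
  List.Forall₂ (fun p q => p.1 = q.1 ∧ p.2.Valid Θ.ar (dom Γ) 0 q.2.arity) I Ξ

end Validity

/-! ## Raw rules and raw type theories -/

/-- The raw rule with premises `prem` and conclusion `bdry` filled with `head`. -/
structure RawRule (S : Signature.{u}) where
  prem : MCtx S
  bdry : Bdry S
  head : Arg S

/-- A raw rule is a syntactically valid hypothetical judgement. -/
def RawRule.Valid {S : Signature.{u}} (R : RawRule S) : Prop :=
  Hyp.Valid (.jdg R.prem [] (.thesis (R.bdry.plug R.head))) ∧
    R.head.Valid R.prem.ar ∅ 0 (R.bdry.cls, 0)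

/-- A raw type theory: a family of raw rules, its specific rules. -/
structure RawTT (S : Signature.{u}) where
  ι : Type v
  rule : ι → RawRule S
  valid : ∀ i, (rule i).Valid

namespace RawTT

variable {S : Signature.{u}} (T : RawTT.{u, v} S)

/-- Derivability in the deductive system associated with a raw type theory. The carrier of the
deductive system consists of the syntactically valid hypothetical judgements and boundaries, hence
the last hypothesis of each rule. -/
inductive Derivable : Hyp S → Prop
  | var {Θ : MCtx S} {Γ : VCtx S} {a : ℕ} {A : Arg S} :
      Γ.lookup a = some A →
      Hyp.Valid (.jdg Θ Γ (.thesis (.tm (.fvar a) A))) →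
      Derivable (.jdg Θ Γ (.thesis (.tm (.fvar a) A)))
  | mvar {Θ : MCtx S} {Γ : VCtx S} {M : ℕ} {As : List (Arg S)} {b : Bdry S}
      {ts : Fin As.length → Arg S} :
      Θ.lookup M = some (ABdry.abstrs As b) →
      (∀ j, Derivable (.jdg Θ Γ (.thesis (.tm (ts j) ((As.get j).subst (Arg.vecUpto ts j)))))) →
      Derivable (.bdry Θ Γ (.thesis (b.map (Arg.subst (Arg.vec ts))))) →
      Hyp.Valid
        (.jdg Θ Γ (.thesis ((b.map (Arg.subst (Arg.vec ts))).plug (.mvar M As.length ts)))) →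
      Derivable
        (.jdg Θ Γ (.thesis ((b.map (Arg.subst (Arg.vec ts))).plug (.mvar M As.length ts))))
  | mvarCongr {Θ : MCtx S} {Γ : VCtx S} {M : ℕ} {As : List (Arg S)} {b : Bdry S}
      {ss ts : Fin As.length → Arg S} :
      Θ.lookup M = some (ABdry.abstrs As b) →
      b.IsObj →
      (∀ j, Derivable (.jdg Θ Γ (.thesis (.tm (ss j) ((As.get j).subst (Arg.vecUpto ss j)))))) →
      (∀ j, Derivable (.jdg Θ Γ (.thesis (.tm (ts j) ((As.get j).subst (Arg.vecUpto ts j)))))) →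
      (∀ j, Derivable
        (.jdg Θ Γ (.thesis (.eqTm (ss j) (ts j) ((As.get j).subst (Arg.vecUpto ss j)))))) →
      (∀ C, b = .tm C →
        Derivable (.jdg Θ Γ (.thesis (.eqTy (C.subst (Arg.vec ss)) (C.subst (Arg.vec ts)))))) →
      Hyp.Valid (.jdg Θ Γ (.thesis ((b.map (Arg.subst (Arg.vec ss))).plugEq
        (.mvar M As.length ss) (.mvar M As.length ts)))) →
      Derivable (.jdg Θ Γ (.thesis ((b.map (Arg.subst (Arg.vec ss))).plugEq
        (.mvar M As.length ss) (.mvar M As.length ts))))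
  | abstr {Θ : MCtx S} {Γ : VCtx S} {a : ℕ} {A : Arg S} {J : AJdg S} :
      Derivable (.jdg Θ Γ (.thesis (.isTy A))) →
      a ∉ dom Γ →
      Derivable (.jdg Θ (Γ ++ [(a, A)]) (J.subst (Arg.single (.fvar a)))) →
      Hyp.Valid (.jdg Θ Γ (.abstr A J)) →
      Derivable (.jdg Θ Γ (.abstr A J))
  | tyRefl {Θ : MCtx S} {Γ : VCtx S} {A : Arg S} :
      Derivable (.jdg Θ Γ (.thesis (.isTy A))) →
      Hyp.Valid (.jdg Θ Γ (.thesis (.eqTy A A))) →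
      Derivable (.jdg Θ Γ (.thesis (.eqTy A A)))
  | tySym {Θ : MCtx S} {Γ : VCtx S} {A B : Arg S} :
      Derivable (.jdg Θ Γ (.thesis (.eqTy A B))) →
      Hyp.Valid (.jdg Θ Γ (.thesis (.eqTy B A))) →
      Derivable (.jdg Θ Γ (.thesis (.eqTy B A)))
  | tyTran {Θ : MCtx S} {Γ : VCtx S} {A B C : Arg S} :
      Derivable (.jdg Θ Γ (.thesis (.eqTy A B))) →
      Derivable (.jdg Θ Γ (.thesis (.eqTy B C))) →
      Hyp.Valid (.jdg Θ Γ (.thesis (.eqTy A C))) →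
      Derivable (.jdg Θ Γ (.thesis (.eqTy A C)))
  | tmRefl {Θ : MCtx S} {Γ : VCtx S} {t A : Arg S} :
      Derivable (.jdg Θ Γ (.thesis (.tm t A))) →
      Hyp.Valid (.jdg Θ Γ (.thesis (.eqTm t t A))) →
      Derivable (.jdg Θ Γ (.thesis (.eqTm t t A)))
  | tmSym {Θ : MCtx S} {Γ : VCtx S} {s t A : Arg S} :
      Derivable (.jdg Θ Γ (.thesis (.eqTm s t A))) →
      Hyp.Valid (.jdg Θ Γ (.thesis (.eqTm t s A))) →
      Derivable (.jdg Θ Γ (.thesis (.eqTm t s A)))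
  | tmTran {Θ : MCtx S} {Γ : VCtx S} {s t r A : Arg S} :
      Derivable (.jdg Θ Γ (.thesis (.eqTm s t A))) →
      Derivable (.jdg Θ Γ (.thesis (.eqTm t r A))) →
      Hyp.Valid (.jdg Θ Γ (.thesis (.eqTm s r A))) →
      Derivable (.jdg Θ Γ (.thesis (.eqTm s r A)))
  | convTm {Θ : MCtx S} {Γ : VCtx S} {t A B : Arg S} :
      Derivable (.jdg Θ Γ (.thesis (.tm t A))) →
      Derivable (.jdg Θ Γ (.thesis (.eqTy A B))) →
      Hyp.Valid (.jdg Θ Γ (.thesis (.tm t B))) →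
      Derivable (.jdg Θ Γ (.thesis (.tm t B)))
  | convEq {Θ : MCtx S} {Γ : VCtx S} {s t A B : Arg S} :
      Derivable (.jdg Θ Γ (.thesis (.eqTm s t A))) →
      Derivable (.jdg Θ Γ (.thesis (.eqTy A B))) →
      Hyp.Valid (.jdg Θ Γ (.thesis (.eqTm s t B))) →
      Derivable (.jdg Θ Γ (.thesis (.eqTm s t B)))
  | bdryTy {Θ : MCtx S} {Γ : VCtx S} :
      Hyp.Valid (.bdry Θ Γ (.thesis .ty)) →
      Derivable (.bdry Θ Γ (.thesis .ty))
  | bdryTm {Θ : MCtx S} {Γ : VCtx S} {A : Arg S} :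
      Derivable (.jdg Θ Γ (.thesis (.isTy A))) →
      Hyp.Valid (.bdry Θ Γ (.thesis (.tm A))) →
      Derivable (.bdry Θ Γ (.thesis (.tm A)))
  | bdryEqTy {Θ : MCtx S} {Γ : VCtx S} {A B : Arg S} :
      Derivable (.jdg Θ Γ (.thesis (.isTy A))) →
      Derivable (.jdg Θ Γ (.thesis (.isTy B))) →
      Hyp.Valid (.bdry Θ Γ (.thesis (.eqTy A B))) →
      Derivable (.bdry Θ Γ (.thesis (.eqTy A B)))
  | bdryEqTm {Θ : MCtx S} {Γ : VCtx S} {s t A : Arg S} :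
      Derivable (.jdg Θ Γ (.thesis (.isTy A))) →
      Derivable (.jdg Θ Γ (.thesis (.tm s A))) →
      Derivable (.jdg Θ Γ (.thesis (.tm t A))) →
      Hyp.Valid (.bdry Θ Γ (.thesis (.eqTm s t A))) →
      Derivable (.bdry Θ Γ (.thesis (.eqTm s t A)))
  | bdryAbstr {Θ : MCtx S} {Γ : VCtx S} {a : ℕ} {A : Arg S} {B : ABdry S} :
      Derivable (.jdg Θ Γ (.thesis (.isTy A))) →
      a ∉ dom Γ →
      Derivable (.bdry Θ (Γ ++ [(a, A)]) (B.subst (Arg.single (.fvar a)))) →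
      Hyp.Valid (.bdry Θ Γ (.abstr A B)) →
      Derivable (.bdry Θ Γ (.abstr A B))
  | specific {Θ : MCtx S} {Γ : VCtx S} (i : T.ι) {I : Inst S} :
      IsInst I (T.rule i).prem Θ Γ →
      (∀ (k M : ℕ) (B : ABdry S) (e : Arg S), (T.rule i).prem[k]? = some (M, B) → I[k]? = some (M, e) →
        Derivable (.jdg Θ Γ ((B.act (I.take k)).plug e))) →
      Derivable (.bdry Θ Γ (.thesis ((T.rule i).bdry.map (Arg.act I)))) →
      Hyp.Valid
        (.jdg Θ Γ (.thesis (((T.rule i).bdry.plug (T.rule i).head).map (Arg.act I)))) →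
      Derivable
        (.jdg Θ Γ (.thesis (((T.rule i).bdry.plug (T.rule i).head).map (Arg.act I))))
  | congr {Θ : MCtx S} {Γ : VCtx S} (i : T.ι) {I J : Inst S} :
      (T.rule i).bdry.IsObj →
      IsInst I (T.rule i).prem Θ Γ →
      IsInst J (T.rule i).prem Θ Γ →
      (∀ (k M : ℕ) (B : ABdry S) (f : Arg S), (T.rule i).prem[k]? = some (M, B) → I[k]? = some (M, f) →
        Derivable (.jdg Θ Γ ((B.act (I.take k)).plug f))) →
      (∀ (k M : ℕ) (B : ABdry S) (g : Arg S), (T.rule i).prem[k]? = some (M, B) → J[k]? = some (M, g) →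
        Derivable (.jdg Θ Γ ((B.act (J.take k)).plug g))) →
      (∀ (k M : ℕ) (B : ABdry S) (f g : Arg S), (T.rule i).prem[k]? = some (M, B) → B.IsObj →
        I[k]? = some (M, f) → J[k]? = some (M, g) →
        Derivable (.jdg Θ Γ ((B.act (I.take k)).plugEq f g))) →
      (∀ C, (T.rule i).bdry = .tm C →
        Derivable (.jdg Θ Γ (.thesis (.eqTy (C.act I) (C.act J))))) →
      Hyp.Valid (.jdg Θ Γ (.thesis (((T.rule i).bdry.map (Arg.act I)).plugEq
        ((T.rule i).head.act I) ((T.rule i).head.act J)))) →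
      Derivable (.jdg Θ Γ (.thesis (((T.rule i).bdry.map (Arg.act I)).plugEq
        ((T.rule i).head.act I) ((T.rule i).head.act J))))

/-- The metavariable context `Θ` is derivably well formed. -/
inductive MCtxDerivable : MCtx S → Prop
  | nil : MCtxDerivable []
  | extend {Θ : MCtx S} {M : ℕ} {B : ABdry S} :
      MCtxDerivable Θ → T.Derivable (.bdry Θ [] B) → M ∉ dom Θ → MCtxDerivable (Θ ++ [(M, B)])

/-- `I` is a derivable instantiation of `Ξ` over `Θ; Γ`. -/
def InstDerivable (I : Inst S) (Ξ Θ : MCtx S) (Γ : VCtx S) : Prop :=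
  IsInst I Ξ Θ Γ ∧
    ∀ (k M : ℕ) (B : ABdry S) (e : Arg S), Ξ[k]? = some (M, B) → I[k]? = some (M, e) →
      T.Derivable (.jdg Θ Γ ((B.act (I.take k)).plug e))

/-- A raw type theory is finitary when the premises and the conclusion boundary of each of its
rules are derivable. -/
def IsFinitary : Prop :=
  ∀ i, T.MCtxDerivable (T.rule i).prem ∧
    T.Derivable (.bdry (T.rule i).prem [] (.thesis (T.rule i).bdry))

end RawTT

/-- `R` is a symbol rule for `s`: its object rule-boundary, in which `s` does not occur, is filled
with `s` applied to the generic applications of the premises.  (Syntactic validity of `R` ensures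
that `s` has the arity associated with the rule-boundary.) -/
def RawRule.IsSymbolRule {S : Signature.{u}} (R : RawRule S) (s : S.Sym) : Prop :=
  R.bdry.IsObj ∧ s ∉ R.bdry.syms ∧ (∀ q ∈ R.prem, s ∉ q.2.syms) ∧
    ∃ es, R.head = .sym s es ∧
      List.ofFn es = R.prem.map fun q => Arg.genApp q.1 q.2.arity

namespace RawTT

variable {S : Signature.{u}} (T : RawTT.{u, v} S)

/-- Standard type theories: finitary type theories whose specific object rules are symbol rules,
with precisely one rule for each symbol. -/
def IsStandard : Prop :=
  T.IsFinitary ∧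
    (∀ i, (T.rule i).bdry.IsObj → ∃ s, (T.rule i).IsSymbolRule s) ∧
    ∀ s, ∃! i, (T.rule i).IsSymbolRule s

/-- The instantiation of the premises `Ξ` of the rule for a symbol by the arguments of the
symbol. -/
def argInst (Ξ : MCtx S) {n : ℕ} (es : Fin n → Arg S) : Inst S :=
  (Ξ.map Prod.fst).zip (List.ofFn es)

/-- Object judgements that are natural for variables. -/
inductive Natural : MCtx S → VCtx S → AJdg S → Prop
  | var {Θ : MCtx S} {Γ : VCtx S} {a : ℕ} {A : Arg S} :
      Γ.lookup a = some A →
      Natural Θ Γ (.thesis (.tm (.fvar a) A))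
  | abstr {Θ : MCtx S} {Γ : VCtx S} {a : ℕ} {A : Arg S} {J : AJdg S} :
      a ∉ dom Γ →
      Natural Θ (Γ ++ [(a, A)]) (J.subst (Arg.single (.fvar a))) →
      Natural Θ Γ (.abstr A J)
  | mvarTy {Θ : MCtx S} {Γ : VCtx S} {M : ℕ} {As : List (Arg S)}
      {ts : Fin As.length → Arg S} :
      Θ.lookup M = some (ABdry.abstrs As .ty) →
      (∀ j, Natural Θ Γ (.thesis (.tm (ts j) ((As.get j).subst (Arg.vecUpto ts j))))) →
      Natural Θ Γ (.thesis (.isTy (.mvar M As.length ts)))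
  | mvarTm {Θ : MCtx S} {Γ : VCtx S} {M : ℕ} {As : List (Arg S)} {B : Arg S}
      {ts : Fin As.length → Arg S} :
      Θ.lookup M = some (ABdry.abstrs As (.tm B)) →
      (∀ j, Natural Θ Γ (.thesis (.tm (ts j) ((As.get j).subst (Arg.vecUpto ts j))))) →
      Natural Θ Γ (.thesis (.tm (.mvar M As.length ts) (B.subst (Arg.vec ts))))
  | sym {Θ : MCtx S} {Γ : VCtx S} {s : S.Sym} {es : Fin (S.arity s).args.length → Arg S}
      {b : Bdry S} (i : T.ι) :
      (T.rule i).IsSymbolRule s →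
      b.IsObj →
      (∀ (k M : ℕ) (B : ABdry S) (e : Arg S), (T.rule i).prem[k]? = some (M, B) → B.IsObj →
        (argInst (T.rule i).prem es)[k]? = some (M, e) →
        Natural Θ Γ ((B.act ((argInst (T.rule i).prem es).take k)).plug e)) →
      Natural Θ Γ (.thesis (b.plug (.sym s es)))

end RawTT

/-! ## Patterns -/

/-- The three syntactic kinds of patterns. -/
inductive PatKind
  | ty
  | tm
  | arg

/-- Type patterns, term patterns and argument patterns over a metavariable context. -/
inductive IsPattern {S : Signature.{u}} (Ξ : MCtx S) : PatKind → Arg S → Prop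
  | tyMVar {M : ℕ} {ts : Fin 0 → Arg S} :
      Ξ.ar M = some (.ty, 0) → IsPattern Ξ .ty (.mvar M 0 ts)
  | tySym {s : S.Sym} {qs : Fin (S.arity s).args.length → Arg S} :
      (S.arity s).cls = .ty →
      (∀ i, IsPattern Ξ .arg (qs i)) →
      (∀ i j, i ≠ j → Disjoint (qs i).mv (qs j).mv) →
      IsPattern Ξ .ty (.sym s qs)
  | tmSym {s : S.Sym} {qs : Fin (S.arity s).args.length → Arg S} :
      (S.arity s).cls = .tm →
      (∀ i, IsPattern Ξ .arg (qs i)) →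
      (∀ i j, i ≠ j → Disjoint (qs i).mv (qs j).mv) →
      IsPattern Ξ .tm (.sym s qs)
  | argMVar {M n : ℕ} {c : Cls} :
      Ξ.ar M = some (c, n) → c.IsObj →
      IsPattern Ξ .arg (Arg.abstrs n (.mvar M n fun i => .bvar (Fin.rev i)))
  | argTy {q : Arg S} : IsPattern Ξ .ty q → IsPattern Ξ .arg q
  | argTm {q : Arg S} : IsPattern Ξ .tm q → IsPattern Ξ .arg q

/-! ## Chains of basic instantiations -/

section Chains

variable {S : Signature.{u}}

/-- The instantiation `M ↦ M̂` by generic applications. -/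
def genInst (Ξ : MCtx S) : Inst S :=
  Ξ.map fun q => (q.1, Arg.genApp q.1 q.2.arity)

/-- The composition of instantiations `J ∘ I`, with `(J ∘ I)(M) = J_* (I(M))`. -/
def Inst.comp (J I : Inst S) : Inst S :=
  I.map fun q => (q.1, q.2.act J)

/-- The basic instantiation of `Ξ` which sends `M` to `e` and the other metavariables to their
generic applications. -/
def basicInst (Ξ : MCtx S) (M : ℕ) (e : Arg S) : Inst S :=
  Ξ.map fun q => (q.1, if q.1 = M then e else Arg.genApp q.1 q.2.arity)

/-- The metavariable context over which the basic instantiation is defined: `M` is removed, and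
the `j`-th boundary is acted upon by the restriction of the basic instantiation to the preceding
metavariables. -/
def basicCod (Ξ : MCtx S) (M : ℕ) (e : Arg S) : MCtx S :=
  (Ξ.mapIdx fun j q => (q.1, q.2.act ((basicInst Ξ M e).take j))).filter fun q => q.1 ≠ M

/-- The chain of basic instantiations determined by an instantiation `I` of `Ξ` over `Θ` and a
sequence `N` of metavariables of `Ξ`: the codomain together with the composed instantiation
of `Ξ`. -/
def chain (Ξ Θ : MCtx S) (I : Inst S) (N : List ℕ) : MCtx S × Inst S :=
  N.foldl
    (fun p M =>
      (basicCod p.1 M ((I.lookup M).getD .dummyTy),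
        (basicInst p.1 M ((I.lookup M).getD .dummyTy)).comp p.2))
    (Θ ++ Ξ, genInst Ξ)

/-- The metavariable context of the chain. -/
def chainCod (Ξ Θ : MCtx S) (I : Inst S) (N : List ℕ) : MCtx S := (chain Ξ Θ I N).1

/-- The composed instantiation of `Ξ` over the metavariable context of the chain. -/
def chainInst (Ξ Θ : MCtx S) (I : Inst S) (N : List ℕ) : Inst S := (chain Ξ Θ I N).2

end Chains

end FTT

/-! The chain is extended by induction on the pattern. A metavariable `M` can be appended once every
metavariable in its boundary `Ξ(M)` has been instantiated. Then `F(N)` and `I` act alike on `Ξ(M)`,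
so in `C(N)` the boundary of `M` is `I_*(Ξ(M))`. If moreover `(I_*(Ξ(M)))[I(M)]` is derivable over
`Θ`, which remains a prefix of `C(N)`, then the basic instantiation of `M` by `I(M)` is derivable.
This is `chain_step`.

For a pattern `S(q₁, …, qₙ)`, inversion (`Derivable.sym_inv`) is applied both to the judgement over
`Ξ` and to its instance over `Θ`. It makes the premises of the rule of `S` derivable, instantiated
by the `qᵢ` and by the `I_* qᵢ` respectively. The arguments are treated from left to right: the
boundary of the `k`-th premise, instantiated by the earlier arguments, mentions only metavariables
of those arguments, and the chain already contains these.

When `q_k` is a generic application of `M`, derivability alone would not identify this instantiated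
boundary with `Ξ(M)`, because a conversion may intervene. Naturality for variables has no conversion
rule and makes the two boundaries syntactically equal (`Natural.lookup_eq`); hence the metavariables
of `Ξ(M)` are already in the chain. At the root nothing need be known about the boundary: inversion
for a symbol does not look at it, and a type metavariable without arguments has a boundary without
metavariables.

The rest is metatheory. Derivability is preserved by simultaneous instantiation and substitution
(`Derivable.tr_aux`), and equal substitutions give equal instances (`Derivable.eq_aux`). Together
they show that derivable instantiations preserve derivability (`Derivable.act`), which is what makes
basic instantiations and their composites derivable. -/

namespace FTT

variable {S : Signature.{u}}

namespace Arg

/-! ## Substitution for bound variables -/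

/-- The substitution sending the index `0` to `t` and the index `i + 1` to `ρ i`. -/
def scons (t : Arg S) (ρ : ℕ → Arg S) : ℕ → Arg S
  | 0 => t
  | i + 1 => ρ i

theorem up_bvar_comp (ρ : ℕ → ℕ) :
    up (fun i => (bvar (ρ i) : Arg S)) = fun i => bvar (upRen ρ i) := by
  funext i; cases i <;> rfl

theorem rename_eq_subst (e : Arg S) (ρ : ℕ → ℕ) :
    e.rename ρ = e.subst fun i => bvar (ρ i) := by
  induction e generalizing ρ with
  | abstr e ih => simp [rename, subst, ih, up_bvar_comp]
  | _ => simp_all [rename, subst]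

theorem up_bvar : up (bvar : ℕ → Arg S) = bvar := by
  funext i; cases i <;> rfl

theorem subst_bvar (e : Arg S) : e.subst bvar = e := by
  induction e with
  | abstr e ih => simp [subst, ih, up_bvar]
  | _ => simp_all [subst]

theorem subst_rename_left (e : Arg S) (ρ : ℕ → ℕ) (σ : ℕ → Arg S) :
    (e.rename ρ).subst σ = e.subst fun i => σ (ρ i) := by
  induction e generalizing ρ σ with
  | abstr e ih =>
    simp only [rename, subst, ih, abstr.injEq]
    congr 1; funext i; cases i <;> rfl
  | _ => simp_all [rename, subst]

theorem rename_rename (e : Arg S) (ρ τ : ℕ → ℕ) :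
    (e.rename ρ).rename τ = e.rename fun i => τ (ρ i) := by
  rw [rename_eq_subst (e.rename ρ), subst_rename_left, ← rename_eq_subst e (fun i => τ (ρ i))]

theorem rename_subst (e : Arg S) (σ : ℕ → Arg S) (ρ : ℕ → ℕ) :
    (e.subst σ).rename ρ = e.subst fun i => (σ i).rename ρ := by
  induction e generalizing ρ σ with
  | abstr e ih =>
    simp only [rename, subst, ih, abstr.injEq]
    congr 1; funext i
    cases i with
    | zero => rfl
    | succ i => simp only [up, rename_rename]; rfl
  | _ => simp_all [rename, subst]

theorem subst_subst (e : Arg S) (σ τ : ℕ → Arg S) :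
    (e.subst σ).subst τ = e.subst fun i => (σ i).subst τ := by
  induction e generalizing σ τ with
  | abstr e ih =>
    simp only [subst, ih, abstr.injEq]
    congr 1; funext i
    cases i with
    | zero => rfl
    | succ i => simp only [up, subst_rename_left, rename_subst]
  | _ => simp_all [subst]

theorem subst_up_single (e t : Arg S) (ρ : ℕ → Arg S) :
    (e.subst (up ρ)).subst (single t) = e.subst (scons t ρ) := by
  rw [subst_subst]; congr 1; funext i
  cases i with
  | zero => rfl
  | succ i =>
    simp only [up, subst_rename_left, scons]
    exact subst_bvar (ρ i)

/-! ## Scoping of bound variables -/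

/-- All the loose indices of an argument are smaller than `k`. -/
def LC : ℕ → Arg S → Prop
  | _, fvar _ => True
  | k, bvar i => i < k
  | k, sym _ es => ∀ i, (es i).LC k
  | k, mvar _ _ ts => ∀ i, (ts i).LC k
  | _, dummyTy => True
  | _, dummyTm => True
  | k, abstr e => e.LC (k + 1)

theorem LC.mono {e : Arg S} {k l : ℕ} (h : e.LC k) (hkl : k ≤ l) : e.LC l := by
  induction e generalizing k l with
  | bvar i => exact lt_of_lt_of_le h hkl
  | sym s es ih => exact fun i => ih i (h i) hkl
  | mvar M n ts ih => exact fun i => ih i (h i) hkl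
  | abstr e ih => exact ih (k := k + 1) h (by omega)
  | _ => trivial

theorem LC.body {e : Arg S} {k : ℕ} (h : e.LC k) : e.body.LC (k + 1) := by
  cases e with
  | abstr e => exact h
  | _ => exact h.mono (Nat.le_succ k)

theorem LC.strip {e : Arg S} {k : ℕ} (h : e.LC k) (n : ℕ) : (e.strip n).LC (k + n) := by
  induction n generalizing e k with
  | zero => exact h
  | succ n ih =>
    have := ih h.body
    rwa [Nat.add_right_comm] at this

theorem LC.subst_congr {e : Arg S} {k : ℕ} (h : e.LC k) {σ τ : ℕ → Arg S}
    (hστ : ∀ i < k, σ i = τ i) : e.subst σ = e.subst τ := by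
  induction e generalizing k σ τ with
  | bvar i => exact hστ i h
  | sym s es ih => simp only [subst, sym.injEq, heq_eq_eq, true_and]; exact funext fun i => ih i (h i) hστ
  | mvar M n ts ih =>
    simp only [subst, mvar.injEq, heq_eq_eq, true_and]; exact funext fun i => ih i (h i) hστ
  | abstr e ih =>
    simp only [subst, abstr.injEq]
    refine ih (k := k + 1) h fun i hi => ?_
    cases i with
    | zero => rfl
    | succ i => simp only [up, hστ i (by omega)]
  | _ => rfl

theorem LC.subst_eq {e : Arg S} (h : e.LC 0) (σ : ℕ → Arg S) : e.subst σ = e := by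
  rw [h.subst_congr (τ := bvar) (by simp), subst_bvar]

theorem LC.rename_eq {e : Arg S} (h : e.LC 0) (ρ : ℕ → ℕ) : e.rename ρ = e := by
  rw [rename_eq_subst, h.subst_eq]

/-! ## Abstractions -/

/-- The argument has at least `n` outermost abstractions. -/
def HasAbs : ℕ → Arg S → Prop
  | 0, _ => True
  | n + 1, e => ∃ f, e = abstr f ∧ f.HasAbs n

theorem hasAbs_abstrs (n : ℕ) (e : Arg S) : (abstrs n e).HasAbs n := by
  induction n with
  | zero => trivial
  | succ n ih => exact ⟨_, rfl, ih⟩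

theorem strip_abstrs (n : ℕ) (e : Arg S) : (abstrs n e).strip n = e := by
  induction n with
  | zero => rfl
  | succ n ih => exact ih

theorem HasAbs.abstrs_strip {n : ℕ} {e : Arg S} (h : e.HasAbs n) : abstrs n (e.strip n) = e := by
  induction n generalizing e with
  | zero => rfl
  | succ n ih =>
    obtain ⟨f, rfl, hf⟩ := h
    simp only [abstrs, strip, body, ih hf]

theorem HasAbs.subst {n : ℕ} {e : Arg S} (h : e.HasAbs n) (ρ : ℕ → Arg S) :
    (e.subst ρ).HasAbs n := by
  induction n generalizing e ρ with
  | zero => trivial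
  | succ n ih =>
    obtain ⟨f, rfl, hf⟩ := h
    exact ⟨_, rfl, ih hf _⟩

/-- Without an outer abstraction this fails: `body` is then the identity, whereas substitution may
replace a bound variable by an abstraction. -/
theorem body_subst {n : ℕ} {e : Arg S} (h : e.HasAbs (n + 1)) (ρ : ℕ → Arg S) :
    (e.subst ρ).body = e.body.subst (up ρ) := by
  obtain ⟨f, rfl, -⟩ := h; rfl

theorem HasAbs.body {n : ℕ} {e : Arg S} (h : e.HasAbs (n + 1)) : e.body.HasAbs n := by
  obtain ⟨f, rfl, hf⟩ := h; exact hf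

/-! ## Simultaneous instantiation of metavariables and free variables -/

/-- The simultaneous action of an instantiation and of a substitution for free variables. -/
def tr (I : Inst S) (σ : ℕ → Arg S) : Arg S → Arg S
  | fvar a => σ a
  | bvar i => bvar i
  | sym s es => sym s fun i => (es i).tr I σ
  | mvar M n ts =>
    match I.lookup M with
    | some e => (e.strip n).subst (vec fun i => (ts i).tr I σ)
    | none => mvar M n fun i => (ts i).tr I σ
  | dummyTy => dummyTy
  | dummyTm => dummyTm
  | abstr e => abstr (e.tr I σ)

theorem act_eq_tr (I : Inst S) (e : Arg S) : e.act I = e.tr I fvar := by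
  induction e with
  | mvar M n ts ih => rcases h : I.lookup M <;> simp only [act, tr, ih, h]
  | _ => simp_all [act, tr]

theorem act_eq_tr' (I : Inst S) : act I = tr I fvar := funext (act_eq_tr I)

theorem tr_mvar_some {I : Inst S} {M : ℕ} {e : Arg S} (h : I.lookup M = some e) (σ : ℕ → Arg S)
    {n : ℕ} (ts : Fin n → Arg S) :
    (mvar M n ts).tr I σ = (e.strip n).subst (vec fun i => (ts i).tr I σ) := by
  simp only [tr, h]

theorem tr_mvar_none {I : Inst S} {M : ℕ} (h : I.lookup M = none) (σ : ℕ → Arg S)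
    {n : ℕ} (ts : Fin n → Arg S) :
    (mvar M n ts).tr I σ = mvar M n fun i => (ts i).tr I σ := by
  simp only [tr, h]

/-- The entries of the instantiation and of the substitution have no loose indices. -/
def Closed (I : Inst S) (σ : ℕ → Arg S) : Prop :=
  (∀ M e, I.lookup M = some e → e.LC 0) ∧ ∀ a, (σ a).LC 0

theorem vec_of_lt {n : ℕ} (ts : Fin n → Arg S) {i : ℕ} (h : i < n) :
    vec ts i = ts (Fin.rev ⟨i, h⟩) := by simp [vec, h]

theorem tr_rename {I : Inst S} {σ : ℕ → Arg S} (hc : Closed I σ) (e : Arg S) (ρ : ℕ → ℕ) :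
    (e.rename ρ).tr I σ = (e.tr I σ).rename ρ := by
  induction e generalizing ρ with
  | fvar a => exact ((hc.2 a).rename_eq ρ).symm
  | mvar M n ts ih =>
    rcases h : I.lookup M with _ | f
    · simp only [rename, tr_mvar_none h, ih]
    · simp only [rename, tr_mvar_some h, ih, rename_subst]
      -- The two substitutions differ at indices `≥ n`, but the entry is closed, so its stripped
      -- form has loose indices below `n` only.
      refine ((hc.1 _ _ h).strip n).subst_congr fun i hi => ?_
      simp only [Nat.zero_add] at hi
      simp only [vec_of_lt _ hi]
  | _ => simp_all [rename, tr]

theorem tr_up {I : Inst S} {σ : ℕ → Arg S} (hc : Closed I σ) (ρ : ℕ → Arg S) :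
    (fun i => (up ρ i).tr I σ) = up fun i => (ρ i).tr I σ := by
  funext i
  cases i with
  | zero => rfl
  | succ i => simp only [up, tr_rename hc]

theorem tr_subst {I : Inst S} {σ : ℕ → Arg S} (hc : Closed I σ) (e : Arg S) (ρ : ℕ → Arg S) :
    (e.subst ρ).tr I σ = (e.tr I σ).subst fun i => (ρ i).tr I σ := by
  induction e generalizing ρ with
  | fvar a => exact ((hc.2 a).subst_eq _).symm
  | mvar M n ts ih =>
    rcases h : I.lookup M with _ | f
    · simp only [subst, tr_mvar_none h, ih]
    · simp only [subst, tr_mvar_some h, ih, subst_subst]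
      refine ((hc.1 _ _ h).strip n).subst_congr fun i hi => ?_
      simp only [Nat.zero_add] at hi
      simp only [vec_of_lt _ hi]
  | abstr e ih => simp only [subst, tr, ih, tr_up hc]
  | _ => simp_all [subst, tr]

theorem tr_subst_single {I : Inst S} {σ : ℕ → Arg S} (hc : Closed I σ) (e t : Arg S) :
    (e.subst (single t)).tr I σ = (e.tr I σ).subst (single (t.tr I σ)) := by
  rw [tr_subst hc]; congr 1; funext i; cases i <;> rfl

theorem body_tr {n : ℕ} {e : Arg S} (h : e.HasAbs (n + 1)) (I : Inst S) (σ : ℕ → Arg S) :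
    (e.tr I σ).body = e.body.tr I σ := by
  obtain ⟨f, rfl, -⟩ := h; rfl

theorem strip_tr {n : ℕ} {e : Arg S} (h : e.HasAbs n) (I : Inst S) (σ : ℕ → Arg S) :
    (e.tr I σ).strip n = (e.strip n).tr I σ := by
  induction n generalizing e with
  | zero => rfl
  | succ n ih =>
    obtain ⟨f, rfl, hf⟩ := h
    exact ih hf

/-! ## Validity -/

variable {ar ar' : ℕ → Option (Cls × ℕ)} {V V' : Set ℕ}

theorem Valid.lc {k : ℕ} {cn : Cls × ℕ} {e : Arg S} (h : e.Valid ar V k cn) : e.LC k := by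
  induction h with
  | bvar h => exact h
  | sym _ ih => exact ih
  | mvar _ _ _ ih => exact ih
  | abstr _ ih => exact ih
  | _ => trivial

theorem Valid.hasAbs {k : ℕ} {cn : Cls × ℕ} {e : Arg S} (h : e.Valid ar V k cn) :
    e.HasAbs cn.2 := by
  induction h with
  | abstr _ ih => exact ⟨_, rfl, ih⟩
  | _ => trivial

theorem Valid.mono {k l : ℕ} {cn : Cls × ℕ} {e : Arg S} (h : e.Valid ar V k cn)
    (har : ∀ M c, ar M = some c → ar' M = some c) (hV : V ⊆ V') (hkl : k ≤ l) :
    e.Valid ar' V' l cn := by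
  induction h generalizing l with
  | fvar h => exact .fvar (hV h)
  | bvar h => exact .bvar (by omega)
  | sym _ ih => exact .sym fun i => ih i hkl
  | mvar h hc _ ih => exact .mvar (har _ _ h) hc fun i => ih i hkl
  | dummyTy => exact .dummyTy
  | dummyTm => exact .dummyTm
  | abstr _ ih => exact .abstr (ih (by omega))

theorem Valid.rename {k l : ℕ} {cn : Cls × ℕ} {e : Arg S} (h : e.Valid ar V k cn) {ρ : ℕ → ℕ}
    (hρ : ∀ i < k, ρ i < l) : (e.rename ρ).Valid ar V l cn := by
  induction h generalizing l ρ with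
  | fvar h => exact .fvar h
  | bvar h => exact .bvar (hρ _ h)
  | sym _ ih => exact .sym fun i => ih i hρ
  | mvar h hc _ ih => exact .mvar h hc fun i => ih i hρ
  | dummyTy => exact .dummyTy
  | dummyTm => exact .dummyTm
  | abstr _ ih =>
    refine .abstr (ih fun i hi => ?_)
    cases i with
    | zero => exact Nat.succ_pos _
    | succ i => exact Nat.succ_lt_succ (hρ i (by omega))

theorem Valid.subst {k l : ℕ} {cn : Cls × ℕ} {e : Arg S} (h : e.Valid ar V k cn)
    {ρ : ℕ → Arg S} (hρ : ∀ i < k, (ρ i).Valid ar V l (.tm, 0)) :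
    (e.subst ρ).Valid ar V l cn := by
  induction h generalizing l ρ with
  | fvar h => exact .fvar h
  | bvar h => exact hρ _ h
  | sym _ ih => exact .sym fun i => ih i hρ
  | mvar h hc _ ih => exact .mvar h hc fun i => ih i hρ
  | dummyTy => exact .dummyTy
  | dummyTm => exact .dummyTm
  | abstr _ ih =>
    refine .abstr (ih fun i hi => ?_)
    cases i with
    | zero => exact .bvar (Nat.succ_pos _)
    | succ i => exact (hρ i (by omega)).rename fun i hi => Nat.succ_lt_succ hi

theorem Valid.body {k n : ℕ} {c : Cls} {e : Arg S} (h : e.Valid ar V k (c, n + 1)) :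
    e.body.Valid ar V (k + 1) (c, n) := by
  cases h; assumption

theorem Valid.strip {k n : ℕ} {c : Cls} {e : Arg S} (h : e.Valid ar V k (c, n)) :
    (e.strip n).Valid ar V (k + n) (c, 0) := by
  induction n generalizing k e with
  | zero => exact h
  | succ n ih =>
    have := ih h.body
    rwa [Nat.add_right_comm] at this

theorem Valid.single {t : Arg S} (h : t.Valid ar V 0 (.tm, 0)) {k : ℕ} :
    ∀ i < k + 1, (single t i).Valid ar V k (.tm, 0) := by
  intro i hi
  cases i with
  | zero => exact h.mono (fun _ _ h => h) subset_rfl (Nat.zero_le _)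
  | succ i => exact .bvar (by omega)

/-- The pair of an instantiation and a substitution is well formed: it takes arguments over
metavariables with arities `ar` and free variables `V` to arguments over `ar'` and `V'`. -/
structure TrOK (ar : ℕ → Option (Cls × ℕ)) (V : Set ℕ) (ar' : ℕ → Option (Cls × ℕ)) (V' : Set ℕ)
    (I : Inst S) (σ : ℕ → Arg S) : Prop where
  mvar : ∀ M c, ar M = some c →
    (I.lookup M = none ∧ ar' M = some c) ∨ ∃ f, I.lookup M = some f ∧ f.Valid ar' V' 0 c
  fvar : ∀ a ∈ V, (σ a).Valid ar' V' 0 (.tm, 0)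

theorem Valid.tr {I : Inst S} {σ : ℕ → Arg S} (hok : TrOK ar V ar' V' I σ) {k : ℕ} {cn : Cls × ℕ}
    {e : Arg S} (h : e.Valid ar V k cn) : (e.tr I σ).Valid ar' V' k cn := by
  induction h with
  | fvar h => exact (hok.fvar _ h).mono (fun _ _ h => h) subset_rfl (Nat.zero_le _)
  | bvar h => exact .bvar h
  | sym _ ih => exact .sym ih
  | @mvar k M n c ts h hc _ ih =>
    rcases hok.mvar _ _ h with ⟨h1, h2⟩ | ⟨f, h1, h2⟩
    · rw [tr_mvar_none h1]
      exact .mvar h2 hc ih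
    · rw [tr_mvar_some h1]
      refine h2.strip.subst fun i hi => ?_
      rw [Nat.zero_add] at hi
      rw [vec_of_lt _ hi]
      exact ih _
  | dummyTy => exact .dummyTy
  | dummyTm => exact .dummyTm
  | abstr _ ih => exact .abstr ih

theorem Valid.tr_congr {I J : Inst S} {σ τ : ℕ → Arg S} {k : ℕ} {cn : Cls × ℕ} {e : Arg S}
    (h : e.Valid ar V k cn) (hIJ : ∀ M c, ar M = some c → I.lookup M = J.lookup M)
    (hστ : ∀ a ∈ V, σ a = τ a) : e.tr I σ = e.tr J τ := by
  induction h with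
  | fvar h => exact hστ _ h
  | sym _ ih => simp only [Arg.tr, ih]
  | mvar h hc _ ih => simp only [Arg.tr, ih, hIJ _ _ h]
  | abstr _ ih => simp only [Arg.tr, ih]
  | _ => rfl

/-! ### Generic applications of metavariables -/

theorem genApp_valid {k M n : ℕ} {c : Cls} (h : ar M = some (c, n)) :
    (genApp M (c, n) : Arg S).Valid ar V k (c, n) := by
  have key : ∀ (m k : ℕ) (e : Arg S), e.Valid ar V (k + m) (c, 0) →
      (abstrs m e).Valid ar V k (c, m) := by
    intro m
    induction m with
    | zero => exact fun _ _ h => h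
    | succ m ih => exact fun k e he => .abstr (ih _ _ (by rwa [Nat.add_right_comm]))
  cases c with
  | ty => exact key _ _ _ (.mvar h trivial fun i => .bvar (by have := i.rev.isLt; omega))
  | tm => exact key _ _ _ (.mvar h trivial fun i => .bvar (by have := i.rev.isLt; omega))
  | eqTy => exact key _ _ _ .dummyTy
  | eqTm => exact key _ _ _ .dummyTm

theorem genApp_of_isObj {M n : ℕ} {c : Cls} (h : c.IsObj) :
    (genApp M (c, n) : Arg S) = abstrs n (.mvar M n fun i => .bvar (Fin.rev i)) := by
  cases c <;> first | rfl | exact h.elim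

theorem genApp_strip_subst {M n : ℕ} {c : Cls} (h : c.IsObj) (ts : Fin n → Arg S) :
    ((genApp M (c, n)).strip n).subst (vec ts) = mvar M n ts := by
  rw [genApp_of_isObj h, strip_abstrs]
  simp only [subst, mvar.injEq, heq_eq_eq, true_and]
  funext i
  rw [vec_of_lt _ i.rev.isLt, Fin.eta, Fin.rev_rev]

theorem hasAbs_genApp (M : ℕ) (c : Cls × ℕ) : (genApp M c : Arg S).HasAbs c.2 := by
  obtain ⟨c, n⟩ := c
  cases c <;> exact hasAbs_abstrs _ _

/-- An argument is fixed by an instantiation by generic applications. -/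
theorem Valid.act_eq_self {I : Inst S} {k : ℕ} {cn : Cls × ℕ} {e : Arg S}
    (h : e.Valid ar V k cn)
    (hI : ∀ M c, ar M = some c → I.lookup M = none ∨ I.lookup M = some (genApp M c)) :
    e.act I = e := by
  induction h with
  | sym _ ih => simp only [act, ih]
  | @mvar k M n c ts h hc _ ih =>
    rcases hI _ _ h with h | h
    · simp only [act, h, ih]
    · simp only [act, h, ih, genApp_strip_subst hc]
  | abstr _ ih => simp only [act, ih]
  | _ => rfl

/-- Below its abstractions a valid argument of an equality class can only be a dummy, since
variables, symbols and metavariable applications have object class. Dummies carry no name, hence the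
arbitrary `M`. -/
theorem Valid.abstrs_dummy {k n : ℕ} {c : Cls} {e : Arg S} (h : e.Valid ar V k (c, n))
    (hc : ¬ c.IsObj) (M : ℕ) : e = genApp M (c, n) := by
  induction n generalizing k e with
  | zero =>
    cases h with
    | sym => exact (hc (S.arity _).isObj).elim
    | mvar _ h => exact (hc h).elim
    | dummyTy => rfl
    | dummyTm => rfl
    | fvar => exact (hc trivial).elim
    | bvar => exact (hc trivial).elim
  | succ n ih =>
    cases h with
    | abstr h =>
      rw [ih h]
      cases c <;> first | rfl | exact (hc trivial).elim

theorem vec_bvar_rev {n i : ℕ} (h : i < n) :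
    vec (fun j : Fin n => (bvar (Fin.rev j) : Arg S)) i = bvar i := by
  rw [vec_of_lt _ h]; simp

theorem abstrs_tr (n : ℕ) (e : Arg S) (I : Inst S) (σ : ℕ → Arg S) :
    (abstrs n e).tr I σ = abstrs n (e.tr I σ) := by
  induction n with
  | zero => rfl
  | succ n ih => simp only [abstrs, tr, ih]

/-- The action of an instantiation on a generic application. -/
theorem genApp_tr {I : Inst S} {M : ℕ} {c : Cls × ℕ} {f : Arg S} (hI : I.lookup M = some f)
    (hf : f.Valid ar V 0 c) (σ : ℕ → Arg S) : (genApp M c).tr I σ = f := by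
  obtain ⟨c, n⟩ := c
  by_cases hc : c.IsObj
  · rw [genApp_of_isObj hc, abstrs_tr, tr_mvar_some hI]
    have hs := hf.lc.strip n
    rw [Nat.zero_add] at hs
    -- The arguments of the generic application are the indices `n - 1, …, 0`, so every index below
    -- `n` is replaced by itself, and `f.strip n` has no other loose index.
    rw [hs.subst_congr (τ := bvar), subst_bvar]
    · exact HasAbs.abstrs_strip (hf.hasAbs)
    · intro i hi
      exact vec_bvar_rev hi
  · rw [hf.abstrs_dummy hc M]
    cases c <;> first | exact (hc trivial).elim | simp [genApp, abstrs_tr, tr]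

/-! ## Composition -/

theorem lookup_map (K : Inst S) (f : Arg S → Arg S) (M : ℕ) :
    (List.map (fun q => (q.1, f q.2)) K).lookup M = (K.lookup M).map f := by
  induction K with
  | nil => rfl
  | cons q K ih =>
    obtain ⟨a, e⟩ := q
    by_cases h : M = a
    · subst h; simp
    · have : (M == a) = false := by simpa using h
      simp only [List.map_cons, List.lookup_cons, this, ih]

theorem tr_vec {n : ℕ} (ts : Fin n → Arg S) (I : Inst S) (σ : ℕ → Arg S) (i : ℕ) :
    (vec ts i).tr I σ = vec (fun j => (ts j).tr I σ) i := by
  unfold vec; split <;> rfl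

/-- The action of an instantiation after an instantiation `K` of all the metavariables of a term
without free variables. -/
theorem Valid.act_tr {I K : Inst S} {σ : ℕ → Arg S} (hc : Closed I σ) {k : ℕ} {cn : Cls × ℕ}
    {e : Arg S} (h : e.Valid ar ∅ k cn)
    (hK : ∀ M c, ar M = some c → ∃ f, K.lookup M = some f ∧ f.HasAbs c.2) :
    (e.act K).tr I σ = e.act (K.map fun q => (q.1, q.2.tr I σ)) := by
  induction h with
  -- As `e` has no free variables, `σ` reaches only the entries of `K`.
  | fvar h => exact h.elim
  | sym _ ih => simp only [Arg.act, Arg.tr, ih]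
  | @mvar k M n c ts h _ _ ih =>
    obtain ⟨f, h1, h2⟩ := hK _ _ h
    have h3 : (List.map (fun q => (q.1, q.2.tr I σ)) K).lookup M = some (f.tr I σ) := by
      rw [lookup_map K (Arg.tr I σ), h1]; rfl
    rw [act_eq_tr, act_eq_tr, tr_mvar_some h1, tr_mvar_some h3, tr_subst hc, strip_tr h2]
    congr 1; funext i
    simp only [tr_vec, ← act_eq_tr, ih]
  | abstr _ ih => simp only [Arg.act, Arg.tr, ih]
  | _ => rfl

end Arg

/-! ## Operations on judgements and boundaries -/

def ABdry.tr (I : Inst S) (σ : ℕ → Arg S) : ABdry S → ABdry S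
  | thesis b => thesis (b.map (Arg.tr I σ))
  | abstr A B => abstr (A.tr I σ) (B.tr I σ)

def AJdg.tr (I : Inst S) (σ : ℕ → Arg S) : AJdg S → AJdg S
  | thesis j => thesis (j.map (Arg.tr I σ))
  | abstr A J => abstr (A.tr I σ) (J.tr I σ)

theorem Bdry.map_map (f g : Arg S → Arg S) (b : Bdry S) :
    (b.map f).map g = b.map fun e => g (f e) := by cases b <;> rfl

theorem Thesis.map_map (f g : Arg S → Arg S) (j : Thesis S) :
    (j.map f).map g = j.map fun e => g (f e) := by cases j <;> rfl

theorem Bdry.map_plug (f : Arg S → Arg S) (b : Bdry S) (e : Arg S) :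
    (b.plug e).map f = (b.map f).plug (f e) := by cases b <;> rfl

theorem Bdry.map_plugEq (f : Arg S → Arg S) (b : Bdry S) (e e' : Arg S) :
    (b.plugEq e e').map f = (b.map f).plugEq (f e) (f e') := by cases b <;> rfl

theorem Bdry.cls_map (f : Arg S → Arg S) (b : Bdry S) : (b.map f).cls = b.cls := by
  cases b <;> rfl

theorem Bdry.isObj_map (f : Arg S → Arg S) (b : Bdry S) : (b.map f).IsObj ↔ b.IsObj := by
  cases b <;> rfl

variable {ar ar' : ℕ → Option (Cls × ℕ)} {V V' : Set ℕ}

theorem Thesis.Valid.map {k k' : ℕ} {f : Arg S → Arg S}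
    (hf : ∀ e cn, e.Valid ar V k cn → (f e).Valid ar' V' k' cn) {j : Thesis S}
    (h : j.Valid ar V k) : (j.map f).Valid ar' V' k' := by
  cases j with
  | isTy A => exact hf _ _ h
  | tm t A => exact ⟨hf _ _ h.1, hf _ _ h.2⟩
  | eqTy A B => exact ⟨hf _ _ h.1, hf _ _ h.2⟩
  | eqTm s t A => exact ⟨hf _ _ h.1, hf _ _ h.2.1, hf _ _ h.2.2⟩

theorem Bdry.Valid.map {k k' : ℕ} {f : Arg S → Arg S}
    (hf : ∀ e cn, e.Valid ar V k cn → (f e).Valid ar' V' k' cn) {b : Bdry S}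
    (h : b.Valid ar V k) : (b.map f).Valid ar' V' k' := by
  cases b with
  | ty => trivial
  | tm A => exact hf _ _ h
  | eqTy A B => exact ⟨hf _ _ h.1, hf _ _ h.2⟩
  | eqTm s t A => exact ⟨hf _ _ h.1, hf _ _ h.2.1, hf _ _ h.2.2⟩

theorem Thesis.Valid.map_congr {k : ℕ} {f g : Arg S → Arg S}
    (hf : ∀ e cn, e.Valid ar V k cn → f e = g e) {j : Thesis S} (h : j.Valid ar V k) :
    j.map f = j.map g := by
  cases j with
  | isTy A => simp only [Thesis.map, hf _ _ h]
  | tm t A => simp only [Thesis.map, hf _ _ h.1, hf _ _ h.2]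
  | eqTy A B => simp only [Thesis.map, hf _ _ h.1, hf _ _ h.2]
  | eqTm s t A => simp only [Thesis.map, hf _ _ h.1, hf _ _ h.2.1, hf _ _ h.2.2]

theorem Bdry.Valid.map_congr {k : ℕ} {f g : Arg S → Arg S}
    (hf : ∀ e cn, e.Valid ar V k cn → f e = g e) {b : Bdry S} (h : b.Valid ar V k) :
    b.map f = b.map g := by
  cases b with
  | ty => rfl
  | tm A => simp only [Bdry.map, hf _ _ h]
  | eqTy A B => simp only [Bdry.map, hf _ _ h.1, hf _ _ h.2]
  | eqTm s t A => simp only [Bdry.map, hf _ _ h.1, hf _ _ h.2.1, hf _ _ h.2.2]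

theorem Bdry.map_id' {f : Arg S → Arg S} (hf : ∀ e, f e = e) (b : Bdry S) : b.map f = b := by
  cases b <;> simp only [Bdry.map, hf]

theorem Bdry.Valid.plug {k : ℕ} {b : Bdry S} {e : Arg S} (h : b.Valid ar V k)
    (he : e.Valid ar V k (b.cls, 0)) : (b.plug e).Valid ar V k := by
  cases b with
  | ty => exact he
  | tm A => exact ⟨he, h⟩
  | eqTy A B => exact h
  | eqTm s t A => exact h

theorem Bdry.valid_of_plug {k : ℕ} {b : Bdry S} {e : Arg S} (h : (b.plug e).Valid ar V k) :
    b.Valid ar V k := by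
  cases b with
  | ty => trivial
  | tm A => exact h.2
  | eqTy A B => exact h
  | eqTm s t A => exact h

theorem Bdry.valid_head_of_plug {k : ℕ} {b : Bdry S} {e : Arg S} (hb : b.IsObj)
    (h : (b.plug e).Valid ar V k) : e.Valid ar V k (b.cls, 0) := by
  cases b with
  | ty => exact h
  | tm A => exact h.1
  | eqTy A B => exact hb.elim
  | eqTm s t A => exact hb.elim

namespace ABdry

theorem act_eq_tr (I : Inst S) (B : ABdry S) : B.act I = B.tr I .fvar := by
  induction B with
  | thesis b => simp only [act, tr, Arg.act_eq_tr']
  | abstr A B ih => simp only [act, tr, Arg.act_eq_tr, ih]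

theorem arity_tr (B : ABdry S) (I : Inst S) (σ : ℕ → Arg S) : (B.tr I σ).arity = B.arity := by
  induction B with
  | thesis b => simp only [tr, arity, Bdry.cls_map]
  | abstr A B ih => simp only [tr, arity, ih]

theorem arity_act (B : ABdry S) (I : Inst S) : (B.act I).arity = B.arity := by
  rw [act_eq_tr, arity_tr]

theorem arity_subst (B : ABdry S) (ρ : ℕ → Arg S) : (B.subst ρ).arity = B.arity := by
  induction B generalizing ρ with
  | thesis b => simp only [subst, arity, Bdry.cls_map]
  | abstr A B ih => simp only [subst, arity, ih]

theorem plug_tr (B : ABdry S) {e : Arg S} (he : e.HasAbs B.arity.2) (I : Inst S)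
    (σ : ℕ → Arg S) : (B.plug e).tr I σ = (B.tr I σ).plug (e.tr I σ) := by
  induction B generalizing e with
  | thesis b => simp only [plug, tr, AJdg.tr, Bdry.map_plug]
  | abstr A B ih => simp only [plug, tr, AJdg.tr, ih (Arg.HasAbs.body he), Arg.body_tr he]

theorem plugEq_tr (B : ABdry S) {e f : Arg S} (he : e.HasAbs B.arity.2) (hf : f.HasAbs B.arity.2)
    (I : Inst S) (σ : ℕ → Arg S) :
    (B.plugEq e f).tr I σ = (B.tr I σ).plugEq (e.tr I σ) (f.tr I σ) := by
  induction B generalizing e f with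
  | thesis b => simp only [plugEq, tr, AJdg.tr, Bdry.map_plugEq]
  | abstr A B ih =>
    simp only [plugEq, tr, AJdg.tr, ih (Arg.HasAbs.body he) (Arg.HasAbs.body hf),
      Arg.body_tr he, Arg.body_tr hf]

theorem plug_subst (B : ABdry S) {e : Arg S} (he : e.HasAbs B.arity.2) (ρ : ℕ → Arg S) :
    (B.plug e).subst ρ = (B.subst ρ).plug (e.subst ρ) := by
  induction B generalizing e ρ with
  | thesis b => simp only [plug, subst, AJdg.subst, Bdry.map_plug]
  | abstr A B ih => simp only [plug, subst, AJdg.subst, ih (Arg.HasAbs.body he), Arg.body_subst he]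

theorem tr_subst {I : Inst S} {σ : ℕ → Arg S} (hc : Arg.Closed I σ) (B : ABdry S)
    (ρ : ℕ → Arg S) : (B.subst ρ).tr I σ = (B.tr I σ).subst fun i => (ρ i).tr I σ := by
  induction B generalizing ρ with
  | thesis b => simp only [subst, tr, Bdry.map_map, Arg.tr_subst hc]
  | abstr A B ih => simp only [subst, tr, ih, Arg.tr_subst hc, Arg.tr_up hc]

theorem tr_subst_single {I : Inst S} {σ : ℕ → Arg S} (hc : Arg.Closed I σ) (B : ABdry S)
    (t : Arg S) :
    (B.subst (Arg.single t)).tr I σ = (B.tr I σ).subst (Arg.single (t.tr I σ)) := by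
  rw [tr_subst hc]; congr 1; funext i; cases i <;> rfl

theorem subst_subst (B : ABdry S) (σ τ : ℕ → Arg S) :
    (B.subst σ).subst τ = B.subst fun i => (σ i).subst τ := by
  induction B generalizing σ τ with
  | thesis b => simp only [subst, Bdry.map_map, Arg.subst_subst]
  | abstr A B ih =>
    simp only [subst, ih, Arg.subst_subst, abstr.injEq, true_and]
    congr 1; funext i
    cases i with
    | zero => rfl
    | succ i => simp only [Arg.up, Arg.subst_rename_left, Arg.rename_subst]

theorem subst_bvar (B : ABdry S) : B.subst Arg.bvar = B := by
  induction B with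
  | thesis b => simp only [subst, Bdry.map_id' Arg.subst_bvar]
  | abstr A B ih => simp only [subst, Arg.up_bvar, Arg.subst_bvar, ih]

theorem subst_up_single (B : ABdry S) (t : Arg S) (ρ : ℕ → Arg S) :
    (B.subst (Arg.up ρ)).subst (Arg.single t) = B.subst (Arg.scons t ρ) := by
  rw [subst_subst]; congr 1; funext i
  cases i with
  | zero => rfl
  | succ i =>
    simp only [Arg.up, Arg.subst_rename_left, Arg.scons]
    exact Arg.subst_bvar (ρ i)

theorem Valid.tr {I : Inst S} {σ : ℕ → Arg S} (hok : Arg.TrOK ar V ar' V' I σ) {k : ℕ}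
    {B : ABdry S} (h : B.Valid ar V k) : (B.tr I σ).Valid ar' V' k := by
  induction B generalizing k with
  | thesis b => exact Bdry.Valid.map (fun _ _ h => h.tr hok) h
  | abstr A B ih => exact ⟨h.1.tr hok, ih h.2⟩

theorem Valid.mono {k : ℕ} {B : ABdry S} (h : B.Valid ar V k)
    (har : ∀ M c, ar M = some c → ar' M = some c) (hV : V ⊆ V') : B.Valid ar' V' k := by
  induction B generalizing k with
  | thesis b =>
    have := Bdry.Valid.map (f := id) (fun _ _ h => h.mono har hV le_rfl) h
    rwa [Bdry.map_id' (f := id) fun _ => rfl] at this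
  | abstr A B ih => exact ⟨h.1.mono har hV le_rfl, ih h.2⟩

theorem Valid.subst_single {k : ℕ} {B : ABdry S} (h : B.Valid ar V (k + 1)) {ρ : ℕ → Arg S}
    (hρ : ∀ i < k + 1, (ρ i).Valid ar V k (.tm, 0)) :
    (B.subst ρ).Valid ar V k := by
  have key : ∀ (B : ABdry S) (k l : ℕ) (ρ : ℕ → Arg S), B.Valid ar V k →
      (∀ i < k, (ρ i).Valid ar V l (.tm, 0)) → (B.subst ρ).Valid ar V l := by
    intro B
    induction B with
    | thesis b => exact fun k l ρ h hρ => Bdry.Valid.map (fun _ _ h => h.subst hρ) h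
    | abstr A B ih =>
      refine fun k l ρ h hρ => ⟨h.1.subst hρ, ih (k + 1) (l + 1) _ h.2 fun i hi => ?_⟩
      cases i with
      | zero => exact .bvar (Nat.succ_pos _)
      | succ i => exact (hρ i (by omega)).rename fun i hi => Nat.succ_lt_succ hi
  exact key B _ _ _ h hρ

theorem Valid.tr_congr {I J : Inst S} {σ τ : ℕ → Arg S} {k : ℕ} {B : ABdry S}
    (h : B.Valid ar V k) (hIJ : ∀ M c, ar M = some c → I.lookup M = J.lookup M)
    (hστ : ∀ a ∈ V, σ a = τ a) : B.tr I σ = B.tr J τ := by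
  induction B generalizing k with
  | thesis b => exact congrArg _ (Bdry.Valid.map_congr (fun _ _ h => h.tr_congr hIJ hστ) h)
  | abstr A B ih => simp only [ABdry.tr, ih h.2, h.1.tr_congr hIJ hστ]

theorem Valid.act_eq_self {I : Inst S} {k : ℕ} {B : ABdry S} (h : B.Valid ar V k)
    (hI : ∀ M c, ar M = some c → I.lookup M = none ∨ I.lookup M = some (Arg.genApp M c)) :
    B.act I = B := by
  induction B generalizing k with
  | thesis b =>
    have := Bdry.Valid.map_congr (f := Arg.act I) (g := id) (fun _ _ h => h.act_eq_self hI) h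
    rw [Bdry.map_id' (f := id) fun _ => rfl] at this
    exact congrArg _ this
  | abstr A B ih => simp only [ABdry.act, ih h.2, h.1.act_eq_self hI]

theorem Valid.act_tr {I K : Inst S} {σ : ℕ → Arg S} (hc : Arg.Closed I σ) {k : ℕ}
    {B : ABdry S} (h : B.Valid ar ∅ k)
    (hK : ∀ M c, ar M = some c → ∃ f, K.lookup M = some f ∧ f.HasAbs c.2) :
    (B.act K).tr I σ = B.act (K.map fun q => (q.1, q.2.tr I σ)) := by
  induction B generalizing k with
  | thesis b =>
    refine congrArg thesis ?_
    rw [Bdry.map_map]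
    exact Bdry.Valid.map_congr (fun _ _ h => h.act_tr hc hK) h
  | abstr A B ih => simp only [ABdry.act, ABdry.tr, ih h.2, h.1.act_tr hc hK]

theorem Valid.plug {k : ℕ} {B : ABdry S} {e : Arg S} (h : B.Valid ar V k)
    (he : e.Valid ar V k B.arity) : (B.plug e).Valid ar V k := by
  induction B generalizing k e with
  | thesis b => exact Bdry.Valid.plug h he
  | abstr A B ih => exact ⟨h.1, ih h.2 he.body⟩

theorem valid_of_plug {k : ℕ} {B : ABdry S} {e : Arg S} (h : (B.plug e).Valid ar V k) :
    B.Valid ar V k := by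
  induction B generalizing k e with
  | thesis b => exact Bdry.valid_of_plug h
  | abstr A B ih => exact ⟨h.1, ih h.2⟩

theorem exists_eq_abstrs (B : ABdry S) : ∃ As b, B = abstrs As b := by
  induction B with
  | thesis b => exact ⟨[], b, rfl⟩
  | abstr A B ih =>
    obtain ⟨As, b, rfl⟩ := ih
    exact ⟨A :: As, b, rfl⟩

theorem arity_abstrs (As : List (Arg S)) (b : Bdry S) :
    (abstrs As b).arity = (b.cls, As.length) := by
  induction As with
  | nil => rfl
  | cons A As ih => simp only [abstrs, arity, ih, List.length_cons]

end ABdry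

namespace AJdg

theorem tr_subst {I : Inst S} {σ : ℕ → Arg S} (hc : Arg.Closed I σ) (J : AJdg S)
    (ρ : ℕ → Arg S) : (J.subst ρ).tr I σ = (J.tr I σ).subst fun i => (ρ i).tr I σ := by
  induction J generalizing ρ with
  | thesis b => simp only [subst, tr, Thesis.map_map, Arg.tr_subst hc]
  | abstr A J ih => simp only [subst, tr, ih, Arg.tr_subst hc, Arg.tr_up hc]

theorem tr_subst_single {I : Inst S} {σ : ℕ → Arg S} (hc : Arg.Closed I σ) (J : AJdg S)
    (t : Arg S) :
    (J.subst (Arg.single t)).tr I σ = (J.tr I σ).subst (Arg.single (t.tr I σ)) := by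
  rw [tr_subst hc]; congr 1; funext i; cases i <;> rfl

theorem Valid.tr {I : Inst S} {σ : ℕ → Arg S} (hok : Arg.TrOK ar V ar' V' I σ) {k : ℕ}
    {J : AJdg S} (h : J.Valid ar V k) : (J.tr I σ).Valid ar' V' k := by
  induction J generalizing k with
  | thesis b => exact Thesis.Valid.map (fun _ _ h => h.tr hok) h
  | abstr A B ih => exact ⟨h.1.tr hok, ih h.2⟩

theorem Valid.tr_congr {I J : Inst S} {σ τ : ℕ → Arg S} {k : ℕ} {B : AJdg S}
    (h : B.Valid ar V k) (hIJ : ∀ M c, ar M = some c → I.lookup M = J.lookup M)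
    (hστ : ∀ a ∈ V, σ a = τ a) : B.tr I σ = B.tr J τ := by
  induction B generalizing k with
  | thesis b => exact congrArg _ (Thesis.Valid.map_congr (fun _ _ h => h.tr_congr hIJ hστ) h)
  | abstr A B ih => simp only [AJdg.tr, ih h.2, h.1.tr_congr hIJ hστ]

end AJdg

/-! ## Equations between the two instances of a judgement -/

/-- The equation between the heads of two object theses. -/
def Thesis.eqj : Thesis S → Thesis S → Thesis S
  | isTy A, isTy B => eqTy A B
  | tm t A, tm s _ => eqTm t s A
  | j, _ => j

/-- The abstracted equation between the heads of two abstracted object judgements. -/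
def AJdg.eqj : AJdg S → AJdg S → AJdg S
  | thesis j, thesis j' => thesis (j.eqj j')
  | abstr A J, abstr _ J' => abstr A (J.eqj J')
  | J, _ => J

theorem Thesis.eqj_map (f : Arg S → Arg S) (j j' : Thesis S) :
    (j.map f).eqj (j'.map f) = (j.eqj j').map f := by
  cases j <;> cases j' <;> rfl

theorem AJdg.eqj_subst (J J' : AJdg S) (ρ : ℕ → Arg S) :
    (J.subst ρ).eqj (J'.subst ρ) = (J.eqj J').subst ρ := by
  induction J generalizing J' ρ with
  | thesis j =>
    cases J' with
    | thesis j' => simp only [subst, eqj, Thesis.eqj_map]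
    | abstr => rfl
  | abstr A J ih =>
    cases J' with
    | thesis j' => rfl
    | abstr => simp only [subst, eqj, ih]

theorem Thesis.Valid.eqj {k : ℕ} {j j' : Thesis S} (h : j.Valid ar V k) (h' : j'.Valid ar V k) :
    (j.eqj j').Valid ar V k := by
  cases j <;> cases j' <;> first | exact h | skip
  · exact ⟨h, h'⟩
  · exact ⟨h.1, h'.1, h.2⟩

theorem AJdg.Valid.eqj {k : ℕ} {J J' : AJdg S} (h : J.Valid ar V k) (h' : J'.Valid ar V k) :
    (J.eqj J').Valid ar V k := by
  induction J generalizing J' k with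
  | thesis j =>
    cases J' with
    | thesis j' => exact Thesis.Valid.eqj h h'
    | abstr => exact h
  | abstr A J ih =>
    cases J' with
    | thesis j' => exact h
    | abstr => exact ⟨h.1, ih h.2 h'.2⟩

/-- `eqj` takes the type of the equation from its first argument, so only the class of the second
boundary matters. -/
theorem Bdry.eqj_plug {b b' : Bdry S} (hb : b.IsObj) (h : b'.cls = b.cls) (e f : Arg S) :
    (b.plug e).eqj (b'.plug f) = b.plugEq e f := by
  cases b <;> first | exact hb.elim | skip
  all_goals cases b' <;> first | rfl | cases h

theorem ABdry.eqj_plug {B B' : ABdry S} (hB : B.IsObj) (h : B'.arity = B.arity) (e f : Arg S) :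
    (B.plug e).eqj (B'.plug f) = B.plugEq e f := by
  induction B generalizing B' e f with
  | thesis b =>
    cases B' with
    | thesis b' => exact congrArg AJdg.thesis (Bdry.eqj_plug hB (congrArg Prod.fst h) e f)
    | abstr => cases congrArg Prod.snd h
  | abstr A B ih =>
    cases B' with
    | thesis b' => cases congrArg Prod.snd h
    | abstr A' B' =>
      simp only [ABdry.arity, Prod.mk.injEq, Nat.add_right_cancel_iff] at h
      exact congrArg (AJdg.abstr A) (ih hB (Prod.ext h.1 h.2) _ _)

/-! ## Spines of arguments -/

/-- The substitution of a list of arguments for the innermost variables, extending `ρ`. -/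
def Arg.vecL : List (Arg S) → (ℕ → Arg S) → ℕ → Arg S
  | [], ρ => ρ
  | t :: l, ρ => vecL l (scons t ρ)

theorem Arg.vecL_add (l : List (Arg S)) (ρ : ℕ → Arg S) (i : ℕ) :
    vecL l ρ (i + l.length) = ρ i := by
  induction l generalizing ρ i with
  | nil => rfl
  | cons t l ih =>
    rw [List.length_cons, Nat.add_comm l.length, ← Nat.add_assoc, vecL, ih]; rfl

/-- `vecL` conses the entries in order, so the last one gets index `0`: positions in the list run
opposite to indices. -/
theorem Arg.vecL_lt (l : List (Arg S)) (ρ : ℕ → Arg S) (i j : ℕ) (h : i + j + 1 = l.length) :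
    some (vecL l ρ i) = l[j]? := by
  induction l generalizing ρ j with
  | nil => simp at h
  | cons t l ih =>
    cases j with
    | zero =>
      simp only [List.length_cons] at h
      have : i = 0 + l.length := by omega
      rw [this, vecL, vecL_add]; rfl
    | succ j =>
      rw [vecL, ih _ j (by simp only [List.length_cons] at h; omega)]; rfl

theorem Arg.vec_eq_vecL {n : ℕ} (ts : Fin n → Arg S) : vec ts = vecL (List.ofFn ts) bvar := by
  funext i
  by_cases h : i < n
  · rw [vec_of_lt ts h]
    have := vecL_lt (List.ofFn ts) bvar i (n - 1 - i) (by simp; omega)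
    apply Option.some.inj
    rw [this, List.getElem?_ofFn, dif_pos (by omega)]
    congr 2
    ext; simp [Fin.rev]; omega
  · have := vecL_add (List.ofFn ts) bvar (i - n)
    rw [List.length_ofFn, Nat.sub_add_cancel (by omega)] at this
    rw [this]; simp [vec, h]

theorem Arg.vecUpto_eq_vecL {n : ℕ} (ts : Fin n → Arg S) (j : Fin n) :
    vecUpto ts j = vecL ((List.ofFn ts).take j) bvar := by
  rw [vecUpto, vec_eq_vecL]
  congr 1
  apply List.ext_getElem?
  intro i
  rw [List.getElem?_ofFn, List.getElem?_take, List.getElem?_ofFn]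
  by_cases h : i < j
  · have : i < n := h.trans j.isLt
    simp [h, this]
  · simp [h]

/-- The application of an abstraction to a list of arguments. -/
def Arg.instL : List (Arg S) → Arg S → Arg S
  | [], e => e
  | t :: l, e => instL l (e.body.subst (single t))

/-- Carrying a substitution `ρ` makes the induction work: applying an abstraction to one more
argument pushes that argument onto `ρ`. -/
theorem Arg.instL_subst (l : List (Arg S)) {e : Arg S} (he : e.HasAbs l.length) (ρ : ℕ → Arg S) :
    (e.subst ρ).instL l = (e.strip l.length).subst (vecL l ρ) := by
  induction l generalizing e ρ with
  | nil => rfl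
  | cons t l ih =>
    obtain ⟨f, rfl, hf⟩ := he
    simp only [Arg.subst, instL, body, subst_up_single, ih hf, List.length_cons, strip, vecL]

theorem Arg.instL_eq {n : ℕ} (ts : Fin n → Arg S) {e : Arg S} (he : e.HasAbs n) :
    e.instL (List.ofFn ts) = (e.strip n).subst (vec ts) := by
  have := instL_subst (List.ofFn ts) (e := e) (by simpa using he) bvar
  rw [subst_bvar, List.length_ofFn] at this
  rw [this, vec_eq_vecL]

/-- The application of an abstracted boundary to a list of arguments. -/
def ABdry.inst : List (Arg S) → ABdry S → Bdry S
  | _, thesis b => b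
  | t :: l, abstr _ B => inst l (B.subst (Arg.single t))
  | [], abstr _ _ => .ty

theorem ABdry.inst_tr {I : Inst S} {σ : ℕ → Arg S} (hc : Arg.Closed I σ) (l : List (Arg S))
    (B : ABdry S) : (B.inst l).map (Arg.tr I σ) = (B.tr I σ).inst (l.map (Arg.tr I σ)) := by
  induction l generalizing B with
  | nil => cases B <;> rfl
  | cons t l ih =>
    cases B with
    | thesis b => rfl
    | abstr A B => simp only [inst, ih, tr, List.map_cons, tr_subst_single hc]

theorem ABdry.inst_abstrs (As : List (Arg S)) (b : Bdry S) (l : List (Arg S))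
    (hl : l.length = As.length) (ρ : ℕ → Arg S) :
    ((abstrs As b).subst ρ).inst l = b.map (Arg.subst (Arg.vecL l ρ)) := by
  induction As generalizing l ρ with
  | nil =>
    obtain rfl := List.length_eq_zero_iff.1 hl
    rfl
  | cons A As ih =>
    obtain _ | ⟨t, l⟩ := l
    · cases hl
    · simp only [abstrs, subst, inst, subst_up_single, ih l (by simpa using hl), Arg.vecL]

theorem ABdry.inst_ofFn {As : List (Arg S)} (b : Bdry S) (ts : Fin As.length → Arg S) :
    (abstrs As b).inst (List.ofFn ts) = b.map (Arg.subst (Arg.vec ts)) := by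
  have := inst_abstrs As b (List.ofFn ts) (by simp) Arg.bvar
  rwa [subst_bvar, ← Arg.vec_eq_vecL] at this

/-- The length hypothesis excludes the default `.ty`, which `inst` returns when there are too few
arguments. -/
theorem ABdry.isObj_inst {B : ABdry S} {l : List (Arg S)} (h : l.length = B.arity.2) :
    (B.inst l).cls = B.arity.1 := by
  induction l generalizing B with
  | nil =>
    cases B with
    | thesis b => rfl
    | abstr A B => cases h
  | cons t l ih =>
    cases B with
    | thesis b => rfl
    | abstr A B =>
      rw [inst, ih (by rw [arity_subst]; simpa [arity] using h), arity_subst]; rfl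

section Spine

variable {α : Type*} {π : α → Arg S}

/-- `Spine π D l B`: the arguments `π t`, for `t` in the list `l`, match the abstracted variables
of `B`, and each `t` is related by `D` to the type of the corresponding variable. -/
def Spine (π : α → Arg S) (D : α → Arg S → Prop) : List α → ABdry S → Prop
  | [], .thesis _ => True
  | t :: l, .abstr A B => D t A ∧ Spine π D l (B.subst (Arg.single (π t)))
  | [], .abstr _ _ => False
  | _ :: _, .thesis _ => False

theorem Spine.length {D : α → Arg S → Prop} {l : List α} {B : ABdry S} (h : Spine π D l B) :
    l.length = B.arity.2 := by
  induction l generalizing B with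
  | nil =>
    cases B with
    | thesis b => rfl
    | abstr A B => exact h.elim
  | cons t l ih =>
    cases B with
    | thesis b => exact h.elim
    | abstr A B =>
      have := ih h.2
      rw [ABdry.arity_subst] at this
      simp [ABdry.arity, this]

/-- Entries of an arbitrary type with a projection `π` cover both single terms (`π = id`) and pairs
of terms to be equated (`π` the first or second component). The types of later variables depend on
earlier entries through `π`, which is why `g` must be compatible with the projections. -/
theorem Spine.map {β : Type*} {π' : β → Arg S} {g : α → β} {D : β → Arg S → Prop}
    {I : Inst S} {σ : ℕ → Arg S} (hc : Arg.Closed I σ) (hg : ∀ t, π' (g t) = (π t).tr I σ)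
    {l : List α} {B : ABdry S} (h : Spine π (fun t A => D (g t) (A.tr I σ)) l B) :
    Spine π' D (l.map g) (B.tr I σ) := by
  induction l generalizing B with
  | nil => cases B <;> exact h
  | cons t l ih =>
    cases B with
    | thesis b => exact h
    | abstr A B =>
      refine ⟨h.1, ?_⟩
      have := ih h.2
      rwa [ABdry.tr_subst_single hc, ← hg] at this

theorem spine_abstrs {D : α → Arg S → Prop} (As : List (Arg S)) (b : Bdry S) (l : List α)
    (ρ : ℕ → Arg S) :
    Spine π D l ((ABdry.abstrs As b).subst ρ) ↔ l.length = As.length ∧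
      ∀ (j : ℕ) (t : α) (A : Arg S), l[j]? = some t → As[j]? = some A →
        D t (A.subst (Arg.vecL ((l.map π).take j) ρ)) := by
  induction As generalizing l ρ with
  | nil =>
    cases l with
    | nil => simp [ABdry.abstrs, ABdry.subst, Spine]
    | cons t l => simp [ABdry.abstrs, ABdry.subst, Spine]
  | cons A As ih =>
    cases l with
    | nil => simp [ABdry.abstrs, ABdry.subst, Spine]
    | cons t l =>
      simp only [ABdry.abstrs, ABdry.subst, Spine, ABdry.subst_up_single, ih, List.length_cons,
        Nat.add_right_cancel_iff]
      constructor
      · rintro ⟨h0, h1, h2⟩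
        refine ⟨h1, fun j t' A' ht hA => ?_⟩
        cases j with
        | zero =>
          obtain rfl : t = t' := by simpa using ht
          obtain rfl : A = A' := by simpa using hA
          exact h0
        | succ j => exact h2 j t' A' (by simpa using ht) (by simpa using hA)
      · rintro ⟨h1, h2⟩
        exact ⟨h2 0 t A rfl rfl, h1, fun j t' A' ht hA => h2 (j + 1) t' A' (by simpa using ht)
          (by simpa using hA)⟩

/-- Translates between the indexed premises of the metavariable rules and the recursive form, which
suits inductions that remove one abstraction at a time. -/
theorem spine_ofFn {D : α → Arg S → Prop} {As : List (Arg S)} {b : Bdry S}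
    {ts : Fin As.length → α} :
    Spine π D (List.ofFn ts) (ABdry.abstrs As b) ↔
      ∀ j, D (ts j) ((As.get j).subst (Arg.vecUpto (fun i => π (ts i)) j)) := by
  have := spine_abstrs (π := π) (D := D) As b (List.ofFn ts) Arg.bvar
  rw [ABdry.subst_bvar] at this
  rw [this]
  have hmap : (List.ofFn ts).map π = List.ofFn fun i => π (ts i) := List.map_ofFn
  simp only [List.length_ofFn, true_and, hmap, Arg.vecUpto_eq_vecL]
  constructor
  · exact fun h j => h j _ _ (by simp) (by simp)
  · intro h j t A ht hA
    have hj : j < As.length := by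
      by_contra hj
      rw [List.getElem?_eq_none (by omega)] at hA
      cases hA
    have := h ⟨j, hj⟩
    simp only [List.getElem?_ofFn, hj, dite_true, Option.some.injEq] at ht
    rw [List.getElem?_eq_getElem hj, Option.some.injEq] at hA
    rw [← ht, ← hA]
    exact this

end Spine

/-- The application of a metavariable to a list of arguments. -/
def Arg.mvarL (M : ℕ) (l : List (Arg S)) : Arg S := mvar M l.length l.get

theorem Arg.mvarL_ofFn (M : ℕ) {n : ℕ} (ts : Fin n → Arg S) :
    mvarL M (List.ofFn ts) = mvar M n ts := by
  -- With the length as a variable `n`, the equation `h` can be eliminated without transport between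
  -- types `Fin`.
  have key : ∀ (l : List (Arg S)) (n : ℕ) (h : l.length = n) (ts : Fin n → Arg S),
      (∀ i, ts i = l.get (i.cast h.symm)) → mvarL M l = mvar M n ts := by
    rintro l _ rfl ts h
    rw [mvarL, funext h]; rfl
  exact key _ _ (by simp) _ (by simp)

/-- The action of an instantiation on the application of a metavariable. -/
def appI (I : Inst S) (M : ℕ) (l : List (Arg S)) : Arg S :=
  match I.lookup M with
  | some e => e.instL l
  | none => .mvarL M l

theorem tr_mvar {I : Inst S} {M n : ℕ} (hI : ∀ f, I.lookup M = some f → f.HasAbs n)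
    (σ : ℕ → Arg S) (ts : Fin n → Arg S) :
    (Arg.mvar M n ts).tr I σ = appI I M ((List.ofFn ts).map (Arg.tr I σ)) := by
  have hmap : (List.ofFn ts).map (Arg.tr I σ) = List.ofFn fun i => (ts i).tr I σ :=
    List.map_ofFn
  rcases h : I.lookup M with _ | f
  · simp only [appI, h, hmap, Arg.mvarL_ofFn, Arg.tr_mvar_none h]
  · simp only [appI, h, hmap, Arg.instL_eq _ (hI f h), Arg.tr_mvar_some h]

/-! ## Contexts -/

section Lookup

variable {X : Type u}

theorem exists_getElem?_of_lookup {L : List (ℕ × X)} {a : ℕ} {x : X} (h : L.lookup a = some x) :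
    ∃ k : ℕ, L[k]? = some (a, x) := by
  induction L with
  | nil => cases h
  | cons q L ih =>
    obtain ⟨b, y⟩ := q
    rw [List.lookup_cons] at h
    by_cases hab : a = b
    · subst hab
      simp only [beq_self_eq_true, Option.some.injEq] at h
      exact ⟨0, by simp [h]⟩
    · have : (a == b) = false := by simpa using hab
      rw [this] at h
      obtain ⟨k, hk⟩ := ih h
      exact ⟨k + 1, hk⟩

theorem mem_dom_of_getElem? {L : List (ℕ × X)} {k a : ℕ} {x : X} (h : L[k]? = some (a, x)) :
    a ∈ dom L :=
  List.mem_map_of_mem (f := Prod.fst) (List.mem_of_getElem? h)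

theorem mem_dom_of_lookup {L : List (ℕ × X)} {a : ℕ} {x : X} (h : L.lookup a = some x) :
    a ∈ dom L := by
  obtain ⟨k, hk⟩ := exists_getElem?_of_lookup h
  exact mem_dom_of_getElem? hk

theorem lookup_eq_none {L : List (ℕ × X)} {a : ℕ} (h : a ∉ dom L) : L.lookup a = none := by
  rcases h' : L.lookup a with _ | x
  · rfl
  · exact (h (mem_dom_of_lookup h')).elim

theorem exists_lookup {L : List (ℕ × X)} {a : ℕ} (h : a ∈ dom L) : ∃ x, L.lookup a = some x := by
  induction L with
  | nil => exact absurd h List.not_mem_nil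
  | cons q L ih =>
    obtain ⟨b, y⟩ := q
    rw [List.lookup_cons]
    by_cases hab : a = b
    · subst hab; exact ⟨y, by simp⟩
    · have hb : (a == b) = false := by simpa using hab
      rw [hb]
      refine ih ?_
      rcases List.mem_cons.1 h with h | h
      · exact (hab h).elim
      · exact h

theorem lookup_of_getElem? {L : List (ℕ × X)} (hL : (L.map Prod.fst).Nodup) {k a : ℕ} {x : X}
    (h : L[k]? = some (a, x)) : L.lookup a = some x := by
  induction L generalizing k with
  | nil => simp at h
  | cons q L ih =>
    obtain ⟨b, y⟩ := q
    rw [List.lookup_cons]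
    simp only [List.map_cons, List.nodup_cons] at hL
    cases k with
    | zero =>
      simp only [List.getElem?_cons_zero, Option.some.injEq, Prod.mk.injEq] at h
      simp [h.1, h.2]
    | succ k =>
      simp only [List.getElem?_cons_succ] at h
      have hab : a ≠ b := by
        rintro rfl
        exact hL.1 (mem_dom_of_getElem? h)
      have hb : (a == b) = false := by simpa using hab
      rw [hb]
      exact ih hL.2 h

theorem lookup_append_left {L L' : List (ℕ × X)} {a : ℕ} {x : X} (h : L.lookup a = some x) :
    (L ++ L').lookup a = some x := by
  rw [List.lookup_append, h]; rfl

theorem lookup_append_right {L L' : List (ℕ × X)} {a : ℕ} (h : a ∉ dom L) :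
    (L ++ L').lookup a = L'.lookup a := by
  rw [List.lookup_append, lookup_eq_none h]; rfl

theorem lookup_append_single {L : List (ℕ × X)} {a : ℕ} (h : a ∉ dom L) (x : X) :
    (L ++ [(a, x)]).lookup a = some x := by
  rw [lookup_append_right h]; simp

theorem lookup_append_single_of_ne {L : List (ℕ × X)} {a b : ℕ} (h : b ≠ a) (x : X) :
    (L ++ [(a, x)]).lookup b = L.lookup b := by
  have hb : (b == a) = false := by simpa using h
  rw [List.lookup_append, List.lookup_cons, hb]
  cases L.lookup b <;> rfl

theorem lookup_take {L : List (ℕ × X)} {k a : ℕ} {x : X} (h : (L.take k).lookup a = some x) :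
    L.lookup a = some x := by
  rw [← List.take_append_drop k L]
  exact lookup_append_left h

theorem dom_append (L L' : List (ℕ × X)) : dom (L ++ L') = dom L ∪ dom L' := by
  ext a; simp [dom]

theorem dom_append_single (L : List (ℕ × X)) (a : ℕ) (x : X) :
    dom (L ++ [(a, x)]) = insert a (dom L) := by
  ext b; simp [dom, or_comm]

theorem dom_nil : dom ([] : List (ℕ × X)) = ∅ := by ext a; simp [dom]

theorem dom_take_subset (L : List (ℕ × X)) (k : ℕ) : dom (L.take k) ⊆ dom L := by
  conv_rhs => rw [← List.take_append_drop k L, dom_append]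
  exact Set.subset_union_left

theorem exists_fresh (L : List (ℕ × X)) : ∃ a, a ∉ dom L := by
  obtain ⟨a, ha⟩ := Infinite.exists_notMem_finset (L.map Prod.fst).toFinset
  exact ⟨a, fun h => ha (List.mem_toFinset.2 h)⟩

end Lookup

theorem MCtx.ar_of_lookup {Θ : MCtx S} {M : ℕ} {B : ABdry S} (h : Θ.lookup M = some B) :
    Θ.ar M = some B.arity := by simp [MCtx.ar, h]

theorem MCtx.exists_of_ar {Θ : MCtx S} {M : ℕ} {c : Cls × ℕ} (h : Θ.ar M = some c) :
    ∃ B, Θ.lookup M = some B ∧ B.arity = c := by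
  rcases h' : Θ.lookup M with _ | B
  · simp [MCtx.ar, h'] at h
  · exact ⟨B, rfl, by simpa [MCtx.ar, h'] using h⟩

theorem MCtx.ar_mono {Ξ Θ : MCtx S} (h : ∀ M B, Ξ.lookup M = some B → Θ.lookup M = some B)
    (M : ℕ) (c : Cls × ℕ) (hc : Ξ.ar M = some c) : Θ.ar M = some c := by
  obtain ⟨B, hB, rfl⟩ := exists_of_ar hc
  exact ar_of_lookup (h _ _ hB)

theorem MCtx.Valid.lookup {Θ : MCtx S} (h : Θ.Valid) {M : ℕ} {B : ABdry S}
    (hM : Θ.lookup M = some B) : B.Valid Θ.ar ∅ 0 := by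
  obtain ⟨k, hk⟩ := exists_getElem?_of_lookup hM
  exact (h.2 _ _ _ hk).mono (MCtx.ar_mono fun _ _ => lookup_take) subset_rfl

theorem VCtx.Valid.lookup {Θ : MCtx S} {Γ : VCtx S} (h : Γ.Valid Θ) {a : ℕ} {A : Arg S}
    (ha : Γ.lookup a = some A) : ValidTy Θ.ar (dom Γ) 0 A := by
  obtain ⟨k, hk⟩ := exists_getElem?_of_lookup ha
  exact (h.2 _ _ _ hk).mono (fun _ _ h => h) (dom_take_subset _ _) le_rfl

theorem VCtx.valid_nil (Θ : MCtx S) : VCtx.Valid Θ [] :=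
  ⟨List.nodup_nil, fun k a A h => by simp at h⟩

theorem VCtx.Valid.snoc {Θ : MCtx S} {Γ : VCtx S} (h : Γ.Valid Θ) {a : ℕ} (ha : a ∉ dom Γ)
    {A : Arg S} (hA : ValidTy Θ.ar (dom Γ) 0 A) : VCtx.Valid Θ (Γ ++ [(a, A)]) := by
  refine ⟨?_, fun k b B hk => ?_⟩
  · rw [List.map_append]
    refine List.nodup_append.2 ⟨h.1, by simp, ?_⟩
    rintro x hx y hy rfl
    obtain rfl : x = a := by simpa using hy
    exact ha hx
  · rcases lt_trichotomy k Γ.length with hlt | heq | hgt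
    · rw [List.getElem?_append_left hlt] at hk
      rw [List.take_append_of_le_length hlt.le]
      exact h.2 _ _ _ hk
    · subst heq
      simp only [List.getElem?_concat_length, Option.some.injEq, Prod.mk.injEq] at hk
      rw [List.take_left' rfl, ← hk.2]
      exact hA
    · rw [List.getElem?_eq_none (by simp; omega)] at hk
      cases hk

namespace RawTT

variable {T : RawTT.{u, v} S}

theorem Derivable.valid {H : Hyp S} (h : T.Derivable H) : H.Valid := by
  cases h <;> assumption

/-- The metavariable rule for a list of arguments. -/
theorem Derivable.mvarL {Θ : MCtx S} {Γ : VCtx S} {M : ℕ} {B : ABdry S} {l : List (Arg S)}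
    (hM : Θ.lookup M = some B)
    (hl : Spine id (fun t A => T.Derivable (.jdg Θ Γ (.thesis (.tm t A)))) l B)
    (hb : T.Derivable (.bdry Θ Γ (.thesis (B.inst l))))
    (hv : Hyp.Valid (.jdg Θ Γ (.thesis ((B.inst l).plug (.mvarL M l))))) :
    T.Derivable (.jdg Θ Γ (.thesis ((B.inst l).plug (.mvarL M l)))) := by
  obtain ⟨As, b, rfl⟩ := B.exists_eq_abstrs
  have hlen := hl.length
  rw [ABdry.arity_abstrs] at hlen
  obtain ⟨ts, rfl⟩ : ∃ ts : Fin As.length → Arg S, l = List.ofFn ts :=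
    ⟨fun i => l.get (i.cast hlen.symm), by
      apply List.ext_getElem <;> simp [hlen]⟩
  rw [ABdry.inst_ofFn] at hb ⊢ hv
  rw [Arg.mvarL_ofFn] at hv ⊢
  exact .mvar hM (spine_ofFn.1 hl) hb hv

/-- The congruence rule for metavariables, for lists of arguments. -/
theorem Derivable.mvarLCongr {Θ : MCtx S} {Γ : VCtx S} {M : ℕ} {B : ABdry S}
    {l : List (Arg S × Arg S)} (hM : Θ.lookup M = some B) (hB : B.IsObj)
    (h1 : Spine Prod.fst (fun p A => T.Derivable (.jdg Θ Γ (.thesis (.tm p.1 A)))) l B)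
    (h2 : Spine Prod.snd (fun p A => T.Derivable (.jdg Θ Γ (.thesis (.tm p.2 A)))) l B)
    (h3 : Spine Prod.fst (fun p A => T.Derivable (.jdg Θ Γ (.thesis (.eqTm p.1 p.2 A)))) l B)
    (hC : ∀ C C', B.inst (l.map Prod.fst) = .tm C → B.inst (l.map Prod.snd) = .tm C' →
      T.Derivable (.jdg Θ Γ (.thesis (.eqTy C C'))))
    (hv : Hyp.Valid (.jdg Θ Γ (.thesis ((B.inst (l.map Prod.fst)).plugEq
      (.mvarL M (l.map Prod.fst)) (.mvarL M (l.map Prod.snd)))))) :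
    T.Derivable (.jdg Θ Γ (.thesis ((B.inst (l.map Prod.fst)).plugEq
      (.mvarL M (l.map Prod.fst)) (.mvarL M (l.map Prod.snd))))) := by
  obtain ⟨As, b, rfl⟩ := B.exists_eq_abstrs
  have hlen := h1.length
  rw [ABdry.arity_abstrs] at hlen
  obtain ⟨ts, rfl⟩ : ∃ ts : Fin As.length → Arg S × Arg S, l = List.ofFn ts :=
    ⟨fun i => l.get (i.cast hlen.symm), by
      apply List.ext_getElem <;> simp [hlen]⟩
  have e1 : (List.ofFn ts).map Prod.fst = List.ofFn fun i => (ts i).1 := List.map_ofFn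
  have e2 : (List.ofFn ts).map Prod.snd = List.ofFn fun i => (ts i).2 := List.map_ofFn
  rw [e1, e2] at hv ⊢
  rw [e1, e2] at hC
  simp only [ABdry.inst_ofFn, Arg.mvarL_ofFn] at hC hv ⊢
  have hobj : b.IsObj := by
    rw [ABdry.IsObj, ABdry.arity_abstrs] at hB; exact hB
  exact .mvarCongr hM hobj (spine_ofFn.1 h1) (spine_ofFn.1 h2) (spine_ofFn.1 h3)
    (fun C hb => hC _ _ (by rw [hb]; rfl) (by rw [hb]; rfl)) hv

/-! ## Interpretations of metavariables and substitutions -/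

/-- The instantiation `I` interprets the metavariables of `Ξ` (those not in its domain are
interpreted by themselves) over the metavariable context `Θ`, so that the metavariable rules are
admissible. -/
structure Interp (T : RawTT.{u, v} S) (Ξ Θ : MCtx S) (I : Inst S) : Prop where
  valid : Θ.Valid
  arity : ∀ M c, Ξ.ar M = some c →
    (I.lookup M = none ∧ Θ.ar M = some c) ∨ ∃ f, I.lookup M = some f ∧ f.Valid Θ.ar ∅ 0 c
  lc : ∀ M e, I.lookup M = some e → e.LC 0
  mvar : ∀ (Γ : VCtx S) (M : ℕ) (B : ABdry S) (l : List (Arg S)), Γ.Valid Θ →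
    Ξ.lookup M = some B →
    Spine id (fun t A => T.Derivable (.jdg Θ Γ (.thesis (.tm t A)))) l (B.act I) →
    T.Derivable (.bdry Θ Γ (.thesis ((B.act I).inst l))) →
    Hyp.Valid (.jdg Θ Γ (.thesis (((B.act I).inst l).plug (appI I M l)))) →
    T.Derivable (.jdg Θ Γ (.thesis (((B.act I).inst l).plug (appI I M l))))
  mvarCongr : ∀ (Γ : VCtx S) (M : ℕ) (B : ABdry S) (l : List (Arg S × Arg S)), Γ.Valid Θ →
    Ξ.lookup M = some B → B.IsObj →
    Spine Prod.fst (fun p A => T.Derivable (.jdg Θ Γ (.thesis (.tm p.1 A)))) l (B.act I) →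
    Spine Prod.snd (fun p A => T.Derivable (.jdg Θ Γ (.thesis (.tm p.2 A)))) l (B.act I) →
    Spine Prod.fst (fun p A => T.Derivable (.jdg Θ Γ (.thesis (.eqTm p.1 p.2 A)))) l (B.act I) →
    (∀ C C', (B.act I).inst (l.map Prod.fst) = .tm C → (B.act I).inst (l.map Prod.snd) = .tm C' →
      T.Derivable (.jdg Θ Γ (.thesis (.eqTy C C')))) →
    Hyp.Valid (.jdg Θ Γ (.thesis (((B.act I).inst (l.map Prod.fst)).plugEq
      (appI I M (l.map Prod.fst)) (appI I M (l.map Prod.snd))))) →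
    T.Derivable (.jdg Θ Γ (.thesis (((B.act I).inst (l.map Prod.fst)).plugEq
      (appI I M (l.map Prod.fst)) (appI I M (l.map Prod.snd)))))

/-- A class `Q` of typed terms which may be substituted for free variables. -/
structure Substitutable (T : RawTT.{u, v} S) (Θ : MCtx S) (Q : VCtx S → Arg S → Arg S → Prop) :
    Prop where
  der : ∀ Γ t A, Γ.Valid Θ → Q Γ t A → T.Derivable (.jdg Θ Γ (.thesis (.tm t A)))
  weak : ∀ Γ t A b B, Q Γ t A → VCtx.Valid Θ (Γ ++ [(b, B)]) → Q (Γ ++ [(b, B)]) t A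
  var : ∀ Γ a A, Γ.Valid Θ → Γ.lookup a = some A → Q Γ (.fvar a) A

/-- The substitution `σ` takes the variables of `Δ` to terms in the class `Q` over `Γ`. -/
structure IsSub (Q : VCtx S → Arg S → Arg S → Prop) (I : Inst S) (Θ : MCtx S) (Δ Γ : VCtx S)
    (σ : ℕ → Arg S) : Prop where
  ctx : Γ.Valid Θ
  lc : ∀ a, (σ a).LC 0
  sub : ∀ a A, Δ.lookup a = some A → Q Γ (σ a) (A.tr I σ)

variable {Ξ Θ : MCtx S} {I : Inst S} {Q : VCtx S → Arg S → Arg S → Prop} {Δ Γ : VCtx S}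
  {σ : ℕ → Arg S}

theorem IsSub.closed (hσ : IsSub Q I Θ Δ Γ σ) (hI : T.Interp Ξ Θ I) : Arg.Closed I σ :=
  ⟨hI.lc, hσ.lc⟩

theorem IsSub.trOK (hσ : IsSub Q I Θ Δ Γ σ) (hQ : T.Substitutable Θ Q) (hI : T.Interp Ξ Θ I) :
    Arg.TrOK Ξ.ar (dom Δ) Θ.ar (dom Γ) I σ where
  mvar M c h := (hI.arity M c h).imp_right fun ⟨f, h1, h2⟩ =>
    ⟨f, h1, h2.mono (fun _ _ h => h) (Set.empty_subset _) le_rfl⟩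
  fvar a ha := by
    obtain ⟨A, hA⟩ := exists_lookup ha
    exact (hQ.der _ _ _ hσ.ctx (hσ.sub _ _ hA)).valid.2.2.1

theorem IsSub.valid_jdg (hσ : IsSub Q I Θ Δ Γ σ) (hQ : T.Substitutable Θ Q)
    (hI : T.Interp Ξ Θ I) {J : AJdg S} (h : Hyp.Valid (.jdg Ξ Δ J)) :
    Hyp.Valid (.jdg Θ Γ (J.tr I σ)) :=
  ⟨hI.valid, hσ.ctx, h.2.2.tr (hσ.trOK hQ hI)⟩

theorem IsSub.valid_bdry (hσ : IsSub Q I Θ Δ Γ σ) (hQ : T.Substitutable Θ Q)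
    (hI : T.Interp Ξ Θ I) {B : ABdry S} (h : Hyp.Valid (.bdry Ξ Δ B)) :
    Hyp.Valid (.bdry Θ Γ (B.tr I σ)) :=
  ⟨hI.valid, hσ.ctx, h.2.2.tr (hσ.trOK hQ hI)⟩

theorem _root_.FTT.Arg.Valid.tr_update {e : Arg S} {k : ℕ} {cn : Cls × ℕ}
    {ar : ℕ → Option (Cls × ℕ)} {V : Set ℕ} {a : ℕ}
    (h : e.Valid ar V k cn) (ha : a ∉ V) (I : Inst S) (σ : ℕ → Arg S) (t : Arg S) :
    e.tr I (Function.update σ a t) = e.tr I σ :=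
  h.tr_congr (fun _ _ _ => rfl) fun b hb => Function.update_of_ne (by rintro rfl; exact ha hb) _ _

theorem _root_.FTT.Arg.Closed.update {I : Inst S} {σ : ℕ → Arg S} (hc : Arg.Closed I σ) (a : ℕ)
    {t : Arg S} (ht : t.LC 0) : Arg.Closed I (Function.update σ a t) := by
  refine ⟨hc.1, fun b => ?_⟩
  by_cases h : b = a
  · subst h; rwa [Function.update_self]
  · rw [Function.update_of_ne h]; exact hc.2 b

/-- Since `a` lies outside `V`, it does not occur in `J`, and updating `σ` at `a` affects only the
variable introduced by the opening. -/
theorem _root_.FTT.AJdg.Valid.open_tr {J : AJdg S} {ar : ℕ → Option (Cls × ℕ)} {V : Set ℕ} {a : ℕ}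
    (h : J.Valid ar V 1) (ha : a ∉ V) (hc : Arg.Closed I σ) {t : Arg S} (ht : t.LC 0) :
    (J.subst (Arg.single (.fvar a))).tr I (Function.update σ a t) =
      (J.tr I σ).subst (Arg.single t) := by
  rw [AJdg.tr_subst_single (hc.update a ht), Arg.tr, Function.update_self,
    h.tr_congr (J := I) (τ := σ) (fun _ _ _ => rfl) fun b hb =>
      Function.update_of_ne (by rintro rfl; exact ha hb) _ _]

theorem _root_.FTT.ABdry.Valid.open_tr {J : ABdry S} {ar : ℕ → Option (Cls × ℕ)} {V : Set ℕ}
    {a : ℕ} (h : J.Valid ar V 1) (ha : a ∉ V) (hc : Arg.Closed I σ) {t : Arg S} (ht : t.LC 0) :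
    (J.subst (Arg.single (.fvar a))).tr I (Function.update σ a t) =
      (J.tr I σ).subst (Arg.single t) := by
  rw [ABdry.tr_subst_single (hc.update a ht), Arg.tr, Function.update_self,
    h.tr_congr (J := I) (τ := σ) (fun _ _ _ => rfl) fun b hb =>
      Function.update_of_ne (by rintro rfl; exact ha hb) _ _]

/-- Extension of the domain of a substitution by a variable. -/
theorem IsSub.cons (hσ : IsSub Q I Θ Δ Γ σ) (hΔ : Δ.Valid Ξ) {a : ℕ} (ha : a ∉ dom Δ)
    {A : Arg S} (hA : ValidTy Ξ.ar (dom Δ) 0 A) {t : Arg S} (htl : t.LC 0)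
    (ht : Q Γ t (A.tr I σ)) : IsSub Q I Θ (Δ ++ [(a, A)]) Γ (Function.update σ a t) where
  ctx := hσ.ctx
  lc b := by
    by_cases h : b = a
    · subst h; rwa [Function.update_self]
    · rw [Function.update_of_ne h]; exact hσ.lc b
  sub b B hb := by
    by_cases h : b = a
    · subst h
      rw [lookup_append_single ha, Option.some.injEq] at hb
      rwa [Function.update_self, ← hb, hA.tr_update ha]
    · rw [lookup_append_single_of_ne h] at hb
      rw [Function.update_of_ne h, (hΔ.lookup hb).tr_update ha]
      exact hσ.sub _ _ hb

theorem IsSub.weak (hσ : IsSub Q I Θ Δ Γ σ) (hQ : T.Substitutable Θ Q) {b : ℕ} {B : Arg S}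
    (hB : VCtx.Valid Θ (Γ ++ [(b, B)])) : IsSub Q I Θ Δ (Γ ++ [(b, B)]) σ where
  ctx := hB
  lc := hσ.lc
  sub a A ha := hQ.weak _ _ _ _ _ (hσ.sub a A ha) hB

/-- Extension of a substitution under a binder. -/
theorem IsSub.extend (hσ : IsSub Q I Θ Δ Γ σ) (hQ : T.Substitutable Θ Q) (hΔ : Δ.Valid Ξ) {a : ℕ}
    (ha : a ∉ dom Δ) {A : Arg S} (hA : ValidTy Ξ.ar (dom Δ) 0 A) {b : ℕ} (hb : b ∉ dom Γ)
    (hA' : ValidTy Θ.ar (dom Γ) 0 (A.tr I σ)) :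
    IsSub Q I Θ (Δ ++ [(a, A)]) (Γ ++ [(b, A.tr I σ)]) (Function.update σ a (.fvar b)) :=
  (hσ.weak hQ (hσ.ctx.snoc hb hA')).cons hΔ ha hA trivial
    (hQ.var _ _ _ (hσ.ctx.snoc hb hA') (lookup_append_single hb _))

/-! ## Instances of rules -/

end RawTT

theorem IsInst.lookup {K : Inst S} {P Θ : MCtx S} {Γ : VCtx S} (h : IsInst K P Θ Γ) {M : ℕ}
    {c : Cls × ℕ} (hM : P.ar M = some c) :
    ∃ f, K.lookup M = some f ∧ f.Valid Θ.ar (dom Γ) 0 c := by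
  obtain ⟨B, hB, rfl⟩ := MCtx.exists_of_ar hM
  clear hM
  unfold IsInst at h
  induction h with
  | nil => cases hB
  | @cons p q K P h1 h2 ih =>
    obtain ⟨a, f⟩ := p
    obtain ⟨a', B'⟩ := q
    obtain ⟨rfl, h1⟩ := h1
    by_cases hab : M = a
    · subst hab
      simp only [List.lookup_cons, beq_self_eq_true, Option.some.injEq] at hB
      exact ⟨f, by simp, hB ▸ h1⟩
    · have hb : (M == a) = false := by simpa using hab
      rw [List.lookup_cons, hb] at hB
      obtain ⟨f', h3, h4⟩ := ih hB
      exact ⟨f', by rw [List.lookup_cons, hb]; exact h3, h4⟩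

theorem IsInst.take {K : Inst S} {P Θ : MCtx S} {Γ : VCtx S} (h : IsInst K P Θ Γ) (k : ℕ) :
    IsInst (K.take k) (P.take k) Θ Γ :=
  List.forall₂_take k h

theorem IsInst.getElem? {K : Inst S} {P Θ : MCtx S} {Γ : VCtx S} (h : IsInst K P Θ Γ) {k M M' : ℕ}
    {B : ABdry S} {e : Arg S} (hP : P[k]? = some (M, B)) (hK : K[k]? = some (M', e)) :
    M' = M ∧ e.Valid Θ.ar (dom Γ) 0 B.arity := by
  unfold IsInst at h
  induction h generalizing k with
  | nil => simp at hP
  | cons h1 h2 ih =>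
    cases k with
    | zero =>
      simp only [List.getElem?_cons_zero, Option.some.injEq] at hP hK
      subst hP hK
      exact h1
    | succ k => exact ih hP hK

theorem IsInst.exists_getElem? {K : Inst S} {P Θ : MCtx S} {Γ : VCtx S} (h : IsInst K P Θ Γ)
    {k M : ℕ} {B : ABdry S} (hP : P[k]? = some (M, B)) : ∃ e, K[k]? = some (M, e) := by
  unfold IsInst at h
  induction h generalizing k with
  | nil => simp at hP
  | @cons p q _ _ h1 h2 ih =>
    cases k with
    | zero =>
      simp only [List.getElem?_cons_zero, Option.some.injEq] at hP
      subst hP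
      obtain ⟨a, e⟩ := p
      obtain rfl : a = M := h1.1
      exact ⟨e, rfl⟩
    | succ k => exact ih hP

theorem IsInst.map_tr {K : Inst S} {P Ξ Θ : MCtx S} {Δ Γ : VCtx S} (h : IsInst K P Ξ Δ)
    {I : Inst S} {σ : ℕ → Arg S} (hok : Arg.TrOK Ξ.ar (dom Δ) Θ.ar (dom Γ) I σ) :
    IsInst (K.map fun q => (q.1, q.2.tr I σ)) P Θ Γ := by
  unfold IsInst
  rw [List.forall₂_map_left_iff]
  exact h.imp fun p q hpq => ⟨hpq.1, hpq.2.tr hok⟩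

theorem IsInst.hasAbs_lookup {K : Inst S} {P Θ : MCtx S} {Γ : VCtx S} (h : IsInst K P Θ Γ)
    (M : ℕ) (c : Cls × ℕ) (hM : P.ar M = some c) :
    ∃ f, K.lookup M = some f ∧ f.HasAbs c.2 := by
  obtain ⟨f, h1, h2⟩ := h.lookup hM
  exact ⟨f, h1, h2.hasAbs⟩

theorem IsInst.act_tr {K : Inst S} {P Θ : MCtx S} {Γ : VCtx S} (h : IsInst K P Θ Γ)
    (hP : P.Valid) {I : Inst S} {σ : ℕ → Arg S} (hc : Arg.Closed I σ) {k M : ℕ} {B : ABdry S}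
    (hk : P[k]? = some (M, B)) :
    (B.act (K.take k)).tr I σ = B.act ((K.map fun q => (q.1, q.2.tr I σ)).take k) := by
  rw [← List.map_take]
  exact (hP.2 _ _ _ hk).act_tr hc (h.take k).hasAbs_lookup

theorem getElem?_map_tr {K : Inst S} {f : Arg S → Arg S} {k M : ℕ} {e' : Arg S}
    (h : (K.map fun q => (q.1, f q.2))[k]? = some (M, e')) :
    ∃ e, K[k]? = some (M, e) ∧ e' = f e := by
  rw [List.getElem?_map] at h
  rcases h' : K[k]? with _ | ⟨N, e⟩
  · rw [h'] at h; cases h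
  · rw [h'] at h
    simp only [Option.map_some, Option.some.injEq, Prod.mk.injEq] at h
    exact ⟨e, by rw [h.1], h.2.symm⟩

/-! ### Preservation of derivability under simultaneous instantiation and substitution -/

namespace RawTT

variable {T : RawTT.{u, v} S}

/-- The transformed hypothetical judgement or boundary is derivable, for every substitution. -/
def TrDerivable (T : RawTT.{u, v} S) (Ξ Θ : MCtx S) (I : Inst S)
    (Q : VCtx S → Arg S → Arg S → Prop) : Hyp S → Prop
  | .jdg Ξ' Δ J => Ξ' = Ξ → ∀ (Γ : VCtx S) (σ : ℕ → Arg S), IsSub Q I Θ Δ Γ σ →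
      T.Derivable (.jdg Θ Γ (J.tr I σ))
  | .bdry Ξ' Δ B => Ξ' = Ξ → ∀ (Γ : VCtx S) (σ : ℕ → Arg S), IsSub Q I Θ Δ Γ σ →
      T.Derivable (.bdry Θ Γ (B.tr I σ))

theorem Interp.hasAbs {Ξ Θ : MCtx S} {I : Inst S} (hI : T.Interp Ξ Θ I) {M : ℕ}
    {B : ABdry S} (hM : Ξ.lookup M = some B) (f : Arg S) (hf : I.lookup M = some f) :
    f.HasAbs B.arity.2 := by
  rcases hI.arity M _ (MCtx.ar_of_lookup hM) with ⟨h, -⟩ | ⟨f', h1, h2⟩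
  · rw [h] at hf; cases hf
  · rw [h1, Option.some.injEq] at hf
    exact hf ▸ h2.hasAbs

theorem _root_.FTT.ABdry.Valid.tr_eq_act {ar : ℕ → Option (Cls × ℕ)} {k : ℕ} {B : ABdry S}
    (h : B.Valid ar ∅ k) (I : Inst S) (σ : ℕ → Arg S) : B.tr I σ = B.act I := by
  rw [ABdry.act_eq_tr]
  exact h.tr_congr (fun _ _ _ => rfl) fun a ha => ha.elim

theorem rule_bdry_valid (T : RawTT.{u, v} S) (i : T.ι) :
    (T.rule i).bdry.Valid (T.rule i).prem.ar ∅ 0 := by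
  have := (T.valid i).1.2.2
  rw [dom_nil] at this
  exact Bdry.valid_of_plug this

theorem rule_bdry_act_tr (T : RawTT.{u, v} S) (i : T.ι) {K : Inst S} {Θ : MCtx S} {Γ : VCtx S}
    (hK : IsInst K (T.rule i).prem Θ Γ) {I : Inst S} {σ : ℕ → Arg S} (hc : Arg.Closed I σ) :
    ((T.rule i).bdry.map (Arg.act K)).map (Arg.tr I σ) =
      (T.rule i).bdry.map (Arg.act (K.map fun q => (q.1, q.2.tr I σ))) := by
  rw [Bdry.map_map]
  exact Bdry.Valid.map_congr (fun _ _ h => h.act_tr hc hK.hasAbs_lookup)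
    (T.rule_bdry_valid i)

theorem rule_head_act_tr (T : RawTT.{u, v} S) (i : T.ι) {K : Inst S} {Θ : MCtx S} {Γ : VCtx S}
    (hK : IsInst K (T.rule i).prem Θ Γ) {I : Inst S} {σ : ℕ → Arg S} (hc : Arg.Closed I σ) :
    ((T.rule i).head.act K).tr I σ =
      (T.rule i).head.act (K.map fun q => (q.1, q.2.tr I σ)) :=
  (T.valid i).2.act_tr hc hK.hasAbs_lookup

/-- Induction on the derivation. Every rule is carried to an instance of itself, except that the
variable rule is taken care of by `Q` and the metavariable rules by `Interp`. Leaving these two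
abstract lets one induction give weakening, then substitution, and finally instantiation, each stage
supplying the hypotheses of the next. -/
theorem Derivable.tr_aux {Ξ Θ : MCtx S} {I : Inst S} {Q : VCtx S → Arg S → Arg S → Prop}
    (hQ : T.Substitutable Θ Q) (hI : T.Interp Ξ Θ I) {H : Hyp S} (h : T.Derivable H) :
    T.TrDerivable Ξ Θ I Q H := by
  induction h with
  | var h hv =>
    rintro rfl Γ σ hσ
    exact hQ.der _ _ _ hσ.ctx (hσ.sub _ _ h)
  | @mvar Ξ' Δ M As b ts hM hts hb hv ih ihb =>
    rintro rfl Γ σ hσ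
    have hc := hσ.closed hI
    have hv' := hσ.valid_jdg hQ hI hv
    have habs := hI.hasAbs hM
    rw [ABdry.arity_abstrs] at habs
    -- Boundaries in a metavariable context are closed, so `σ` does not act on them.
    have hB := (hv.1.lookup hM).tr_eq_act I σ
    have hb' := ihb rfl Γ σ hσ
    have hs : Spine id (fun t A => T.Derivable (.jdg Θ Γ (.thesis (.tm (t.tr I σ) (A.tr I σ)))))
        (List.ofFn ts) (ABdry.abstrs As b) := spine_ofFn.2 fun j => ih j rfl Γ σ hσ
    have hs' := Spine.map (π' := id) (g := Arg.tr I σ)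
      (D := fun t A => T.Derivable (.jdg Θ Γ (.thesis (.tm t A)))) hc (fun _ => rfl) hs
    simp only [AJdg.tr, ABdry.tr, ← ABdry.inst_ofFn, Bdry.map_plug, ABdry.inst_tr hc,
      tr_mvar habs, hB] at hs' hv' hb' ⊢
    exact hI.mvar _ _ _ _ hσ.ctx hM hs' hb' hv'
  | @mvarCongr Ξ' Δ M As b ss ts hM hobj hss hts hst hC hv ih1 ih2 ih3 ihC =>
    rintro rfl Γ σ hσ
    have hc := hσ.closed hI
    have hv' := hσ.valid_jdg hQ hI hv
    have habs := hI.hasAbs hM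
    have hBobj : (ABdry.abstrs As b).IsObj := by rw [ABdry.IsObj, ABdry.arity_abstrs]; exact hobj
    rw [ABdry.arity_abstrs] at habs
    have hB := (hv.1.lookup hM).tr_eq_act I σ
    let g : Arg S × Arg S → Arg S × Arg S := fun p => (p.1.tr I σ, p.2.tr I σ)
    let l : List (Arg S × Arg S) := List.ofFn fun j => (ss j, ts j)
    have h1 : Spine Prod.fst
        (fun p A => T.Derivable (.jdg Θ Γ (.thesis (.tm (g p).1 (A.tr I σ))))) l
        (ABdry.abstrs As b) := spine_ofFn.2 fun j => ih1 j rfl Γ σ hσ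
    have h2 : Spine Prod.snd
        (fun p A => T.Derivable (.jdg Θ Γ (.thesis (.tm (g p).2 (A.tr I σ))))) l
        (ABdry.abstrs As b) := spine_ofFn.2 fun j => ih2 j rfl Γ σ hσ
    have h3 : Spine Prod.fst
        (fun p A => T.Derivable (.jdg Θ Γ (.thesis (.eqTm (g p).1 (g p).2 (A.tr I σ))))) l
        (ABdry.abstrs As b) := spine_ofFn.2 fun j => ih3 j rfl Γ σ hσ
    have h1' := Spine.map (π' := Prod.fst) (g := g)
      (D := fun p A => T.Derivable (.jdg Θ Γ (.thesis (.tm p.1 A)))) hc (fun _ => rfl) h1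
    have h2' := Spine.map (π' := Prod.snd) (g := g)
      (D := fun p A => T.Derivable (.jdg Θ Γ (.thesis (.tm p.2 A)))) hc (fun _ => rfl) h2
    have h3' := Spine.map (π' := Prod.fst) (g := g)
      (D := fun p A => T.Derivable (.jdg Θ Γ (.thesis (.eqTm p.1 p.2 A)))) hc (fun _ => rfl) h3
    have e1 : (l.map g).map Prod.fst = (List.ofFn ss).map (Arg.tr I σ) := by
      simp only [l, List.map_ofFn]; rfl
    have e2 : (l.map g).map Prod.snd = (List.ofFn ts).map (Arg.tr I σ) := by
      simp only [l, List.map_ofFn]; rfl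
    rw [hB] at h1' h2' h3'
    have key := hI.mvarCongr Γ M _ (l.map g) hσ.ctx hM hBobj h1' h2' h3'
    rw [e1, e2, ← hB, ← ABdry.inst_tr hc, ← ABdry.inst_tr hc, ABdry.inst_ofFn, ABdry.inst_ofFn,
      ← tr_mvar habs, ← tr_mvar habs, ← Bdry.map_plugEq] at key
    refine key (fun C C' hC1 hC2 => ?_) hv'
    cases b with
    | tm D =>
      simp only [Bdry.map, Bdry.tm.injEq] at hC1 hC2
      rw [← hC1, ← hC2]
      exact ihC _ rfl rfl Γ σ hσ
    | _ => cases hC1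
  | @abstr Ξ' Δ a A J hA ha hJ hv ihA ihJ =>
    rintro rfl Γ σ hσ
    have hA' := ihA rfl Γ σ hσ
    -- The name `a` is fresh for `Δ` but may occur in `Γ`, so the bound variable is renamed to `b`.
    obtain ⟨b, hb⟩ := exists_fresh Γ
    refine .abstr hA' hb ?_ (hσ.valid_jdg hQ hI hv)
    rw [← hv.2.2.2.open_tr ha (hσ.closed hI) (t := .fvar b) trivial]
    exact ihJ rfl _ _ (hσ.extend hQ hv.2.1 ha hv.2.2.1 hb hA'.valid.2.2)
  | tyRefl _ hv ih =>
    rintro rfl Γ σ hσ; exact .tyRefl (ih rfl _ _ hσ) (hσ.valid_jdg hQ hI hv)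
  | tySym _ hv ih =>
    rintro rfl Γ σ hσ; exact .tySym (ih rfl _ _ hσ) (hσ.valid_jdg hQ hI hv)
  | tyTran _ _ hv ih ih' =>
    rintro rfl Γ σ hσ
    exact .tyTran (ih rfl _ _ hσ) (ih' rfl _ _ hσ) (hσ.valid_jdg hQ hI hv)
  | tmRefl _ hv ih =>
    rintro rfl Γ σ hσ; exact .tmRefl (ih rfl _ _ hσ) (hσ.valid_jdg hQ hI hv)
  | tmSym _ hv ih =>
    rintro rfl Γ σ hσ; exact .tmSym (ih rfl _ _ hσ) (hσ.valid_jdg hQ hI hv)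
  | tmTran _ _ hv ih ih' =>
    rintro rfl Γ σ hσ
    exact .tmTran (ih rfl _ _ hσ) (ih' rfl _ _ hσ) (hσ.valid_jdg hQ hI hv)
  | convTm _ _ hv ih ih' =>
    rintro rfl Γ σ hσ
    exact .convTm (ih rfl _ _ hσ) (ih' rfl _ _ hσ) (hσ.valid_jdg hQ hI hv)
  | convEq _ _ hv ih ih' =>
    rintro rfl Γ σ hσ
    exact .convEq (ih rfl _ _ hσ) (ih' rfl _ _ hσ) (hσ.valid_jdg hQ hI hv)
  | bdryTy hv =>
    rintro rfl Γ σ hσ; exact .bdryTy (hσ.valid_bdry hQ hI hv)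
  | bdryTm _ hv ih =>
    rintro rfl Γ σ hσ; exact .bdryTm (ih rfl _ _ hσ) (hσ.valid_bdry hQ hI hv)
  | bdryEqTy _ _ hv ih ih' =>
    rintro rfl Γ σ hσ
    exact .bdryEqTy (ih rfl _ _ hσ) (ih' rfl _ _ hσ) (hσ.valid_bdry hQ hI hv)
  | bdryEqTm _ _ _ hv ih ih' ih'' =>
    rintro rfl Γ σ hσ
    exact .bdryEqTm (ih rfl _ _ hσ) (ih' rfl _ _ hσ) (ih'' rfl _ _ hσ) (hσ.valid_bdry hQ hI hv)
  | @bdryAbstr Ξ' Δ a A B hA ha hB hv ihA ihB =>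
    rintro rfl Γ σ hσ
    have hA' := ihA rfl Γ σ hσ
    obtain ⟨b, hb⟩ := exists_fresh Γ
    refine .bdryAbstr hA' hb ?_ (hσ.valid_bdry hQ hI hv)
    rw [← hv.2.2.2.open_tr ha (hσ.closed hI) (t := .fvar b) trivial]
    exact ihB rfl _ _ (hσ.extend hQ hv.2.1 ha hv.2.2.1 hb hA'.valid.2.2)
  | @specific Ξ' Δ i K hK hprem hb hv ih ihb =>
    rintro rfl Γ σ hσ
    have hc := hσ.closed hI
    have hv' := hσ.valid_jdg hQ hI hv
    have hb' := ihb rfl Γ σ hσ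
    simp only [AJdg.tr, ABdry.tr, Bdry.map_plug, rule_bdry_act_tr T i hK hc,
      rule_head_act_tr T i hK hc] at hv' hb' ⊢
    rw [← Bdry.map_plug] at hv' ⊢
    -- The same rule applies with the entries of `K` transformed; the premises and the conclusion of
    -- the rule have no free variables of their own.
    refine .specific i (hK.map_tr (hσ.trOK hQ hI)) (fun k M B e' hk he' => ?_) hb' hv'
    obtain ⟨e, he, rfl⟩ := getElem?_map_tr he'
    have := ih k M B e hk he rfl Γ σ hσ
    rwa [ABdry.plug_tr _ (by rw [ABdry.arity_act]; exact (hK.getElem? hk he).2.hasAbs),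
      hK.act_tr (T.valid i).1.1 hc hk] at this
  | @congr Ξ' Δ i K L hobj hK hL hpK hpL hpKL hC hv ihK ihL ihKL ihC =>
    rintro rfl Γ σ hσ
    have hc := hσ.closed hI
    have hv' := hσ.valid_jdg hQ hI hv
    simp only [AJdg.tr, Bdry.map_plugEq, rule_bdry_act_tr T i hK hc,
      rule_head_act_tr T i hK hc, rule_head_act_tr T i hL hc] at hv' ⊢
    refine .congr i hobj (hK.map_tr (hσ.trOK hQ hI)) (hL.map_tr (hσ.trOK hQ hI))
      (fun k M B e' hk he' => ?_) (fun k M B e' hk he' => ?_)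
      (fun k M B e' f' hk hB he' hf' => ?_) (fun C h => ?_) hv'
    · obtain ⟨e, he, rfl⟩ := getElem?_map_tr he'
      have := ihK k M B e hk he rfl Γ σ hσ
      rwa [ABdry.plug_tr _ (by rw [ABdry.arity_act]; exact (hK.getElem? hk he).2.hasAbs),
        hK.act_tr (T.valid i).1.1 hc hk] at this
    · obtain ⟨e, he, rfl⟩ := getElem?_map_tr he'
      have := ihL k M B e hk he rfl Γ σ hσ
      rwa [ABdry.plug_tr _ (by rw [ABdry.arity_act]; exact (hL.getElem? hk he).2.hasAbs),
        hL.act_tr (T.valid i).1.1 hc hk] at this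
    · obtain ⟨e, he, rfl⟩ := getElem?_map_tr he'
      obtain ⟨f, hf, rfl⟩ := getElem?_map_tr hf'
      have := ihKL k M B e f hk hB he hf rfl Γ σ hσ
      rwa [ABdry.plugEq_tr _ (by rw [ABdry.arity_act]; exact (hK.getElem? hk he).2.hasAbs)
        (by rw [ABdry.arity_act]; exact (hL.getElem? hk hf).2.hasAbs),
        hK.act_tr (T.valid i).1.1 hc hk] at this
    · have := ihC C h rfl Γ σ hσ
      have hCv : ValidTy (T.rule i).prem.ar ∅ 0 C := by
        have := T.rule_bdry_valid i
        rw [h] at this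
        exact this
      simpa only [AJdg.tr, Thesis.map, hCv.act_tr hc hK.hasAbs_lookup,
        hCv.act_tr hc hL.hasAbs_lookup] using this

theorem Derivable.tr {Ξ Θ : MCtx S} {I : Inst S} {Q : VCtx S → Arg S → Arg S → Prop}
    {Δ Γ : VCtx S} {σ : ℕ → Arg S} {J : AJdg S} (h : T.Derivable (.jdg Ξ Δ J))
    (hQ : T.Substitutable Θ Q) (hI : T.Interp Ξ Θ I) (hσ : IsSub Q I Θ Δ Γ σ) :
    T.Derivable (.jdg Θ Γ (J.tr I σ)) :=
  h.tr_aux hQ hI rfl _ _ hσ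

theorem Derivable.tr_bdry {Ξ Θ : MCtx S} {I : Inst S} {Q : VCtx S → Arg S → Arg S → Prop}
    {Δ Γ : VCtx S} {σ : ℕ → Arg S} {B : ABdry S} (h : T.Derivable (.bdry Ξ Δ B))
    (hQ : T.Substitutable Θ Q) (hI : T.Interp Ξ Θ I) (hσ : IsSub Q I Θ Δ Γ σ) :
    T.Derivable (.bdry Θ Γ (B.tr I σ)) :=
  h.tr_aux hQ hI rfl _ _ hσ

/-! ## Weakening and substitution -/

theorem _root_.FTT.Arg.act_nil (e : Arg S) : e.tr [] .fvar = e := by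
  induction e with
  | _ => simp_all [Arg.tr]

theorem _root_.FTT.ABdry.tr_nil (B : ABdry S) : B.tr [] .fvar = B := by
  induction B with
  | thesis b => simp only [ABdry.tr, Bdry.map_id' Arg.act_nil]
  | abstr A B ih => simp only [ABdry.tr, Arg.act_nil, ih]

theorem _root_.FTT.AJdg.tr_nil (J : AJdg S) : J.tr [] .fvar = J := by
  induction J with
  | thesis j => cases j <;> simp only [AJdg.tr, Thesis.map, Arg.act_nil]
  | abstr A J ih => simp only [AJdg.tr, Arg.act_nil, ih]

theorem _root_.FTT.ABdry.act_nil (B : ABdry S) : B.act [] = B := by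
  rw [ABdry.act_eq_tr, ABdry.tr_nil]

/-- Inclusion of metavariable contexts. -/
theorem interp_of_subset {Ξ Θ : MCtx S} (hΘ : Θ.Valid)
    (h : ∀ M B, Ξ.lookup M = some B → Θ.lookup M = some B) : T.Interp Ξ Θ [] where
  valid := hΘ
  arity M c hM := .inl ⟨rfl, MCtx.ar_mono h _ _ hM⟩
  lc M e h := by cases h
  mvar Γ M B l hΓ hM hl hb hv := by
    rw [ABdry.act_nil] at *
    exact .mvarL (h _ _ hM) hl hb hv
  mvarCongr Γ M B l hΓ hM hB h1 h2 h3 hC hv := by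
    rw [ABdry.act_nil] at *
    exact .mvarLCongr (h _ _ hM) hB h1 h2 h3 hC hv

/-- This breaks a circularity: to pass under binders, terms being substituted must be weakened. For
variables, weakening is a mere lookup; it yields `Derivable.weaken`, which then allows all derivable
terms in `substitutable_derivable`. -/
theorem substitutable_var {Θ : MCtx S} (hΘ : Θ.Valid) :
    T.Substitutable Θ fun Γ t A => ∃ a, t = .fvar a ∧ Γ.lookup a = some A where
  der := by
    rintro Γ _ A hΓ ⟨a, rfl, ha⟩
    exact .var ha ⟨hΘ, hΓ, .fvar (mem_dom_of_lookup ha), hΓ.lookup ha⟩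
  weak := by
    rintro Γ _ A b B ⟨a, rfl, ha⟩ -
    exact ⟨a, rfl, lookup_append_left ha⟩
  var Γ a A _ ha := ⟨a, rfl, ha⟩

theorem isSub_var {Θ : MCtx S} {Γ Γ' : VCtx S} (hΓ : Γ'.Valid Θ)
    (h : ∀ a A, Γ.lookup a = some A → Γ'.lookup a = some A) :
    IsSub (fun Γ t A => ∃ a, t = .fvar a ∧ Γ.lookup a = some A) [] Θ Γ Γ' Arg.fvar where
  ctx := hΓ
  lc _ := trivial
  sub a A ha := ⟨a, rfl, by rw [Arg.act_nil]; exact h _ _ ha⟩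

theorem Derivable.weaken {Ξ Θ : MCtx S} {Γ Γ' : VCtx S} {J : AJdg S}
    (h : T.Derivable (.jdg Ξ Γ J)) (hΘ : Θ.Valid)
    (hΞ : ∀ M B, Ξ.lookup M = some B → Θ.lookup M = some B) (hΓ' : Γ'.Valid Θ)
    (hΓ : ∀ a A, Γ.lookup a = some A → Γ'.lookup a = some A) : T.Derivable (.jdg Θ Γ' J) := by
  have := h.tr (substitutable_var hΘ) (interp_of_subset hΘ hΞ) (isSub_var hΓ' hΓ)
  rwa [AJdg.tr_nil] at this

theorem Derivable.weaken_bdry {Ξ Θ : MCtx S} {Γ Γ' : VCtx S} {B : ABdry S}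
    (h : T.Derivable (.bdry Ξ Γ B)) (hΘ : Θ.Valid)
    (hΞ : ∀ M B, Ξ.lookup M = some B → Θ.lookup M = some B) (hΓ' : Γ'.Valid Θ)
    (hΓ : ∀ a A, Γ.lookup a = some A → Γ'.lookup a = some A) : T.Derivable (.bdry Θ Γ' B) := by
  have := h.tr_bdry (substitutable_var hΘ) (interp_of_subset hΘ hΞ) (isSub_var hΓ' hΓ)
  rwa [ABdry.tr_nil] at this

theorem substitutable_derivable {Θ : MCtx S} (hΘ : Θ.Valid) :
    T.Substitutable Θ fun Γ t A => T.Derivable (.jdg Θ Γ (.thesis (.tm t A))) where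
  der _ _ _ _ h := h
  weak _ _ _ _ _ h hB := h.weaken hΘ (fun _ _ h => h) hB fun _ _ h => lookup_append_left h
  var _ a _ hΓ ha := (substitutable_var hΘ).der _ _ _ hΓ ⟨a, rfl, ha⟩

/-- Derivable substitutions. -/
abbrev DerSub (T : RawTT.{u, v} S) (Θ : MCtx S) (Δ Γ : VCtx S) (σ : ℕ → Arg S) : Prop :=
  IsSub (fun Γ t A => T.Derivable (.jdg Θ Γ (.thesis (.tm t A)))) [] Θ Δ Γ σ

theorem Derivable.subst {Θ : MCtx S} {Δ Γ : VCtx S} {σ : ℕ → Arg S} {J : AJdg S}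
    (h : T.Derivable (.jdg Θ Δ J)) (hσ : T.DerSub Θ Δ Γ σ) :
    T.Derivable (.jdg Θ Γ (J.tr [] σ)) :=
  h.tr (substitutable_derivable h.valid.1) (interp_of_subset h.valid.1 fun _ _ h => h) hσ

end RawTT

theorem Thesis.eqj_plug_of_not_isObj {b : Bdry S} (hb : ¬ b.IsObj) (e : Arg S) (j : Thesis S) :
    (b.plug e).eqj j = b.plug e := by
  cases b <;> first | exact (hb trivial).elim | rfl

theorem Arg.Valid.open_tr {I : Inst S} {σ : ℕ → Arg S} {ar : ℕ → Option (Cls × ℕ)} {V : Set ℕ}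
    {a : ℕ} {e : Arg S} {c : Cls × ℕ} (h : e.Valid ar V 1 c) (ha : a ∉ V) (hc : Arg.Closed I σ)
    {t : Arg S} (ht : t.LC 0) :
    (e.subst (Arg.single (Arg.fvar a))).tr I (Function.update σ a t) =
      (e.tr I σ).subst (Arg.single t) := by
  rw [tr_subst_single (hc.update a ht), Arg.tr, Function.update_self, h.tr_update ha]

namespace RawTT

variable {T : RawTT.{u, v} S}

/-! ## Equal substitutions -/

/-- Judgementally equal derivable substitutions. -/
structure EqSub (T : RawTT.{u, v} S) (Θ : MCtx S) (Δ Γ : VCtx S) (σ τ : ℕ → Arg S) : Prop where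
  left : T.DerSub Θ Δ Γ σ
  right : T.DerSub Θ Δ Γ τ
  eq : ∀ a A, Δ.lookup a = some A →
    T.Derivable (.jdg Θ Γ (.thesis (.eqTm (σ a) (τ a) (A.tr [] σ))))

/-- Equal substitutions give equal instances of object judgements. -/
def EqDerivable (T : RawTT.{u, v} S) : Hyp S → Prop
  | .jdg Θ Δ J => ∀ (Γ : VCtx S) (σ τ : ℕ → Arg S), T.EqSub Θ Δ Γ σ τ →
      T.Derivable (.jdg Θ Γ ((J.tr [] σ).eqj (J.tr [] τ)))
  | .bdry Θ Δ (.thesis (.tm A)) => ∀ (Γ : VCtx S) (σ τ : ℕ → Arg S), T.EqSub Θ Δ Γ σ τ →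
      T.Derivable (.jdg Θ Γ (.thesis (.eqTy (A.tr [] σ) (A.tr [] τ))))
  | _ => True

variable {Θ : MCtx S} {Δ Γ : VCtx S} {σ τ : ℕ → Arg S}

theorem IsSub.closed_nil {Q : VCtx S → Arg S → Arg S → Prop} (h : IsSub Q [] Θ Δ Γ σ) :
    Arg.Closed [] σ :=
  ⟨fun _ _ h' => (by cases h'), h.lc⟩

theorem EqSub.cons (h : T.EqSub Θ Δ Γ σ τ) (hΔ : Δ.Valid Θ) {a : ℕ} (ha : a ∉ dom Δ)
    {A : Arg S} (hA : ValidTy Θ.ar (dom Δ) 0 A) {s t : Arg S}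
    (hs : T.Derivable (.jdg Θ Γ (.thesis (.tm s (A.tr [] σ)))))
    (ht : T.Derivable (.jdg Θ Γ (.thesis (.tm t (A.tr [] τ)))))
    (hst : T.Derivable (.jdg Θ Γ (.thesis (.eqTm s t (A.tr [] σ))))) :
    T.EqSub Θ (Δ ++ [(a, A)]) Γ (Function.update σ a s) (Function.update τ a t) where
  left := h.left.cons hΔ ha hA hs.valid.2.2.1.lc hs
  right := h.right.cons hΔ ha hA ht.valid.2.2.1.lc ht
  eq b B hb := by
    by_cases hab : b = a
    · subst hab
      rw [lookup_append_single ha, Option.some.injEq] at hb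
      rwa [Function.update_self, Function.update_self, ← hb, hA.tr_update ha]
    · rw [lookup_append_single_of_ne hab] at hb
      rw [Function.update_of_ne hab, Function.update_of_ne hab, (hΔ.lookup hb).tr_update ha]
      exact h.eq _ _ hb

theorem EqSub.weak (h : T.EqSub Θ Δ Γ σ τ) (hΘ : Θ.Valid) {b : ℕ} {B : Arg S}
    (hB : VCtx.Valid Θ (Γ ++ [(b, B)])) : T.EqSub Θ Δ (Γ ++ [(b, B)]) σ τ where
  left := h.left.weak (substitutable_derivable hΘ) hB
  right := h.right.weak (substitutable_derivable hΘ) hB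
  eq a A ha := (h.eq a A ha).weaken hΘ (fun _ _ h => h) hB fun _ _ h => lookup_append_left h

/-- Metavariable and symbol applications use their congruence rules, conversion uses conversion of
equations, and an equation needs only substitution along `σ`, because `eqj` leaves it unchanged. The
clause of `EqDerivable` for boundaries `□ : A` is what supplies the type equation demanded by the
congruence rules. -/
theorem Derivable.eq_aux {H : Hyp S} (h : T.Derivable H) : T.EqDerivable H := by
  induction h with
  | var h hv => exact fun Γ σ τ hst => hst.eq _ _ h
  | @mvar Θ Δ M As b ts hM hts hb hv ih ihb =>
    intro Γ σ τ hst
    have hcl := hst.left.closed_nil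
    have hcr := hst.right.closed_nil
    have hsl := (Derivable.mvar hM hts hb hv).subst hst.left
    have hsr := (Derivable.mvar hM hts hb hv).subst hst.right
    by_cases hobj : b.IsObj
    · have hB : ∀ ρ, (ABdry.abstrs As b).tr [] ρ = ABdry.abstrs As b := fun ρ => by
        rw [(hv.1.lookup hM).tr_eq_act [] ρ, ABdry.act_nil]
      have hBobj : (ABdry.abstrs As b).IsObj := by
        rw [ABdry.IsObj, ABdry.arity_abstrs]; exact hobj
      let g : Arg S → Arg S × Arg S := fun t => (t.tr [] σ, t.tr [] τ)
      let l := (List.ofFn ts).map g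
      have h1 : Spine Prod.fst (fun p A => T.Derivable (.jdg Θ Γ (.thesis (.tm p.1 A)))) l
          ((ABdry.abstrs As b).tr [] σ) :=
        Spine.map (π := id) (g := g) hcl (fun _ => rfl)
          (spine_ofFn.2 fun j => (hts j).subst hst.left)
      have h2 : Spine Prod.snd (fun p A => T.Derivable (.jdg Θ Γ (.thesis (.tm p.2 A)))) l
          ((ABdry.abstrs As b).tr [] τ) :=
        Spine.map (π := id) (g := g) hcr (fun _ => rfl)
          (spine_ofFn.2 fun j => (hts j).subst hst.right)
      have h3 : Spine Prod.fst
          (fun p A => T.Derivable (.jdg Θ Γ (.thesis (.eqTm p.1 p.2 A)))) l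
          ((ABdry.abstrs As b).tr [] σ) :=
        Spine.map (π := id) (g := g) hcl (fun _ => rfl)
          (spine_ofFn.2 fun j => ih j Γ σ τ hst)
      have e1 : l.map Prod.fst = (List.ofFn ts).map (Arg.tr [] σ) := by
        simp only [l, g, List.map_map]; rfl
      have e2 : l.map Prod.snd = (List.ofFn ts).map (Arg.tr [] τ) := by
        simp only [l, g, List.map_map]; rfl
      have f1 : (ABdry.abstrs As b).inst (l.map Prod.fst) =
          (b.map (Arg.subst (Arg.vec ts))).map (Arg.tr [] σ) := by
        rw [e1, ← ABdry.inst_ofFn, ABdry.inst_tr hcl, hB]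
      have f2 : (ABdry.abstrs As b).inst (l.map Prod.snd) =
          (b.map (Arg.subst (Arg.vec ts))).map (Arg.tr [] τ) := by
        rw [e2, ← ABdry.inst_ofFn, ABdry.inst_tr hcr, hB]
      have g1 : Arg.mvarL M (l.map Prod.fst) = (Arg.mvar M As.length ts).tr [] σ := by
        rw [e1, tr_mvar (fun f hf => by cases hf)]; rfl
      have g2 : Arg.mvarL M (l.map Prod.snd) = (Arg.mvar M As.length ts).tr [] τ := by
        rw [e2, tr_mvar (fun f hf => by cases hf)]; rfl
      have hv' := hsl.valid.2.2.eqj hsr.valid.2.2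
      have key := Derivable.mvarLCongr hM hBobj (hB σ ▸ h1) (hB τ ▸ h2) (hB σ ▸ h3)
      rw [f1, f2, g1, g2] at key
      simp only [AJdg.tr, AJdg.eqj, Bdry.map_plug] at hv' ⊢
      rw [Bdry.eqj_plug (by simpa only [Bdry.isObj_map] using hobj)
        (by simp only [Bdry.cls_map])] at hv' ⊢
      refine key (fun C C' hC hC' => ?_) ⟨hv.1, hst.left.ctx, hv'⟩
      cases b with
      | tm D =>
        simp only [Bdry.map, Bdry.tm.injEq] at hC hC'
        rw [← hC, ← hC']
        exact ihb Γ σ τ hst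
      | _ => cases hC
    -- For an equation boundary, `eqj` returns the left instance.
    · simp only [AJdg.tr, AJdg.eqj, Bdry.map_plug] at hsl ⊢
      rwa [Thesis.eqj_plug_of_not_isObj (by simpa only [Bdry.isObj_map] using hobj)]
  | mvarCongr hM hobj hss hts hst hC hv =>
    intro Γ σ τ hστ
    have := (Derivable.mvarCongr hM hobj hss hts hst hC hv).subst hστ.left
    rename_i b _ _ _ _ _ _
    cases b <;> first | exact hobj.elim | exact this
  | @abstr Θ Δ a A J hA ha hJ hv ihA ihJ =>
    intro Γ σ τ hst
    have hA' := hA.subst hst.left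
    have hAA := ihA Γ σ τ hst
    have hsl := (Derivable.abstr hA ha hJ hv).subst hst.left
    have hsr := (Derivable.abstr hA ha hJ hv).subst hst.right
    obtain ⟨b, hb⟩ := exists_fresh Γ
    have hctx := hst.left.ctx.snoc hb hA'.valid.2.2
    have hQ := substitutable_derivable (T := T) hv.1
    have hvar := hQ.var _ b _ hctx (lookup_append_single hb _)
    have hAA' := hAA.weaken hv.1 (fun _ _ h => h) hctx fun _ _ h => lookup_append_left h
    -- The new variable is declared with the `σ`-instance of `A`; to extend `τ` it has to be
    -- converted to the `τ`-instance.
    have hvar' := hvar.convTm hAA' ⟨hv.1, hctx, hvar.valid.2.2.1, hAA'.valid.2.2.2⟩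
    have hext := (hst.weak hv.1 hctx).cons hv.2.1 ha hv.2.2.1 hvar hvar'
      (hvar.tmRefl ⟨hv.1, hctx, hvar.valid.2.2.1, hvar.valid.2.2.1, hvar.valid.2.2.2⟩)
    have hJ' := ihJ _ _ _ hext
    rw [hv.2.2.2.open_tr ha hst.left.closed_nil (t := .fvar b) trivial,
      hv.2.2.2.open_tr ha hst.right.closed_nil (t := .fvar b) trivial, AJdg.eqj_subst] at hJ'
    exact .abstr hA' hb hJ' ⟨hv.1, hst.left.ctx, hsl.valid.2.2.eqj hsr.valid.2.2⟩
  | tyRefl h hv => exact fun Γ σ τ hst => (Derivable.tyRefl h hv).subst hst.left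
  | tySym h hv => exact fun Γ σ τ hst => (Derivable.tySym h hv).subst hst.left
  | tyTran h h' hv => exact fun Γ σ τ hst => (Derivable.tyTran h h' hv).subst hst.left
  | tmRefl h hv => exact fun Γ σ τ hst => (Derivable.tmRefl h hv).subst hst.left
  | tmSym h hv => exact fun Γ σ τ hst => (Derivable.tmSym h hv).subst hst.left
  | tmTran h h' hv => exact fun Γ σ τ hst => (Derivable.tmTran h h' hv).subst hst.left
  | convTm h h' hv ih =>
    intro Γ σ τ hst
    have hsl := (Derivable.convTm h h' hv).subst hst.left
    have hsr := (Derivable.convTm h h' hv).subst hst.right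
    exact .convEq (ih Γ σ τ hst) (h'.subst hst.left)
      ⟨hv.1, hst.left.ctx, hsl.valid.2.2.eqj hsr.valid.2.2⟩
  | convEq h h' hv => exact fun Γ σ τ hst => (Derivable.convEq h h' hv).subst hst.left
  | bdryTy => trivial
  | bdryTm h hv ih => exact fun Γ σ τ hst => ih Γ σ τ hst
  | bdryEqTy => trivial
  | bdryEqTm => trivial
  | bdryAbstr => trivial
  | @specific Θ Δ i K hK hprem hb hv ih ihb =>
    intro Γ σ τ hst
    have hcl := hst.left.closed_nil
    have hcr := hst.right.closed_nil
    have hQ := substitutable_derivable (T := T) hv.1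
    have hI := interp_of_subset (T := T) hv.1 fun _ _ h => h
    have hsl := (Derivable.specific i hK hprem hb hv).subst hst.left
    have hsr := (Derivable.specific i hK hprem hb hv).subst hst.right
    by_cases hobj : (T.rule i).bdry.IsObj
    · have hv' := hsl.valid.2.2.eqj hsr.valid.2.2
      have hP := (T.valid i).1.1
      simp only [AJdg.tr, AJdg.eqj, Bdry.map_plug, rule_bdry_act_tr T i hK hcl,
        rule_head_act_tr T i hK hcl, rule_bdry_act_tr T i hK hcr,
        rule_head_act_tr T i hK hcr] at hv' ⊢
      rw [Bdry.eqj_plug (by simpa only [Bdry.isObj_map] using hobj)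
        (by simp only [Bdry.cls_map])] at hv' ⊢
      have hprem' : ∀ ρ, T.DerSub Θ Δ Γ ρ → ∀ (k M : ℕ) (B : ABdry S) (e' : Arg S),
          (T.rule i).prem[k]? = some (M, B) →
          (K.map fun q => (q.1, q.2.tr [] ρ))[k]? = some (M, e') →
          T.Derivable (.jdg Θ Γ ((B.act ((K.map fun q => (q.1, q.2.tr [] ρ)).take k)).plug e')) := by
        intro ρ hρ k M B e' hk he'
        obtain ⟨e, he, rfl⟩ := getElem?_map_tr he'
        have := (hprem k M B e hk he).subst hρ
        rwa [ABdry.plug_tr _ (by rw [ABdry.arity_act]; exact (hK.getElem? hk he).2.hasAbs),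
          hK.act_tr hP hρ.closed_nil hk] at this
      refine .congr i hobj (hK.map_tr (hst.left.trOK hQ hI)) (hK.map_tr (hst.right.trOK hQ hI))
        (hprem' σ hst.left) (hprem' τ hst.right) (fun k M B e' f' hk hB he' hf' => ?_)
        (fun C h => ?_) ⟨hv.1, hst.left.ctx, hv'⟩
      · obtain ⟨e, he, rfl⟩ := getElem?_map_tr he'
        obtain ⟨f, hf, rfl⟩ := getElem?_map_tr hf'
        rw [he] at hf
        simp only [Option.some.injEq, Prod.mk.injEq, true_and] at hf
        subst hf
        have habs : e.HasAbs (B.act (K.take k)).arity.2 := by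
          rw [ABdry.arity_act]; exact (hK.getElem? hk he).2.hasAbs
        have := ih k M B e hk he Γ σ τ hst
        rw [ABdry.plug_tr _ habs, ABdry.plug_tr _ habs, hK.act_tr hP hcl hk,
          hK.act_tr hP hcr hk, ABdry.eqj_plug (by rwa [ABdry.IsObj, ABdry.arity_act])
            (by simp only [ABdry.arity_act])] at this
        exact this
      · have hCv := T.rule_bdry_valid i
        rw [h] at hCv ihb
        have := ihb Γ σ τ hst
        rwa [Arg.Valid.act_tr hcl (cn := (.ty, 0)) hCv hK.hasAbs_lookup,
          Arg.Valid.act_tr hcr (cn := (.ty, 0)) hCv hK.hasAbs_lookup] at this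
    · simp only [AJdg.tr, AJdg.eqj, Bdry.map_plug] at hsl ⊢
      rwa [Thesis.eqj_plug_of_not_isObj (by simpa only [Bdry.isObj_map] using hobj)]
  | congr i hobj hK hL hpK hpL hpKL hC hv =>
    intro Γ σ τ hστ
    have := (Derivable.congr i hobj hK hL hpK hpL hpKL hC hv).subst hστ.left
    cases hb : (T.rule i).bdry <;> rw [hb] at this hobj <;> first | exact hobj.elim | exact this

/-- Equal substitutions give equal instances of a derivable object judgement. -/
theorem Derivable.subst_eq {J : AJdg S} (h : T.Derivable (.jdg Θ Δ J))
    (hst : T.EqSub Θ Δ Γ σ τ) :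
    T.Derivable (.jdg Θ Γ ((J.tr [] σ).eqj (J.tr [] τ))) :=
  h.eq_aux Γ σ τ hst

/-! ## Application of abstracted judgements -/

theorem _root_.FTT.Arg.Valid.open_var {ar : ℕ → Option (Cls × ℕ)} {V V' : Set ℕ} {a : ℕ}
    {e : Arg S} {c : Cls × ℕ} (h : e.Valid ar V 1 c) (hV : V ⊆ V') (ha : a ∈ V') :
    (e.subst (Arg.single (.fvar a))).Valid ar V' 0 c :=
  (h.mono (fun _ _ h => h) hV le_rfl).subst (Arg.Valid.single (.fvar ha))

/-- Inversion of the abstraction rule. -/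
theorem Derivable.abstr_inv {A : Arg S} {B : ABdry S} {e : Arg S}
    (he : e.Valid Θ.ar (dom Δ) 1 B.arity)
    (h : T.Derivable (.jdg Θ Δ (.abstr A (B.plug e)))) :
    T.Derivable (.jdg Θ Δ (.thesis (.isTy A))) ∧ B.Valid Θ.ar (dom Δ) 1 ∧ ∃ a, a ∉ dom Δ ∧
      T.Derivable (.jdg Θ (Δ ++ [(a, A)]) ((B.subst (Arg.single (.fvar a))).plug
        (e.subst (Arg.single (.fvar a))))) := by
  cases h with
  | @abstr _ _ a _ _ hA ha hJ hv =>
    refine ⟨hA, ABdry.valid_of_plug hv.2.2.2, a, ha, ?_⟩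
    rwa [ABdry.plug_subst _ he.hasAbs] at hJ

/-- Each abstraction is inverted and its variable is recorded in the substitution as the
corresponding argument, so a single appeal to `Derivable.subst` remains at the end. The general `Δ`
and `σ` are there for this induction. -/
theorem Derivable.inst {l : List (Arg S)} {B : ABdry S} {e : Arg S}
    (h : T.Derivable (.jdg Θ Δ (B.plug e))) (he : e.Valid Θ.ar (dom Δ) 0 B.arity)
    (hσ : T.DerSub Θ Δ Γ σ)
    (hl : Spine id (fun t A => T.Derivable (.jdg Θ Γ (.thesis (.tm t A)))) l (B.tr [] σ)) :
    T.Derivable (.jdg Θ Γ (.thesis (((B.tr [] σ).inst l).plug ((e.tr [] σ).instL l)))) := by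
  induction l generalizing B e Δ σ with
  | nil =>
    cases B with
    | thesis b =>
      have := h.subst hσ
      rwa [ABdry.plug_tr _ he.hasAbs] at this
    | abstr A B => exact hl.elim
  | cons t l ih =>
    cases B with
    | thesis b => exact hl.elim
    | abstr A B =>
      obtain ⟨f, rfl, -⟩ := he.hasAbs
      have hf := he.body
      obtain ⟨hA, hB, a, ha, hJ⟩ := abstr_inv hf h
      have htl := hl.1.valid.2.2.1.lc
      have hcl := hσ.closed_nil
      have := ih hJ (by
          rw [ABdry.arity_subst]
          exact hf.open_var (by rw [dom_append]; exact Set.subset_union_left)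
            (by rw [dom_append_single]; exact Set.mem_insert _ _))
        (hσ.cons h.valid.2.1 ha hA.valid.2.2 htl hl.1)
        (by rw [hB.open_tr ha hcl htl]; exact hl.2)
      rwa [hB.open_tr ha hcl htl, hf.open_tr ha hcl htl] at this

/-- The same accumulation for a pair of equal substitutions, ending in `Derivable.subst_eq`. -/
theorem Derivable.inst_eq {l : List (Arg S × Arg S)} {B : ABdry S} {e : Arg S} (hB : B.IsObj)
    (h : T.Derivable (.jdg Θ Δ (B.plug e))) (he : e.Valid Θ.ar (dom Δ) 0 B.arity)
    (hσ : T.EqSub Θ Δ Γ σ τ)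
    (h1 : Spine Prod.fst (fun p A => T.Derivable (.jdg Θ Γ (.thesis (.tm p.1 A)))) l (B.tr [] σ))
    (h2 : Spine Prod.snd (fun p A => T.Derivable (.jdg Θ Γ (.thesis (.tm p.2 A)))) l (B.tr [] τ))
    (h3 : Spine Prod.fst (fun p A => T.Derivable (.jdg Θ Γ (.thesis (.eqTm p.1 p.2 A)))) l
      (B.tr [] σ)) :
    T.Derivable (.jdg Θ Γ (.thesis (((B.tr [] σ).inst (l.map Prod.fst)).plugEq
      ((e.tr [] σ).instL (l.map Prod.fst)) ((e.tr [] τ).instL (l.map Prod.snd))))) := by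
  induction l generalizing B e Δ σ τ with
  | nil =>
    cases B with
    | thesis b =>
      have := h.subst_eq hσ
      rwa [ABdry.plug_tr _ he.hasAbs, ABdry.plug_tr _ he.hasAbs,
        ABdry.eqj_plug (by rwa [ABdry.IsObj, ABdry.arity_tr])
          (by simp only [ABdry.arity_tr])] at this
    | abstr A B => exact h1.elim
  | cons p l ih =>
    cases B with
    | thesis b => exact h1.elim
    | abstr A B =>
      obtain ⟨f, rfl, -⟩ := he.hasAbs
      have hf := he.body
      obtain ⟨hA, hB', a, ha, hJ⟩ := abstr_inv hf h
      have hs := h1.1.valid.2.2.1.lc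
      have ht := h2.1.valid.2.2.1.lc
      have hcl := hσ.left.closed_nil
      have hcr := hσ.right.closed_nil
      have := ih (by rw [ABdry.IsObj, ABdry.arity_subst]; exact hB) hJ (by
          rw [ABdry.arity_subst]
          exact hf.open_var (by rw [dom_append]; exact Set.subset_union_left)
            (by rw [dom_append_single]; exact Set.mem_insert _ _))
        (hσ.cons h.valid.2.1 ha hA.valid.2.2 h1.1 h2.1 h3.1)
        (by rw [hB'.open_tr ha hcl hs]; exact h1.2) (by rw [hB'.open_tr ha hcr ht]; exact h2.2)
        (by rw [hB'.open_tr ha hcl hs]; exact h3.2)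
      rwa [hB'.open_tr ha hcl hs, hf.open_tr ha hcl hs, hf.open_tr ha hcr ht] at this

/-! ## Instantiation -/

theorem _root_.FTT.IsInst.map_fst {I : Inst S} {Ξ Θ : MCtx S} {Γ : VCtx S}
    (h : IsInst I Ξ Θ Γ) : I.map Prod.fst = Ξ.map Prod.fst := by
  unfold IsInst at h
  induction h with
  | nil => rfl
  | cons h1 _ ih => simp only [List.map_cons, h1.1, ih]

theorem _root_.FTT.IsInst.lookup_of_getElem? {I : Inst S} {Ξ Θ : MCtx S} {Γ : VCtx S}
    (h : IsInst I Ξ Θ Γ) (hΞ : Ξ.Valid) {k M : ℕ} {e : Arg S} (hk : I[k]? = some (M, e)) :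
    I.lookup M = some e :=
  FTT.lookup_of_getElem? (by rw [h.map_fst]; exact hΞ.1) hk

theorem _root_.FTT.IsInst.valid_of_lookup {I : Inst S} {Ξ Θ : MCtx S} {Γ : VCtx S}
    (h : IsInst I Ξ Θ Γ) {M : ℕ} {e : Arg S} (hM : I.lookup M = some e) :
    ∃ c, Ξ.ar M = some c ∧ e.Valid Θ.ar (dom Γ) 0 c := by
  have hdom : M ∈ dom Ξ := by
    have := mem_dom_of_lookup hM
    rwa [dom, Set.mem_ofPred_eq, h.map_fst] at this
  obtain ⟨B, hB⟩ := exists_lookup hdom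
  obtain ⟨f, hf, hv⟩ := h.lookup (MCtx.ar_of_lookup hB)
  rw [hM, Option.some.injEq] at hf
  exact ⟨_, MCtx.ar_of_lookup hB, hf ▸ hv⟩

/-- The `k`-th boundary mentions only earlier metavariables, so the restriction in the definition of
a derivable instantiation can be dropped. -/
theorem _root_.FTT.IsInst.act_take {I : Inst S} {Ξ Θ : MCtx S} {Γ : VCtx S}
    (h : IsInst I Ξ Θ Γ) (hΞ : Ξ.Valid) {k M : ℕ} {B : ABdry S} (hk : Ξ[k]? = some (M, B)) :
    B.act (I.take k) = B.act I := by
  rw [ABdry.act_eq_tr, ABdry.act_eq_tr]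
  refine (hΞ.2 _ _ _ hk).tr_congr (fun N c hN => ?_) fun _ _ => rfl
  obtain ⟨f, hf, -⟩ := (h.take k).lookup hN
  rw [hf, lookup_take hf]

/-- The closed instances of the premises of a derivable instantiation. -/
theorem InstDerivable.lookup {I : Inst S} {Ξ : MCtx S} (h : T.InstDerivable I Ξ Θ Γ)
    (hΞ : Ξ.Valid) {M : ℕ} {B : ABdry S} (hM : Ξ.lookup M = some B) :
    ∃ f, I.lookup M = some f ∧ f.Valid Θ.ar (dom Γ) 0 B.arity ∧
      T.Derivable (.jdg Θ Γ ((B.act I).plug f)) := by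
  obtain ⟨k, hk⟩ := exists_getElem?_of_lookup hM
  obtain ⟨f, hf⟩ := h.1.exists_getElem? hk
  refine ⟨f, h.1.lookup_of_getElem? hΞ hf, (h.1.getElem? hk hf).2, ?_⟩
  rw [← h.1.act_take hΞ hk]
  exact h.2 k M B f hk hf

theorem derSub_nil (hΓ : Γ.Valid Θ) : T.DerSub Θ [] Γ .fvar :=
  ⟨hΓ, fun _ => trivial, fun _ _ h => by cases h⟩

/-- The entry `I(M)` is the head of a derivable abstracted judgement. The metavariable rule for `M`
becomes the application of that judgement to arguments, and the congruence rule its application to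
equal arguments. -/
theorem InstDerivable.interp {I : Inst S} {Ξ : MCtx S} (h : T.InstDerivable I Ξ Θ [])
    (hΞ : Ξ.Valid) (hΘ : Θ.Valid) : T.Interp Ξ Θ I where
  valid := hΘ
  arity M c hM := by
    obtain ⟨f, h1, h2⟩ := h.1.lookup hM
    rw [dom_nil] at h2
    exact .inr ⟨f, h1, h2⟩
  lc M e hM := by
    obtain ⟨c, -, hv⟩ := h.1.valid_of_lookup hM
    exact hv.lc
  mvar Γ M B l hΓ hM hl _ _ := by
    obtain ⟨f, hf, hv, hd⟩ := h.lookup hΞ hM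
    rw [appI, hf]
    have := hd.inst (by rwa [ABdry.arity_act]) (derSub_nil hΓ) (by rwa [ABdry.tr_nil])
    rwa [ABdry.tr_nil, Arg.act_nil] at this
  mvarCongr Γ M B l hΓ hM hB h1 h2 h3 _ _ := by
    obtain ⟨f, hf, hv, hd⟩ := h.lookup hΞ hM
    simp only [appI, hf]
    have := hd.inst_eq (by rwa [ABdry.IsObj, ABdry.arity_act]) (by rwa [ABdry.arity_act])
      ⟨derSub_nil hΓ, derSub_nil hΓ, fun _ _ h => by cases h⟩ (by rwa [ABdry.tr_nil])
      (by rwa [ABdry.tr_nil]) (by rwa [ABdry.tr_nil])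
    rwa [ABdry.tr_nil, Arg.act_nil] at this

theorem isSub_nil {I : Inst S} {Q : VCtx S → Arg S → Arg S → Prop} (Θ : MCtx S) :
    IsSub Q I Θ [] [] .fvar :=
  ⟨VCtx.valid_nil Θ, fun _ => trivial, fun _ _ h => by cases h⟩

theorem Derivable.act {I : Inst S} {Ξ : MCtx S} {J : AJdg S} (h : T.Derivable (.jdg Ξ [] J))
    (hI : T.InstDerivable I Ξ Θ []) (hΘ : Θ.Valid) :
    T.Derivable (.jdg Θ [] (J.tr I .fvar)) :=
  h.tr (substitutable_derivable hΘ) (hI.interp h.valid.1 hΘ) (isSub_nil Θ)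

theorem Derivable.act_bdry {I : Inst S} {Ξ : MCtx S} {B : ABdry S}
    (h : T.Derivable (.bdry Ξ [] B)) (hI : T.InstDerivable I Ξ Θ []) (hΘ : Θ.Valid) :
    T.Derivable (.bdry Θ [] (B.act I)) := by
  rw [ABdry.act_eq_tr]
  exact h.tr_bdry (substitutable_derivable hΘ) (hI.interp h.valid.1 hΘ) (isSub_nil Θ)

end RawTT

/-! ## Generic applications -/

theorem Spine.exists_of_mem {α : Type*} {π : α → Arg S} {D : α → Arg S → Prop} {l : List α}
    {B : ABdry S} (h : Spine π D l B) {t : α} (ht : t ∈ l) : ∃ A, D t A := by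
  induction l generalizing B with
  | nil => cases ht
  | cons s l ih =>
    cases B with
    | thesis b => exact h.elim
    | abstr A B =>
      rcases List.mem_cons.1 ht with rfl | ht
      · exact ⟨A, h.1⟩
      · exact ih h.2 ht

theorem Arg.instL_genApp {M : ℕ} {c : Cls} (hc : c.IsObj) (l : List (Arg S)) :
    (genApp M (c, l.length)).instL l = mvarL M l := by
  have := instL_eq l.get (hasAbs_genApp (S := S) M (c, l.length))
  rwa [genApp_strip_subst hc, List.ofFn_get] at this

namespace RawTT

variable {T : RawTT.{u, v} S} {Θ : MCtx S} {Γ : VCtx S}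

/-- Derivability of an abstracted judgement from the derivability of its applications. -/
theorem Derivable.plug_of_inst {B : ABdry S} {e : Arg S} (hB : T.Derivable (.bdry Θ Γ B))
    (he : e.Valid Θ.ar (dom Γ) 0 B.arity)
    (h : ∀ (Γ' : VCtx S) (l : List (Arg S)), Γ'.Valid Θ →
      (∀ a A, Γ.lookup a = some A → Γ'.lookup a = some A) →
      Spine id (fun t A => T.Derivable (.jdg Θ Γ' (.thesis (.tm t A)))) l B →
      T.Derivable (.bdry Θ Γ' (.thesis (B.inst l))) →
      T.Derivable (.jdg Θ Γ' (.thesis ((B.inst l).plug (e.instL l))))) :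
    T.Derivable (.jdg Θ Γ (B.plug e)) := by
  induction hn : B.arity.2 generalizing B e Γ with
  | zero =>
    cases B with
    | thesis b => exact h Γ [] hB.valid.2.1 (fun _ _ h => h) trivial hB
    | abstr A B => cases hn
  | succ n ih =>
    cases B with
    | thesis b => cases hn
    | abstr A B =>
      have hv := hB.valid
      obtain ⟨f, rfl, -⟩ := he.hasAbs
      have hf := he.body
      cases hB with
      | @bdryAbstr _ _ a _ _ hA ha hB' _ =>
        refine .abstr hA ha ?_ ⟨hv.1, hv.2.1, hv.2.2.plug he⟩
        rw [ABdry.plug_subst _ hf.hasAbs]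
        refine ih hB' ?_ (fun Γ' l hΓ' hsub hl hb => ?_) ?_
        · rw [ABdry.arity_subst]
          exact hf.open_var (by rw [dom_append]; exact Set.subset_union_left)
            (by rw [dom_append_single]; exact Set.mem_insert _ _)
        · refine h Γ' (.fvar a :: l) hΓ' (fun b B hb => hsub _ _ (lookup_append_left hb))
            ⟨?_, hl⟩ hb
          exact (substitutable_derivable hv.1).var _ _ _ hΓ' (hsub _ _ (lookup_append_single ha A))
        · rw [ABdry.arity_subst]
          simpa [ABdry.arity] using hn

/-- By `Derivable.plug_of_inst` it is enough to consider applications of the generic application to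
arguments, and there the claim is the metavariable rule. -/
theorem Derivable.genApp {M : ℕ} {B : ABdry S} (hM : Θ.lookup M = some B)
    (hB : T.Derivable (.bdry Θ [] B)) :
    T.Derivable (.jdg Θ [] (B.plug (Arg.genApp M B.arity))) := by
  refine hB.plug_of_inst (Arg.genApp_valid (MCtx.ar_of_lookup hM)) fun Γ l hΓ _ hl hb => ?_
  have hlen := hl.length
  have hcls : (B.inst l).cls = B.arity.1 := ABdry.isObj_inst hlen
  -- For an equation boundary the two heads differ, one being a dummy, but `plug` ignores them.
  have hhead : (B.inst l).plug ((Arg.genApp M B.arity).instL l) =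
      (B.inst l).plug (Arg.mvarL M l) := by
    by_cases hc : B.arity.1.IsObj
    · have : B.arity = (B.arity.1, l.length) := by rw [hlen]
      rw [this, Arg.instL_genApp hc]
    · rw [← hcls] at hc
      cases h : B.inst l <;> rw [h] at hc <;> first | exact (hc trivial).elim | rfl
  rw [hhead]
  refine .mvarL hM hl hb ⟨hb.valid.1, hΓ, ?_⟩
  by_cases hc : B.arity.1.IsObj
  · refine Bdry.Valid.plug hb.valid.2.2 ?_
    rw [hcls]
    refine .mvar (by rw [MCtx.ar_of_lookup hM, hlen]) hc fun i => ?_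
    obtain ⟨A, hA⟩ := hl.exists_of_mem (l.get_mem i)
    exact hA.valid.2.2.1
  · have := hb.valid.2.2
    rw [← hcls] at hc
    cases h : B.inst l <;> rw [h] at hc this <;> first | exact (hc trivial).elim | exact this

/-! ## Inversion for symbols -/

/-- The head of a symbol rule applies the symbol to the generic applications of the premises, and
`I` takes the generic application of `M` to `I(M)`. So `I` can be read off from the arguments of the
instantiated head. -/
theorem argInst_eq_of_isSymbolRule {i : T.ι} {s : S.Sym}
    {es' : Fin (S.arity s).args.length → Arg S} {I : Inst S}
    (hes' : List.ofFn es' = (T.rule i).prem.map fun q => Arg.genApp q.1 q.2.arity)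
    (hI : IsInst I (T.rule i).prem Θ Γ) :
    argInst (T.rule i).prem (fun j => (es' j).act I) = I := by
  have h1 : (List.ofFn fun j => (es' j).act I) =
      (T.rule i).prem.map fun q => (Arg.genApp q.1 q.2.arity).act I := by
    have : (List.ofFn fun j => (es' j).act I) = (List.ofFn es').map (Arg.act I) := by
      rw [List.map_ofFn]; rfl
    rw [this, hes', List.map_map]; rfl
  rw [argInst, h1]
  have hP := (T.valid i).1.1
  apply List.ext_getElem?
  intro k
  rcases hk : (T.rule i).prem[k]? with _ | ⟨M, B⟩
  · have hlen := List.Forall₂.length_eq hI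
    have hle := List.getElem?_eq_none_iff.1 hk
    rw [List.getElem?_eq_none (by simpa using hle), List.getElem?_eq_none (by omega)]
  · obtain ⟨e, he⟩ := hI.exists_getElem? hk
    rw [he, List.getElem?_zip_eq_some.2 ⟨?_, ?_⟩]
    · rw [List.getElem?_map, hk]; rfl
    · rw [List.getElem?_map, hk, Option.map_some, Arg.act_eq_tr,
        Arg.genApp_tr (hI.lookup_of_getElem? hP he) (hI.getElem? hk he).2]

/-- An object judgement whose head is a symbol application can end only in a conversion or in a
specific rule. A conversion changes just the type, so the induction is over all object boundaries
`b`; in a standard theory the specific rule is a symbol rule. -/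
theorem Derivable.sym_inv (hT : T.IsStandard) {b : Bdry S} (hb : b.IsObj) {s : S.Sym}
    {es : Fin (S.arity s).args.length → Arg S}
    (h : T.Derivable (.jdg Θ Γ (.thesis (b.plug (.sym s es))))) :
    ∃ i, (T.rule i).IsSymbolRule s ∧
      T.InstDerivable (argInst (T.rule i).prem es) (T.rule i).prem Θ Γ := by
  generalize hH : Hyp.jdg Θ Γ (.thesis (b.plug (.sym s es))) = H at h
  induction h generalizing b with
  | convTm h _ _ ih =>
    cases b with
    | tm A =>
      simp only [Bdry.plug, Hyp.jdg.injEq, AJdg.thesis.injEq, Thesis.tm.injEq] at hH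
      obtain ⟨rfl, rfl, rfl, rfl⟩ := hH
      exact ih (b := .tm _) trivial rfl
    | ty => simp [Bdry.plug] at hH
    | _ => exact hb.elim
  | @specific Θ' Γ' i I hI hprem _ _ =>
    -- An equation rule cannot conclude an object thesis.
    have hobj : (T.rule i).bdry.IsObj := by
      simp only [Hyp.jdg.injEq, AJdg.thesis.injEq] at hH
      have := hH.2.2
      cases h : (T.rule i).bdry <;> first | trivial | skip
      all_goals
        rw [h] at this
        cases b <;> first | exact hb.elim | simp [Bdry.plug, Thesis.map] at this
    obtain ⟨s', hs'⟩ := hT.2.1 i hobj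
    obtain ⟨es', hes', hgen⟩ := hs'.2.2.2
    simp only [Hyp.jdg.injEq, AJdg.thesis.injEq, Bdry.map_plug, hes', Arg.act] at hH
    obtain ⟨rfl, rfl, hH⟩ := hH
    -- Comparing heads identifies the symbol of the rule with `s` and the arguments with the
    -- instances of generic applications.
    have key : Arg.sym s es = .sym s' fun j => (es' j).act I := by
      cases h : (T.rule i).bdry <;> rw [h] at hobj hH <;> first | exact hobj.elim | skip
      all_goals
        cases b <;> first | exact hb.elim | skip
        all_goals simp [Bdry.plug, Bdry.map] at hH
      · exact Arg.sym.injEq .. ▸ hH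
      · exact Arg.sym.injEq .. ▸ hH.1
    simp only [Arg.sym.injEq] at key
    obtain ⟨rfl, key⟩ := key
    obtain rfl := eq_of_heq key
    refine ⟨i, hs', ?_⟩
    rw [argInst_eq_of_isSymbolRule hgen hI]
    exact ⟨hI, hprem⟩
  | @mvar _ _ M As b' ts =>
    cases b <;> first | exact hb.elim | (cases b' <;> simp [Bdry.plug, Bdry.map] at hH)
  | @mvarCongr _ _ M As b' ts _ _ hobj =>
    cases b' <;> first | exact hobj.elim | (cases b <;> first | exact hb.elim | simp [Bdry.plug, Bdry.plugEq, Bdry.map] at hH)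
  | congr i hobj =>
    cases h : (T.rule i).bdry <;> rw [h] at hH hobj <;> first | exact hobj.elim | (cases b <;> first | exact hb.elim | simp [Bdry.plug, Bdry.plugEq, Bdry.map] at hH)
  | _ => cases b <;> first | exact hb.elim | simp [Bdry.plug] at hH

/-! ## Inversion of naturality for variables -/

theorem Natural.sym_inv {b : Bdry S} {s : S.Sym}
    {es : Fin (S.arity s).args.length → Arg S} (hb : b.IsObj)
    (h : T.Natural Θ Γ (.thesis (b.plug (.sym s es)))) :
    ∃ i, (T.rule i).IsSymbolRule s ∧
      ∀ (k M : ℕ) (B : ABdry S) (e : Arg S), (T.rule i).prem[k]? = some (M, B) → B.IsObj →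
        (argInst (T.rule i).prem es)[k]? = some (M, e) →
        T.Natural Θ Γ ((B.act ((argInst (T.rule i).prem es).take k)).plug e) := by
  generalize hJ : AJdg.thesis (b.plug (.sym s es)) = J at h
  cases h with
  | @sym _ s' es' b' i hi hb' hprem =>
    have key : Arg.sym s es = .sym s' es' := by
      cases b <;> first | exact hb.elim | skip
      all_goals
        cases b' <;> first | exact hb'.elim | skip
        all_goals simp [Bdry.plug] at hJ
      · exact Arg.sym.injEq .. ▸ hJ
      · exact Arg.sym.injEq .. ▸ hJ.1
    simp only [Arg.sym.injEq] at key
    obtain ⟨rfl, key⟩ := key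
    obtain rfl := eq_of_heq key
    exact ⟨i, hi, hprem⟩
  | _ => cases b <;> first | exact hb.elim | simp [Bdry.plug] at hJ

theorem Natural.fvar_inv {a : ℕ} {A : Arg S} (h : T.Natural Θ Γ (.thesis (.tm (.fvar a) A))) :
    Γ.lookup a = some A := by
  generalize hJ : AJdg.thesis (Thesis.tm (.fvar a) A) = J at h
  cases h with
  | var h =>
    simp only [AJdg.thesis.injEq, Thesis.tm.injEq, Arg.fvar.injEq] at hJ
    obtain ⟨rfl, rfl⟩ := hJ
    exact h
  | @sym _ _ _ b => cases b <;> simp [Bdry.plug] at hJ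
  | _ => simp at hJ

theorem _root_.FTT.Arg.mvarL_inj {M M' : ℕ} {l l' : List (Arg S)}
    (h : Arg.mvarL M l = .mvarL M' l') : M = M' ∧ l = l' := by
  let f : Arg S → ℕ × List (Arg S) := fun e => match e with
    | .mvar M _ ts => (M, List.ofFn ts)
    | _ => (0, [])
  have h' := congrArg f h
  simp only [f, Arg.mvarL, Prod.mk.injEq, List.ofFn_get] at h'
  exact h'

/-- Here the absence of a conversion rule from naturality counts: the boundary must be,
syntactically, the one computed from the boundary of `M` and the arguments. -/
theorem Natural.mvarL_inv {M : ℕ} {l : List (Arg S)} {b : Bdry S} (hb : b.IsObj)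
    (h : T.Natural Θ Γ (.thesis (b.plug (.mvarL M l)))) :
    ∃ B, Θ.lookup M = some B ∧ B.inst l = b ∧
      Spine id (fun t A => T.Natural Θ Γ (.thesis (.tm t A))) l B := by
  generalize hJ : AJdg.thesis (b.plug (.mvarL M l)) = J at h
  cases h with
  | @mvarTy _ M' As ts hM hts =>
    cases b with
    | ty =>
      simp only [Bdry.plug, AJdg.thesis.injEq, Thesis.isTy.injEq] at hJ
      rw [← Arg.mvarL_ofFn] at hJ
      obtain ⟨rfl, rfl⟩ := Arg.mvarL_inj hJ
      exact ⟨_, hM, ABdry.inst_ofFn _ _, spine_ofFn.2 hts⟩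
    | tm A => simp [Bdry.plug] at hJ
    | _ => exact hb.elim
  | @mvarTm _ M' As B ts hM hts =>
    cases b with
    | ty => simp [Bdry.plug] at hJ
    | tm A =>
      simp only [Bdry.plug, AJdg.thesis.injEq, Thesis.tm.injEq] at hJ
      rw [← Arg.mvarL_ofFn] at hJ
      obtain ⟨rfl, rfl⟩ := Arg.mvarL_inj hJ.1
      exact ⟨_, hM, by rw [ABdry.inst_ofFn, hJ.2]; rfl, spine_ofFn.2 hts⟩
    | _ => exact hb.elim
  | var => cases b <;> simp [Bdry.plug, Arg.mvarL] at hJ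
  | @sym _ _ _ b' =>
    cases b <;> first | exact hb.elim | (cases b' <;> simp [Bdry.plug, Arg.mvarL] at hJ)
  | abstr => cases b <;> simp [Bdry.plug] at hJ

/-- A list of distinct free variables which are not in `V`. -/
def FreshNames : Set ℕ → List (Arg S) → Prop
  | _, [] => True
  | V, t :: l => ∃ a, t = .fvar a ∧ a ∉ V ∧ FreshNames (insert a V) l

/-- Inverting the abstraction rule repeatedly opens all the abstractions; the chosen names form the
list `l`, and `Γ'` records their types. -/
theorem Natural.exists_inst {B : ABdry S} {e : Arg S} (he : e.HasAbs B.arity.2)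
    (h : T.Natural Θ Γ (B.plug e)) :
    ∃ (Γ' : VCtx S) (l : List (Arg S)), (∀ a A, Γ.lookup a = some A → Γ'.lookup a = some A) ∧
      FreshNames (dom Γ) l ∧
      Spine id (fun t A => ∃ a, t = .fvar a ∧ Γ'.lookup a = some A) l B ∧
      T.Natural Θ Γ' (.thesis ((B.inst l).plug (e.instL l))) := by
  induction hn : B.arity.2 generalizing B e Γ with
  | zero =>
    cases B with
    | thesis b => exact ⟨Γ, [], fun _ _ h => h, trivial, trivial, h⟩
    | abstr A B => cases hn
  | succ n ih =>
    cases B with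
    | thesis b => cases hn
    | abstr A B =>
      obtain ⟨f, rfl, hf⟩ := he
      cases h with
      | @abstr _ a _ _ ha hJ =>
        change T.Natural _ _ ((B.plug f).subst _) at hJ
        rw [ABdry.plug_subst _ hf] at hJ
        obtain ⟨Γ', l, h1, h2, h3, h4⟩ := ih (by rw [ABdry.arity_subst]; exact hf.subst _) hJ
          (by rw [ABdry.arity_subst]; simpa [ABdry.arity] using hn)
        rw [dom_append_single] at h2
        exact ⟨Γ', .fvar a :: l, fun b B hb => h1 _ _ (lookup_append_left hb), ⟨a, rfl, ha, h2⟩,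
          ⟨⟨a, rfl, h1 _ _ (lookup_append_single ha _)⟩, h3⟩, h4⟩

end RawTT

/-! ## Injectivity of opening -/

variable {ar : ℕ → Option (Cls × ℕ)} {V : Set ℕ}

/-- An injective substitution of variables, the free ones among which are not in `V`. -/
structure Arg.IsVarSub (V : Set ℕ) (k : ℕ) (ρ : ℕ → Arg S) : Prop where
  var : ∀ i < k, (∃ j, ρ i = bvar j) ∨ ∃ a, a ∉ V ∧ ρ i = fvar a
  inj : ∀ i < k, ∀ j < k, ρ i = ρ j → i = j

theorem Arg.IsVarSub.up {k : ℕ} {ρ : ℕ → Arg S} (h : IsVarSub V k ρ) :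
    IsVarSub V (k + 1) (Arg.up ρ) where
  var i hi := by
    cases i with
    | zero => exact .inl ⟨0, rfl⟩
    | succ i =>
      rcases h.var i (by omega) with ⟨j, hj⟩ | ⟨a, ha, hj⟩
      · exact .inl ⟨j + 1, by simp [Arg.up, hj, rename]⟩
      · exact .inr ⟨a, ha, by simp [Arg.up, hj, rename]⟩
  inj i hi j hj hij := by
    cases i with
    | zero =>
      cases j with
      | zero => rfl
      | succ j =>
        rcases h.var j (by omega) with ⟨l, hl⟩ | ⟨a, _, hl⟩ <;> simp [Arg.up, hl, rename] at hij
    | succ i =>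
      cases j with
      | zero =>
        rcases h.var i (by omega) with ⟨l, hl⟩ | ⟨a, _, hl⟩ <;> simp [Arg.up, hl, rename] at hij
      | succ j =>
        refine congrArg Nat.succ (h.inj i (by omega) j (by omega) ?_)
        rcases h.var i (by omega) with ⟨l, hl⟩ | ⟨a, _, hl⟩ <;>
        rcases h.var j (by omega) with ⟨l', hl'⟩ | ⟨a', _, hl'⟩ <;>
        simp_all [Arg.up, rename]

/-- Variables are replaced by distinct variables, and the free ones among these lie outside `V`, so
they cannot be confused with free variables already present in `e` or `e'`. -/
theorem Arg.Valid.subst_inj {k : ℕ} {c c' : Cls × ℕ} {e e' : Arg S} (h : e.Valid ar V k c)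
    (h' : e'.Valid ar V k c') {ρ : ℕ → Arg S} (hρ : IsVarSub V k ρ)
    (heq : e.subst ρ = e'.subst ρ) : e = e' := by
  induction h generalizing e' c' ρ with
  | fvar ha =>
    cases h' with
    | bvar hi =>
      rcases hρ.var _ hi with ⟨j, hj⟩ | ⟨a, ha', hj⟩
      · simp [Arg.subst, hj] at heq
      · simp only [Arg.subst, hj, Arg.fvar.injEq] at heq
        exact (ha' (heq ▸ ha)).elim
    | fvar => exact heq
    | _ => simp [Arg.subst] at heq
  | bvar hi =>
    cases h' with
    | bvar hj => exact congrArg _ (hρ.inj _ hi _ hj heq)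
    | fvar ha =>
      rcases hρ.var _ hi with ⟨j, hj⟩ | ⟨a, ha', hj⟩
      · simp [Arg.subst, hj] at heq
      · simp only [Arg.subst, hj, Arg.fvar.injEq] at heq
        exact (ha' (heq ▸ ha)).elim
    | _ => rcases hρ.var _ hi with ⟨j, hj⟩ | ⟨a, ha', hj⟩ <;> simp [Arg.subst, hj] at heq
  | sym _ ih =>
    cases h' with
    | bvar hi =>
      rcases hρ.var _ hi with ⟨j, hj⟩ | ⟨a, ha', hj⟩ <;> simp [Arg.subst, hj] at heq
    | sym h' =>
      simp only [Arg.subst, Arg.sym.injEq] at heq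
      obtain ⟨rfl, heq⟩ := heq
      have heq := eq_of_heq heq
      exact congrArg _ (funext fun i => ih i (h' i) hρ (congrFun heq i))
    | _ => simp [Arg.subst] at heq
  | mvar _ _ _ ih =>
    cases h' with
    | bvar hi =>
      rcases hρ.var _ hi with ⟨j, hj⟩ | ⟨a, ha', hj⟩ <;> simp [Arg.subst, hj] at heq
    | mvar _ _ h' =>
      simp only [Arg.subst, Arg.mvar.injEq] at heq
      obtain ⟨rfl, rfl, heq⟩ := heq
      have heq := eq_of_heq heq
      exact congrArg _ (funext fun i => ih i (h' i) hρ (congrFun heq i))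
    | _ => simp [Arg.subst] at heq
  | abstr _ ih =>
    cases h' with
    | bvar hi =>
      rcases hρ.var _ hi with ⟨j, hj⟩ | ⟨a, ha', hj⟩ <;> simp [Arg.subst, hj] at heq
    | abstr h' =>
      simp only [Arg.subst, Arg.abstr.injEq] at heq
      exact congrArg _ (ih h' hρ.up heq)
    | _ => simp [Arg.subst] at heq
  | dummyTy =>
    cases h' with
    | bvar hi =>
      rcases hρ.var _ hi with ⟨j, hj⟩ | ⟨a, ha', hj⟩ <;> simp [Arg.subst, hj] at heq
    | dummyTy => rfl
    | _ => simp [Arg.subst] at heq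
  | dummyTm =>
    cases h' with
    | bvar hi =>
      rcases hρ.var _ hi with ⟨j, hj⟩ | ⟨a, ha', hj⟩ <;> simp [Arg.subst, hj] at heq
    | dummyTm => rfl
    | _ => simp [Arg.subst] at heq

theorem Bdry.Valid.subst_inj {k : ℕ} {b b' : Bdry S} (h : b.Valid ar V k)
    (h' : b'.Valid ar V k) {ρ : ℕ → Arg S} (hρ : Arg.IsVarSub V k ρ)
    (heq : b.map (Arg.subst ρ) = b'.map (Arg.subst ρ)) : b = b' := by
  cases b <;> cases b' <;> simp only [Bdry.map, reduceCtorEq, Bdry.tm.injEq, Bdry.eqTy.injEq,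
    Bdry.eqTm.injEq] at heq ⊢
  · exact Arg.Valid.subst_inj h h' hρ heq
  · exact ⟨h.1.subst_inj h'.1 hρ heq.1, h.2.subst_inj h'.2 hρ heq.2⟩
  · exact ⟨h.1.subst_inj h'.1 hρ heq.1, h.2.1.subst_inj h'.2.1 hρ heq.2.1,
      h.2.2.subst_inj h'.2.2 hρ heq.2.2⟩

theorem ABdry.Valid.subst_inj {k : ℕ} {B B' : ABdry S} (h : B.Valid ar V k)
    (h' : B'.Valid ar V k) {ρ : ℕ → Arg S} (hρ : Arg.IsVarSub V k ρ)
    (heq : B.subst ρ = B'.subst ρ) : B = B' := by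
  induction B generalizing B' k ρ with
  | thesis b =>
    cases B' with
    | thesis b' =>
      exact congrArg _ (Bdry.Valid.subst_inj h h' hρ (ABdry.thesis.inj heq))
    | abstr => simp [ABdry.subst] at heq
  | abstr A B ih =>
    cases B' with
    | thesis b' => simp [ABdry.subst] at heq
    | abstr A' B' =>
      simp only [ABdry.subst, ABdry.abstr.injEq] at heq
      rw [h.1.subst_inj h'.1 hρ heq.1, ih h.2 h'.2 hρ.up heq.2]

theorem Arg.isVarSub_single {a : ℕ} (ha : a ∉ V) : IsVarSub V 1 (single (fvar a : Arg S)) where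
  var i hi := by
    obtain rfl : i = 0 := by omega
    exact .inr ⟨a, ha, rfl⟩
  inj i hi j hj _ := by omega

/-- A closed abstracted boundary is determined by its application to fresh variables. -/
theorem Spine.boundary_unique {D : Arg S → Arg S → Prop}
    (hD : ∀ t A A', D t A → D t A' → A = A') {l : List (Arg S)} (hl : RawTT.FreshNames V l)
    {B B' : ABdry S} (hB : B.Valid ar V 0) (hB' : B'.Valid ar V 0) (h : Spine id D l B)
    (h' : Spine id D l B') (heq : B.inst l = B'.inst l) : B = B' := by
  induction l generalizing B B' V with
  | nil =>
    cases B with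
    | thesis b =>
      cases B' with
      | thesis b' => exact congrArg _ heq
      | abstr => exact h'.elim
    | abstr => exact h.elim
  | cons t l ih =>
    cases B with
    | thesis b => exact h.elim
    | abstr A B =>
      cases B' with
      | thesis b' => exact h'.elim
      | abstr A' B' =>
        obtain ⟨a, rfl, ha, hl⟩ := hl
        obtain rfl := hD _ _ _ h.1 h'.1
        -- The induction gives equality after opening with `a`; as `a` is fresh, the opening can be
        -- undone.
        refine congrArg _ (hB.2.subst_inj hB'.2 (Arg.isVarSub_single ha) ?_)
        refine ih hl ?_ ?_ h.2 h'.2 heq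
        · exact (hB.2.mono (fun _ _ h => h) (Set.subset_insert _ _)).subst_single
            (Arg.Valid.single (.fvar (Set.mem_insert _ _)))
        · exact (hB'.2.mono (fun _ _ h => h) (Set.subset_insert _ _)).subst_single
            (Arg.Valid.single (.fvar (Set.mem_insert _ _)))

/-! ### Boundaries at which a generic application is natural for variables -/

theorem Arg.valid_abstrs_mvar {V : Set ℕ} {k n m M l : ℕ} {c : Cls} {ts : Fin l → Arg S}
    (h : (abstrs n (.mvar M l ts)).Valid ar V k (c, m)) :
    m = n ∧ ar M = some (c, l) ∧ c.IsObj := by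
  induction n generalizing k m with
  | zero => cases h with | mvar h hc _ => exact ⟨rfl, h, hc⟩
  | succ n ih =>
    cases h with
    | abstr h =>
      obtain ⟨rfl, h'⟩ := ih h
      exact ⟨rfl, h'⟩

/-- If the generic application of a metavariable is natural for variables at a boundary, this is
the boundary of the metavariable. -/
theorem RawTT.Natural.lookup_eq {T : RawTT.{u, v} S} {Ξ : MCtx S} (hΞ : Ξ.Valid) {M n : ℕ}
    {B : ABdry S} (hB : B.Valid Ξ.ar ∅ 0)
    (he : (Arg.abstrs n (.mvar M n fun i => .bvar (Fin.rev i)) : Arg S).Valid Ξ.ar ∅ 0 B.arity)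
    (h : T.Natural Ξ [] (B.plug (Arg.abstrs n (.mvar M n fun i => .bvar (Fin.rev i))))) :
    Ξ.lookup M = some B := by
  obtain ⟨hn, -, hc⟩ := Arg.valid_abstrs_mvar (c := B.arity.1) (m := B.arity.2) he
  -- After opening with fresh variables the generic application becomes `M` applied to those
  -- variables, and inversion can be used.
  obtain ⟨Γ, l, -, hl, hs, hnat⟩ := h.exists_inst he.hasAbs
  have hlen := hs.length
  rw [← Arg.genApp_of_isObj hc, ← hn, ← hlen, Arg.instL_genApp hc] at hnat
  obtain ⟨B', hM, hinst, hs'⟩ := hnat.mvarL_inv (by rwa [Bdry.IsObj, ABdry.isObj_inst hlen])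
  rw [hM]
  rw [dom_nil] at hl
  have hs'' : ∀ t ∈ l, ∃ a, t = Arg.fvar a := fun t ht => by
    obtain ⟨A, a, ha, -⟩ := hs.exists_of_mem ht
    exact ⟨a, ha⟩
  -- Both `B` and the boundary of `M` in `Ξ` match the fresh variables and agree once applied to
  -- them. The relation used is functional because `Γ` assigns one type to each variable.
  refine congrArg some (Spine.boundary_unique (D := fun t A => ∃ a, t = .fvar a ∧
    Γ.lookup a = some A) ?_ hl (hΞ.lookup hM) hB ?_ hs hinst)
  · rintro _ A A' ⟨a, rfl, h1⟩ ⟨a', h3, h2⟩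
    obtain rfl := Arg.fvar.inj h3
    rw [h1] at h2
    exact Option.some.inj h2
  -- A variable is natural only at its declared type, so the spine of natural arguments is one of
  -- declared types.
  · clear hs hl hlen hinst hM hnat
    induction l generalizing B' with
    | nil => cases B' <;> exact hs'
    | cons t l ih =>
      cases B' with
      | thesis b => exact hs'.elim
      | abstr A B' =>
        obtain ⟨a, rfl⟩ := hs'' t List.mem_cons_self
        exact ⟨⟨a, rfl, hs'.1.fvar_inv⟩, ih _ hs'.2 fun t ht => hs'' t (List.mem_cons_of_mem _ ht)⟩

/-! ## Extension of metavariable contexts -/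

theorem MCtx.Valid.snoc {Θ : MCtx S} (h : Θ.Valid) {M : ℕ} (hM : M ∉ dom Θ) {B : ABdry S}
    (hB : B.Valid Θ.ar ∅ 0) : MCtx.Valid (Θ ++ [(M, B)]) := by
  refine ⟨?_, fun k N B' hk => ?_⟩
  · rw [List.map_append]
    refine List.nodup_append.2 ⟨h.1, by simp, ?_⟩
    rintro x hx y hy rfl
    obtain rfl : x = M := by simpa using hy
    exact hM hx
  · rcases lt_trichotomy k Θ.length with hlt | heq | hgt
    · rw [List.getElem?_append_left hlt] at hk
      rw [List.take_append_of_le_length hlt.le]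
      exact h.2 _ _ _ hk
    · subst heq
      simp only [List.getElem?_concat_length, Option.some.injEq, Prod.mk.injEq] at hk
      rw [List.take_left' rfl, ← hk.2]
      exact hB
    · rw [List.getElem?_eq_none (by simp; omega)] at hk
      cases hk

theorem MCtx.Valid.of_snoc {Θ : MCtx S} {M : ℕ} {B : ABdry S}
    (h : MCtx.Valid (Θ ++ [(M, B)])) : Θ.Valid ∧ M ∉ dom Θ ∧ B.Valid Θ.ar ∅ 0 := by
  have h1 := h.1
  rw [List.map_append, List.nodup_append] at h1
  refine ⟨⟨h1.1, fun k N B' hk => ?_⟩, fun hM => h1.2.2 _ hM M (by simp) rfl, ?_⟩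
  · have hlt : k < Θ.length := by
      by_contra hlt
      rw [List.getElem?_eq_none (by omega)] at hk
      cases hk
    have := h.2 k N B' (by rw [List.getElem?_append_left hlt, hk])
    rwa [List.take_append_of_le_length hlt.le] at this
  · have := h.2 Θ.length M B (by simp)
    rwa [List.take_left' rfl] at this

theorem MCtx.Valid.append {Θ Ξ : MCtx S} (hΘ : Θ.Valid) (hΞ : Ξ.Valid)
    (hd : Disjoint (dom Ξ) (dom Θ)) : MCtx.Valid (Θ ++ Ξ) := by
  induction Ξ using List.reverseRecOn with
  | nil => simpa using hΘ
  | append_singleton Ξ q ih =>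
    obtain ⟨M, B⟩ := q
    obtain ⟨h1, h2, h3⟩ := hΞ.of_snoc
    rw [dom_append_single, Set.disjoint_insert_left] at hd
    rw [← List.append_assoc]
    refine (ih h1 hd.2).snoc (by rw [dom_append]; exact fun h => h.elim hd.1 h2) ?_
    refine h3.mono (MCtx.ar_mono fun N B' hN => ?_) subset_rfl
    rw [lookup_append_right (Set.disjoint_left.1 hd.2 (mem_dom_of_lookup hN)), hN]

theorem RawTT.MCtxDerivable.valid {T : RawTT.{u, v} S} {Θ : MCtx S} (h : T.MCtxDerivable Θ) :
    Θ.Valid := by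
  induction h with
  | nil => exact ⟨List.nodup_nil, fun k M B h => by simp at h⟩
  | extend _ hB hM ih => exact ih.snoc hM (by simpa only [dom_nil] using hB.valid.2.2)

theorem IsInst.trOK {I : Inst S} {Ξ Θ : MCtx S} (h : IsInst I Ξ Θ []) :
    Arg.TrOK Ξ.ar ∅ Θ.ar ∅ I .fvar where
  mvar M c hM := by
    obtain ⟨f, h1, h2⟩ := h.lookup hM
    rw [dom_nil] at h2
    exact .inr ⟨f, h1, h2⟩
  fvar a ha := ha.elim

theorem IsInst.closed {I : Inst S} {Ξ Θ : MCtx S} {Γ : VCtx S} (h : IsInst I Ξ Θ Γ) :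
    Arg.Closed I .fvar :=
  ⟨fun _ _ hM => by obtain ⟨c, -, hv⟩ := h.valid_of_lookup hM; exact hv.lc, fun _ => trivial⟩

theorem IsInst.mono {I : Inst S} {Ξ Θ Θ' : MCtx S} (h : IsInst I Ξ Θ [])
    (hΘ : ∀ M c, Θ.ar M = some c → Θ'.ar M = some c) : IsInst I Ξ Θ' [] :=
  List.Forall₂.imp (fun _ _ hpq => ⟨hpq.1, hpq.2.mono hΘ subset_rfl le_rfl⟩) h

theorem IsInst.snoc {I : Inst S} {Ξ Θ : MCtx S} (h : IsInst I Ξ Θ []) (M : ℕ) {e : Arg S}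
    {B : ABdry S} (he : e.Valid Θ.ar ∅ 0 B.arity) : IsInst (I ++ [(M, e)]) (Ξ ++ [(M, B)]) Θ [] :=
  List.rel_append h (.cons ⟨rfl, by rwa [dom_nil]⟩ .nil)

theorem IsInst.comp {I J : Inst S} {Ξ Ψ Θ : MCtx S} (hI : IsInst I Ξ Ψ []) (hJ : IsInst J Ψ Θ []) :
    IsInst (J.comp I) Ξ Θ [] := by
  have := hI.map_tr (Γ := []) (by rw [dom_nil]; exact hJ.trOK)
  rwa [← Arg.act_eq_tr'] at this

theorem IsInst.act_append {I : Inst S} {Ξ Θ : MCtx S} {Γ : VCtx S} (h : IsInst I Ξ Θ Γ)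
    (I' : Inst S) {B : ABdry S} {k : ℕ} {V : Set ℕ} (hB : B.Valid Ξ.ar V k) :
    B.act (I ++ I') = B.act I := by
  rw [ABdry.act_eq_tr, ABdry.act_eq_tr]
  refine hB.tr_congr (fun N c hN => ?_) fun _ _ => rfl
  obtain ⟨f, hf, -⟩ := h.lookup hN
  rw [hf, lookup_append_left hf]

/-- The composition of instantiations. -/
theorem IsInst.act_comp {I J : Inst S} {Ξ Ψ Θ : MCtx S} {Γ Γ' : VCtx S} (hI : IsInst I Ξ Ψ Γ)
    (hJ : IsInst J Ψ Θ Γ') {B : ABdry S} {k : ℕ} (hB : B.Valid Ξ.ar ∅ k) :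
    (B.act I).act J = B.act (J.comp I) := by
  rw [ABdry.act_eq_tr J, hB.act_tr hJ.closed hI.hasAbs_lookup, ← Arg.act_eq_tr']; rfl

theorem lookup_comp (J I : Inst S) (M : ℕ) : (J.comp I).lookup M = (I.lookup M).map (Arg.act J) :=
  Arg.lookup_map I (Arg.act J) M

/-! ## Basic instantiations -/

theorem lookup_map_keys {X Y : Type u} (L : List (ℕ × X)) (f : ℕ → X → Y) (a : ℕ) :
    (L.map fun q => (q.1, f q.1 q.2)).lookup a = (L.lookup a).map (f a) := by
  induction L with
  | nil => rfl
  | cons q L ih =>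
    obtain ⟨b, x⟩ := q
    by_cases h : a = b
    · subst h; simp
    · have hb : (a == b) = false := by simpa using h
      simp only [List.map_cons, List.lookup_cons, hb, ih]

theorem lookup_basicInst (Ψ : MCtx S) (M : ℕ) (e : Arg S) (N : ℕ) :
    (basicInst Ψ M e).lookup N =
      (Ψ.lookup N).map fun B => if N = M then e else Arg.genApp N B.arity :=
  lookup_map_keys Ψ (fun N B => if N = M then e else Arg.genApp N B.arity) N

theorem lookup_genInst (Ψ : MCtx S) (N : ℕ) :
    (genInst Ψ).lookup N = (Ψ.lookup N).map fun B => Arg.genApp N B.arity :=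
  lookup_map_keys Ψ (fun N B => Arg.genApp N B.arity) N

theorem basicInst_snoc (Ψ : MCtx S) (M : ℕ) (e : Arg S) (N : ℕ) (B : ABdry S) :
    basicInst (Ψ ++ [(N, B)]) M e =
      basicInst Ψ M e ++ [(N, if N = M then e else Arg.genApp N B.arity)] := by
  simp [basicInst]

/-- Each boundary is acted upon by the preceding part of the basic instantiation only, so appending
an entry leaves the earlier ones unchanged. This permits induction from the end of the context. -/
theorem basicCod_snoc (Ψ : MCtx S) (M : ℕ) (e : Arg S) (N : ℕ) (B : ABdry S) :
    basicCod (Ψ ++ [(N, B)]) M e =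
      basicCod Ψ M e ++ if N = M then [] else [(N, B.act (basicInst Ψ M e))] := by
  have hlen : (basicInst Ψ M e).length = Ψ.length := by simp [basicInst]
  have h1 : (Ψ.mapIdx fun j q => (q.1, q.2.act ((basicInst (Ψ ++ [(N, B)]) M e).take j))) =
      Ψ.mapIdx fun j q => (q.1, q.2.act ((basicInst Ψ M e).take j)) := by
    apply List.ext_getElem?
    intro k
    rw [List.getElem?_mapIdx, List.getElem?_mapIdx]
    rcases hk : Ψ[k]? with _ | q
    · rfl
    · have hlt : k < Ψ.length := by
        by_contra hlt
        rw [List.getElem?_eq_none (by omega)] at hk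
        cases hk
      rw [basicInst_snoc, List.take_append_of_le_length (by omega)]
  unfold basicCod
  rw [List.mapIdx_concat, List.filter_append, h1, basicInst_snoc, List.take_left' hlen]
  congr 1
  by_cases h : N = M <;> simp [h]

theorem basicCod_prefix (Ψ Ψ' : MCtx S) (M : ℕ) (e : Arg S) :
    basicCod Ψ M e <+: basicCod (Ψ ++ Ψ') M e := by
  induction Ψ' using List.reverseRecOn with
  | nil => simp
  | append_singleton Ψ' q ih =>
    rw [← List.append_assoc, basicCod_snoc]
    exact ih.trans (List.prefix_append _ _)

theorem act_basicInst_of_not_mem {Ψ : MCtx S} {M : ℕ} (hM : M ∉ dom Ψ) (e : Arg S) {B : ABdry S}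
    {V : Set ℕ} {k : ℕ} (hB : B.Valid Ψ.ar V k) : B.act (basicInst Ψ M e) = B := by
  refine hB.act_eq_self fun N c hN => .inr ?_
  obtain ⟨B', hB', rfl⟩ := MCtx.exists_of_ar hN
  have hNM : N ≠ M := by
    rintro rfl
    exact hM (mem_dom_of_lookup hB')
  rw [lookup_basicInst, hB', Option.map_some, if_neg hNM]

/-- If `M` is absent, all entries of the basic instantiation are generic applications, which act
trivially. -/
theorem basicCod_of_not_mem {Ψ : MCtx S} (hΨ : Ψ.Valid) {M : ℕ} (hM : M ∉ dom Ψ) (e : Arg S) :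
    basicCod Ψ M e = Ψ := by
  induction Ψ using List.reverseRecOn with
  | nil => rfl
  | append_singleton Ψ q ih =>
    obtain ⟨N, B⟩ := q
    obtain ⟨h1, h2, h3⟩ := hΨ.of_snoc
    rw [dom_append_single, Set.mem_insert_iff, not_or] at hM
    rw [basicCod_snoc, ih h1 hM.2, if_neg (Ne.symm hM.1), act_basicInst_of_not_mem hM.2 e h3]

theorem getElem?_of_snoc {X : Type u} {L : List (ℕ × X)} {k a : ℕ} {x : X} (y : ℕ × X)
    (h : L[k]? = some (a, x)) : (L ++ [y])[k]? = some (a, x) ∧ (L ++ [y]).take k = L.take k := by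
  have hlt : k < L.length := by
    by_contra hlt
    rw [List.getElem?_eq_none (by omega)] at h
    cases h
  exact ⟨by rw [List.getElem?_append_left hlt, h], List.take_append_of_le_length hlt.le⟩

theorem dom_basicCod (Ψ : MCtx S) (M : ℕ) (e : Arg S) : dom (basicCod Ψ M e) = dom Ψ \ {M} := by
  induction Ψ using List.reverseRecOn with
  | nil => simp [basicCod, dom_nil]
  | append_singleton Ψ q ih =>
    obtain ⟨N, B⟩ := q
    rw [basicCod_snoc, dom_append, ih, dom_append_single]
    by_cases h : N = M
    · subst h; rw [if_pos rfl, dom_nil]; ext a; simp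
    · rw [if_neg h]
      ext a
      simp only [dom, Set.mem_union, Set.mem_sdiff, Set.mem_insert_iff, Set.mem_singleton_iff,
        List.map_cons, List.map_nil, List.mem_singleton, Set.mem_ofPred_eq]
      constructor
      · rintro (h' | rfl)
        · exact ⟨.inr h'.1, h'.2⟩
        · exact ⟨.inl rfl, h⟩
      · rintro ⟨rfl | h', h2⟩
        · exact .inr rfl
        · exact .inl ⟨h', h2⟩

/-- A basic instantiation is an instantiation. -/
theorem basicInst_spec {Ψ : MCtx S} (hΨ : Ψ.Valid) {M : ℕ} {e : Arg S}
    (he : ∀ (k : ℕ) (B : ABdry S), Ψ[k]? = some (M, B) →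
      e.Valid (MCtx.ar (Ψ.take k)) ∅ 0 B.arity) :
    (basicCod Ψ M e).Valid ∧ IsInst (basicInst Ψ M e) Ψ (basicCod Ψ M e) [] ∧
      ∀ N B, N ≠ M → Ψ.lookup N = some B →
        (basicCod Ψ M e).lookup N = some (B.act (basicInst Ψ M e)) := by
  induction Ψ using List.reverseRecOn with
  | nil => exact ⟨hΨ, .nil, fun N B _ h => by cases h⟩
  | append_singleton Ψ q ih =>
    obtain ⟨N, B⟩ := q
    obtain ⟨h1, h2, h3⟩ := hΨ.of_snoc
    obtain ⟨ihv, ihi, ihl⟩ := ih h1 fun k B' hk => by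
      obtain ⟨h4, h5⟩ := getElem?_of_snoc (N, B) hk
      have := he k B' h4
      rwa [h5] at this
    have hact : ∀ B' : ABdry S, B'.Valid (MCtx.ar Ψ) ∅ 0 →
        B'.act (basicInst (Ψ ++ [(N, B)]) M e) = B'.act (basicInst Ψ M e) := fun B' hB' => by
      rw [basicInst_snoc]; exact ihi.act_append _ hB'
    rw [basicCod_snoc, basicInst_snoc]
    rw [basicInst_snoc] at hact
    by_cases hNM : N = M
    · subst hNM
      simp only [if_true, List.append_nil] at hact ⊢
      refine ⟨ihv, ihi.snoc N ?_, fun N' B' hN' hl => ?_⟩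
      -- `M` is now the last metavariable. The part before it does not contain `M` and is left
      -- unchanged, so it is the whole codomain, and `e` is valid over it.
      · have := he Ψ.length B (by simp)
        rw [List.take_left' rfl] at this
        rwa [basicCod_of_not_mem h1 h2]
      · rw [lookup_append_single_of_ne hN'] at hl
        rw [ihl N' B' hN' hl, hact _ (h1.lookup hl)]
    · simp only [if_neg hNM] at hact ⊢
      have hBv : (B.act (basicInst Ψ M e)).Valid (MCtx.ar (basicCod Ψ M e)) ∅ 0 := by
        rw [ABdry.act_eq_tr]; exact h3.tr ihi.trOK
      have hN : N ∉ dom (basicCod Ψ M e) := by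
        rw [dom_basicCod]; exact fun h => h2 h.1
      refine ⟨ihv.snoc hN hBv, ?_, fun N' B' hN' hl => ?_⟩
      · refine (ihi.mono (MCtx.ar_mono fun _ _ h => lookup_append_left h)).snoc N ?_
        refine Arg.genApp_valid ?_
        rw [MCtx.ar_of_lookup (lookup_append_single hN _), ABdry.arity_act]
      · by_cases hNN : N' = N
        · subst hNN
          rw [lookup_append_single h2, Option.some.injEq] at hl
          subst hl
          rw [lookup_append_single hN, hact _ h3]
        · rw [lookup_append_single_of_ne hNN] at hl ⊢
          rw [ihl N' B' hN' hl, hact _ (h1.lookup hl)]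

namespace RawTT

variable {T : RawTT.{u, v} S}

theorem instDerivable_of_lookup {I : Inst S} {Ξ Θ : MCtx S} {Γ : VCtx S} (hI : IsInst I Ξ Θ Γ)
    (hΞ : Ξ.Valid) (h : ∀ (M : ℕ) (B : ABdry S) (f : Arg S), Ξ.lookup M = some B →
      I.lookup M = some f → T.Derivable (.jdg Θ Γ ((B.act I).plug f))) :
    T.InstDerivable I Ξ Θ Γ := by
  refine ⟨hI, fun k M B e hk he => ?_⟩
  rw [hI.act_take hΞ hk]
  exact h M B e (lookup_of_getElem? hΞ.1 hk) (hI.lookup_of_getElem? hΞ he)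

/-- A basic instantiation by a derivable argument is derivable. -/
theorem MCtxDerivable.basicInst {Ψ : MCtx S} (hΨ : T.MCtxDerivable Ψ) {M : ℕ} {e : Arg S}
    (he : ∀ (k : ℕ) (B : ABdry S), Ψ[k]? = some (M, B) →
      e.Valid (MCtx.ar (Ψ.take k)) ∅ 0 B.arity ∧ T.Derivable (.jdg (Ψ.take k) [] (B.plug e))) :
    T.MCtxDerivable (basicCod Ψ M e) ∧
      T.InstDerivable (basicInst Ψ M e) Ψ (basicCod Ψ M e) [] := by
  induction hΨ with
  | nil => exact ⟨.nil, .nil, fun k M B e h => by simp at h⟩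
  | @extend Ψ N B hΨ hB hN ih =>
    have he' : ∀ (k : ℕ) (B : ABdry S), Ψ[k]? = some (M, B) →
        e.Valid (MCtx.ar (Ψ.take k)) ∅ 0 B.arity ∧
          T.Derivable (.jdg (Ψ.take k) [] (B.plug e)) := fun k B' hk => by
      obtain ⟨h4, h5⟩ := getElem?_of_snoc (N, B) hk
      have := he k B' h4
      rwa [h5] at this
    obtain ⟨ihc, ihi⟩ := ih he'
    have hv := (hΨ.extend hB hN).valid
    obtain ⟨h1, h2, h3⟩ := hv.of_snoc
    obtain ⟨hcv, hci, hcl⟩ := basicInst_spec hv fun k B hk => (he k B hk).1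
    have hact : ∀ B' : ABdry S, B'.Valid Ψ.ar ∅ 0 →
        B'.act (FTT.basicInst (Ψ ++ [(N, B)]) M e) = B'.act (FTT.basicInst Ψ M e) :=
      fun B' hB' => by rw [basicInst_snoc]; exact ihi.1.act_append _ hB'
    -- The induction hypothesis makes the instantiation of the part before `N` derivable, so it
    -- preserves derivability of the boundary of `N`.
    have hBc := hB.act_bdry ihi ihc.valid
    have hNc : N ∉ dom (basicCod Ψ M e) := by
      rw [dom_basicCod]; exact fun h => h2 h.1
    have hcod : T.MCtxDerivable (basicCod (Ψ ++ [(N, B)]) M e) := by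
      rw [basicCod_snoc]
      by_cases hNM : N = M
      · simpa only [if_pos hNM, List.append_nil] using ihc
      · rw [if_neg hNM]
        exact ihc.extend hBc hNc
    have hsub : ∀ N' B', (basicCod Ψ M e).lookup N' = some B' →
        (basicCod (Ψ ++ [(N, B)]) M e).lookup N' = some B' := fun N' B' h => by
      rw [basicCod_snoc]; exact lookup_append_left h
    refine ⟨hcod, instDerivable_of_lookup hci hv fun N' B' f hB' hf => ?_⟩
    rw [lookup_basicInst, hB', Option.map_some, Option.some.injEq] at hf
    by_cases hNN : N' = N
    · subst hNN
      rw [lookup_append_single hN, Option.some.injEq] at hB'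
      subst hB'
      rw [hact _ h3]
      by_cases hNM : N' = M
      · subst hNM
        rw [if_pos rfl] at hf
        subst hf
        -- Since `M` does not occur before itself, its boundary is not altered and the hypothesis on
        -- `e` applies as it stands.
        rw [act_basicInst_of_not_mem h2 _ h3]
        have := (he Ψ.length B (by simp)).2
        rw [List.take_left' rfl] at this
        refine this.weaken hcv (fun N B hN => hsub _ _ ?_) (VCtx.valid_nil _) fun _ _ h => h
        rwa [basicCod_of_not_mem h1 h2]
      · rw [if_neg hNM] at hf
        subst hf
        have hl := hcl N' B hNM (lookup_append_single hN B)
        rw [hact _ h3] at hl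
        -- A metavariable other than `M` is sent to its generic application, which is derivable at
        -- the transported boundary.
        have := Derivable.genApp hl
          (hBc.weaken_bdry hcv hsub (VCtx.valid_nil _) fun _ _ h => h)
        rwa [ABdry.arity_act] at this
    · rw [lookup_append_single_of_ne hNN] at hB'
      obtain ⟨f', hf', -, hd⟩ := ihi.lookup h1 hB'
      rw [lookup_basicInst, hB', Option.map_some, Option.some.injEq, hf] at hf'
      subst hf'
      rw [hact _ (h1.lookup hB')]
      exact hd.weaken hcv hsub (VCtx.valid_nil _) fun _ _ h => h

end RawTT

/-! ## Chains -/

theorem chainCod_snoc (Ξ Θ : MCtx S) (I : Inst S) (N : List ℕ) (M : ℕ) :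
    chainCod Ξ Θ I (N ++ [M]) =
      basicCod (chainCod Ξ Θ I N) M ((I.lookup M).getD .dummyTy) := by
  simp [chainCod, chain]

theorem chainInst_snoc (Ξ Θ : MCtx S) (I : Inst S) (N : List ℕ) (M : ℕ) :
    chainInst Ξ Θ I (N ++ [M]) =
      (basicInst (chainCod Ξ Θ I N) M ((I.lookup M).getD .dummyTy)).comp
        (chainInst Ξ Θ I N) := by
  simp [chainCod, chainInst, chain]

theorem exists_prefix_take {X : Type u} {L R : List (ℕ × X)} {k a : ℕ} {x : X} (ha : a ∉ dom L)
    (hk : (L ++ R)[k]? = some (a, x)) : ∃ R', (L ++ R).take k = L ++ R' := by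
  have hle : L.length ≤ k := by
    by_contra hlt
    rw [List.getElem?_append_left (by omega)] at hk
    exact ha (mem_dom_of_getElem? hk)
  exact ⟨R.take (k - L.length), by rw [List.take_append, List.take_of_length_le hle]⟩

/-- The syntactic description of the chain of basic instantiations. -/
structure ChainSpec (Ξ Θ : MCtx S) (I : Inst S) (N : List ℕ) : Prop where
  valid : (chainCod Ξ Θ I N).Valid
  isPrefix : Θ <+: chainCod Ξ Θ I N
  isInst : IsInst (chainInst Ξ Θ I N) Ξ (chainCod Ξ Θ I N) []
  lookup_cod : ∀ M B, M ∉ N → Ξ.lookup M = some B →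
    (chainCod Ξ Θ I N).lookup M = some (B.act (chainInst Ξ Θ I N))
  lookup_inst : ∀ M B, Ξ.lookup M = some B → (chainInst Ξ Θ I N).lookup M =
    if M ∈ N then I.lookup M else some (Arg.genApp M B.arity)

/-- `Θ` is a prefix of the context of the chain and does not contain `M`, so all of `Θ` precedes
`M`. Therefore `I(M)`, which lives over `Θ`, also makes sense over the part preceding `M`. -/
theorem ChainSpec.valid_arg {Ξ Θ : MCtx S} {I : Inst S} {N : List ℕ} (h : ChainSpec Ξ Θ I N)
    (hI : IsInst I Ξ Θ []) (hd : Disjoint (dom Ξ) (dom Θ)) {M : ℕ} (hM : M ∉ N) {B₀ : ABdry S}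
    (hB₀ : Ξ.lookup M = some B₀) {e : Arg S} (he : I.lookup M = some e)
    {k : ℕ} {B : ABdry S} (hk : (chainCod Ξ Θ I N)[k]? = some (M, B)) :
    B = B₀.act (chainInst Ξ Θ I N) ∧
      (∀ N' B', Θ.lookup N' = some B' →
        ((chainCod Ξ Θ I N).take k).lookup N' = some B') ∧
      e.Valid (MCtx.ar ((chainCod Ξ Θ I N).take k)) ∅ 0 B.arity := by
  have hB : B = B₀.act (chainInst Ξ Θ I N) := by
    have := lookup_of_getElem? h.valid.1 hk
    rw [h.lookup_cod M B₀ hM hB₀] at this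
    exact (Option.some.inj this).symm
  obtain ⟨R, hR⟩ := h.isPrefix
  obtain ⟨R', hR'⟩ := exists_prefix_take
    (Set.disjoint_left.1 hd (mem_dom_of_lookup hB₀)) (hR ▸ hk)
  rw [hR] at hR'
  have hsub : ∀ N' B', Θ.lookup N' = some B' →
      ((chainCod Ξ Θ I N).take k).lookup N' = some B' := fun N' B' h => by
    rw [hR']; exact lookup_append_left h
  refine ⟨hB, hsub, ?_⟩
  obtain ⟨f, hf, hv⟩ := hI.lookup (MCtx.ar_of_lookup hB₀)
  rw [he, Option.some.injEq] at hf
  subst hf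
  rw [dom_nil] at hv
  rw [hB, ABdry.arity_act]
  exact hv.mono (MCtx.ar_mono hsub) subset_rfl le_rfl

/-- The composite sends the metavariables in `N` to their values under `I` and the others to generic
applications. A value under `I` involves only metavariables of `Θ`, so later basic instantiations do
not change it. -/
theorem chainSpec {Ξ Θ : MCtx S} {I : Inst S} (hΞ : Ξ.Valid) (hΘ : Θ.Valid)
    (hI : IsInst I Ξ Θ []) (hd : Disjoint (dom Ξ) (dom Θ)) {N : List ℕ} (hN : N.Nodup)
    (hNΞ : ∀ M ∈ N, M ∈ dom Ξ) : ChainSpec Ξ Θ I N := by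
  induction N using List.reverseRecOn with
  | nil =>
    have hv := hΘ.append hΞ hd
    have hlook : ∀ M B, Ξ.lookup M = some B → (Θ ++ Ξ).lookup M = some B := fun M B h => by
      rw [lookup_append_right (Set.disjoint_left.1 hd (mem_dom_of_lookup h)), h]
    refine ⟨hv, List.prefix_append _ _, ?_, fun M B _ h => ?_, fun M B h => ?_⟩
    · change IsInst (genInst Ξ) Ξ (Θ ++ Ξ) []
      unfold IsInst genInst
      rw [List.forall₂_map_left_iff, List.forall₂_same]
      rintro ⟨M, B⟩ hq
      obtain ⟨k, hk⟩ := List.getElem?_of_mem hq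
      exact ⟨rfl, Arg.genApp_valid (MCtx.ar_of_lookup (hlook _ _ (lookup_of_getElem? hΞ.1 hk)))⟩
    · change (Θ ++ Ξ).lookup M = some (B.act (genInst Ξ))
      rw [hlook M B h, (hΞ.lookup h).act_eq_self]
      intro M' c hM'
      obtain ⟨B', hB', rfl⟩ := MCtx.exists_of_ar hM'
      right
      rw [lookup_genInst, hB']; rfl
    · change (genInst Ξ).lookup M = _
      rw [lookup_genInst, h]; simp
  | append_singleton N M ih =>
    rw [List.nodup_append] at hN
    have h := ih hN.1 fun M hM => hNΞ M (List.mem_append_left _ hM)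
    have hMN : M ∉ N := fun hM => hN.2.2 M hM M (by simp) rfl
    obtain ⟨B₀, hB₀⟩ := exists_lookup (hNΞ M (by simp))
    obtain ⟨e, he, hev⟩ := hI.lookup (MCtx.ar_of_lookup hB₀)
    rw [dom_nil] at hev
    obtain ⟨hv, hi, hl⟩ := basicInst_spec h.valid fun k B hk =>
      (h.valid_arg hI hd hMN hB₀ he hk).2.2
    have hMΘ : M ∉ dom Θ := Set.disjoint_left.1 hd (mem_dom_of_lookup hB₀)
    -- Since `I` is defined at `M`, the default `dummyTy` plays no role.
    have hcod : chainCod Ξ Θ I (N ++ [M]) = basicCod (chainCod Ξ Θ I N) M e := by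
      rw [chainCod_snoc, he]; rfl
    have hinst : chainInst Ξ Θ I (N ++ [M]) =
        (basicInst (chainCod Ξ Θ I N) M e).comp (chainInst Ξ Θ I N) := by
      rw [chainInst_snoc, he]; rfl
    refine ⟨hcod ▸ hv, ?_, ?_, fun M' B hM' hB => ?_, fun M' B hB => ?_⟩
    · obtain ⟨R, hR⟩ := h.isPrefix
      have := basicCod_prefix Θ R M e
      rw [basicCod_of_not_mem hΘ hMΘ, hR] at this
      rwa [hcod]
    · rw [hcod, hinst]
      exact h.isInst.comp hi
    · rw [List.mem_append, not_or, List.mem_singleton] at hM'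
      rw [hcod, hinst, hl M' _ hM'.2 (h.lookup_cod M' B hM'.1 hB),
        h.isInst.act_comp hi (hΞ.lookup hB)]
    · rw [hinst, lookup_comp, h.lookup_inst M' B hB]
      by_cases hM'N : M' ∈ N
      · rw [if_pos hM'N, if_pos (List.mem_append_left _ hM'N)]
        obtain ⟨f, hf, hfv⟩ := hI.lookup (MCtx.ar_of_lookup hB)
        -- The value at an earlier metavariable is over `Θ`, where the basic instantiation for `M`
        -- consists of generic applications.
        rw [hf, Option.map_some, hfv.act_eq_self]
        intro M'' c hc
        obtain ⟨B', hB', rfl⟩ := MCtx.exists_of_ar hc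
        obtain ⟨R, hR⟩ := h.isPrefix
        right
        rw [lookup_basicInst, ← hR, lookup_append_left hB', Option.map_some, if_neg]
        rintro rfl
        exact hMΘ (mem_dom_of_lookup hB')
      · rw [if_neg hM'N, Option.map_some, Arg.act_eq_tr]
        have hlook := lookup_basicInst (chainCod Ξ Θ I N) M e M'
        rw [h.lookup_cod M' B hM'N hB, Option.map_some, ABdry.arity_act] at hlook
        by_cases hMM : M' = M
        · subst hMM
          rw [if_pos rfl] at hlook
          rw [if_pos (by simp), he]
          rw [hB₀, Option.some.injEq] at hB
          subst hB
          rw [Arg.genApp_tr hlook hev]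
        · rw [if_neg hMM] at hlook
          rw [if_neg (by simp [hM'N, hMM]),
            Arg.genApp_tr hlook (V := ∅) (ar := Ξ.ar) (Arg.genApp_valid (MCtx.ar_of_lookup hB))]

/-! ## Metavariables -/

def ABdry.mv : ABdry S → Set ℕ
  | thesis b => b.mv
  | abstr A B => A.mv ∪ B.mv

theorem Arg.act_congr {I J : Inst S} {e : Arg S} (h : ∀ M ∈ e.mv, I.lookup M = J.lookup M) :
    e.act I = e.act J := by
  induction e with
  | sym s es ih =>
    simp only [act, sym.injEq, heq_eq_eq, true_and]
    exact funext fun i => ih i fun M hM => h M (Set.mem_iUnion.2 ⟨i, hM⟩)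
  | mvar M n ts ih =>
    have hts : (fun i => (ts i).act I) = fun i => (ts i).act J :=
      funext fun i => ih i fun M hM => h M (.inr (Set.mem_iUnion.2 ⟨i, hM⟩))
    simp only [act, h M (.inl rfl), hts]
  | abstr e ih => exact congrArg _ (ih h)
  | _ => rfl

theorem ABdry.act_congr {I J : Inst S} {B : ABdry S}
    (h : ∀ M ∈ B.mv, I.lookup M = J.lookup M) : B.act I = B.act J := by
  induction B with
  | thesis b =>
    cases b with
    | ty => rfl
    | tm A => simp only [act, Bdry.map, Arg.act_congr h]
    | eqTy A B =>
      simp only [act, Bdry.map, Arg.act_congr fun M hM => h M (.inl hM),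
        Arg.act_congr fun M hM => h M (.inr hM)]
    | eqTm s t A =>
      simp only [act, Bdry.map, Arg.act_congr fun M hM => h M (.inl (.inl hM)),
        Arg.act_congr fun M hM => h M (.inl (.inr hM)), Arg.act_congr fun M hM => h M (.inr hM)]
  | abstr A B ih =>
    simp only [act, Arg.act_congr fun M hM => h M (.inl hM), ih fun M hM => h M (.inr hM)]

theorem Arg.mv_rename (e : Arg S) (ρ : ℕ → ℕ) : (e.rename ρ).mv = e.mv := by
  induction e generalizing ρ with
  | abstr e ih => exact ih _
  | _ => simp_all [rename, mv]

theorem Arg.mv_subst {X : Set ℕ} {e : Arg S} {ρ : ℕ → Arg S} (he : e.mv ⊆ X)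
    (hρ : ∀ i, (ρ i).mv ⊆ X) : (e.subst ρ).mv ⊆ X := by
  induction e generalizing ρ with
  | bvar i => exact hρ i
  | sym s es ih =>
    exact Set.iUnion_subset fun i => ih i ((Set.subset_iUnion _ i).trans he) hρ
  | mvar M n ts ih =>
    refine Set.union_subset (Set.subset_union_left.trans he) (Set.iUnion_subset fun i =>
      ih i (((Set.subset_iUnion (fun i => (ts i).mv) i).trans Set.subset_union_right).trans he) hρ)
  | abstr e ih =>
    refine ih he fun i => ?_
    cases i with
    | zero => exact Set.empty_subset _
    | succ i => rw [up, mv_rename]; exact hρ i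
  | _ => exact he

theorem Arg.mv_strip (n : ℕ) (e : Arg S) : (e.strip n).mv = e.mv := by
  induction n generalizing e with
  | zero => rfl
  | succ n ih => rw [strip, ih]; cases e <;> rfl

/-- Since `K` is defined at every available metavariable, none of the original ones survive as such.
This bounds the metavariables of an instantiated premise boundary by those of the preceding
arguments. -/
theorem Arg.Valid.mv_act {X : Set ℕ} {K : Inst S} {ar : ℕ → Option (Cls × ℕ)} {V : Set ℕ} {k : ℕ}
    {c : Cls × ℕ} {e : Arg S} (h : e.Valid ar V k c)
    (hK : ∀ M c, ar M = some c → ∃ f, K.lookup M = some f ∧ f.mv ⊆ X) : (e.act K).mv ⊆ X := by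
  induction h with
  | sym _ ih => exact Set.iUnion_subset ih
  | @mvar k M n c ts h _ _ ih =>
    obtain ⟨f, hf, hX⟩ := hK _ _ h
    simp only [Arg.act, hf]
    refine mv_subst (by rwa [mv_strip]) fun i => ?_
    unfold vec
    split
    · exact ih _
    · exact Set.empty_subset _
  | abstr _ ih => exact ih
  | _ => exact Set.empty_subset _

theorem ABdry.Valid.mv_act {X : Set ℕ} {K : Inst S} {ar : ℕ → Option (Cls × ℕ)} {V : Set ℕ}
    {k : ℕ} {B : ABdry S} (h : B.Valid ar V k)
    (hK : ∀ M c, ar M = some c → ∃ f, K.lookup M = some f ∧ f.mv ⊆ X) : (B.act K).mv ⊆ X := by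
  induction B generalizing k with
  | thesis b =>
    cases b with
    | ty => exact Set.empty_subset _
    | tm A => exact Arg.Valid.mv_act h hK
    | eqTy A B => exact Set.union_subset (h.1.mv_act hK) (h.2.mv_act hK)
    | eqTm s t A =>
      exact Set.union_subset (Set.union_subset (h.1.mv_act hK) (h.2.1.mv_act hK))
        (h.2.2.mv_act hK)
  | abstr A B ih => exact Set.union_subset (h.1.mv_act hK) (ih h.2)

namespace RawTT

variable {T : RawTT.{u, v} S}

/-- One step of a derivable chain of basic instantiations. -/
theorem chain_step {Ξ Θ : MCtx S} {I : Inst S} (hΞ : Ξ.Valid) (hΘ : Θ.Valid)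
    (hI : IsInst I Ξ Θ []) (hd : Disjoint (dom Ξ) (dom Θ)) {N : List ℕ} (hN : N.Nodup)
    (hNΞ : ∀ M ∈ N, M ∈ dom Ξ) (hcod : T.MCtxDerivable (chainCod Ξ Θ I N))
    (hinst : T.InstDerivable (chainInst Ξ Θ I N) Ξ (chainCod Ξ Θ I N) [])
    {M : ℕ} (hM : M ∉ N) {B : ABdry S} (hB : Ξ.lookup M = some B) (hmv : B.mv ⊆ {M | M ∈ N})
    {e : Arg S} (he : I.lookup M = some e) (hder : T.Derivable (.jdg Θ [] ((B.act I).plug e))) :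
    T.MCtxDerivable (chainCod Ξ Θ I (N ++ [M])) ∧
      T.InstDerivable (chainInst Ξ Θ I (N ++ [M])) Ξ (chainCod Ξ Θ I (N ++ [M])) [] := by
  have h := chainSpec hΞ hΘ hI hd hN hNΞ
  -- All metavariables of `B` are already instantiated, and on these the composite agrees with `I`.
  have hact : B.act (chainInst Ξ Θ I N) = B.act I := by
    refine ABdry.act_congr fun M' hM' => ?_
    obtain ⟨B', hB'⟩ := exists_lookup (hNΞ M' (hmv hM'))
    rw [h.lookup_inst M' B' hB', if_pos (show M' ∈ N from hmv hM')]
  obtain ⟨hc, hi⟩ := hcod.basicInst fun k B' hk => by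
    obtain ⟨rfl, hsub, hv⟩ := h.valid_arg hI hd hM hB he hk
    refine ⟨hv, ?_⟩
    rw [hact]
    -- The judgement is derivable over `Θ`, which is contained in the part of the chain context
    -- preceding `M`.
    exact hder.weaken
      ⟨hcod.valid.1.sublist ((List.take_sublist _ _).map _), fun j M' B' hj => by
        have hjk : j < k := by
          by_contra hjk
          rw [List.getElem?_take_eq_none (by omega)] at hj
          cases hj
        rw [List.getElem?_take_of_lt hjk] at hj
        rw [List.take_take, min_eq_left hjk.le]
        exact hcod.valid.2 _ _ _ hj⟩ hsub (VCtx.valid_nil _) fun _ _ h => h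
  rw [chainCod_snoc, chainInst_snoc, he, Option.getD_some]
  refine ⟨hc, instDerivable_of_lookup (hinst.1.comp hi.1) hΞ fun M' B' f' hB' hf' => ?_⟩
  obtain ⟨f, hf, hfv, hfd⟩ := hinst.lookup hΞ hB'
  rw [lookup_comp, hf, Option.map_some, Option.some.injEq] at hf'
  subst hf'
  -- The composite is derivable because the new basic instantiation preserves derivability of the
  -- instances obtained so far.
  have := hfd.act hi hc.valid
  rwa [ABdry.plug_tr _ (by rw [ABdry.arity_act]; exact hfv.hasAbs), ← ABdry.act_eq_tr,
    ← Arg.act_eq_tr, hinst.1.act_comp hi.1 (hΞ.lookup hB')] at this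

end RawTT

/-! ## Patterns -/

/-- Naturality speaks only about the object premises of a symbol rule; this shows that a premise
filled by a pattern is one of them. -/
theorem IsPattern.isObj {Ξ : MCtx S} {κ : PatKind} {p : Arg S} (hp : IsPattern Ξ κ p)
    {ar : ℕ → Option (Cls × ℕ)} {V : Set ℕ} {k : ℕ} {c : Cls × ℕ} (h : p.Valid ar V k c) :
    c.1.IsObj := by
  induction hp with
  | tyMVar => cases h with | mvar _ hc _ => exact hc
  | tySym => cases h; exact (S.arity _).isObj
  | tmSym => cases h; exact (S.arity _).isObj
  | argMVar => exact (Arg.valid_abstrs_mvar (c := c.1) (m := c.2) h).2.2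
  | argTy _ ih => exact ih h
  | argTm _ ih => exact ih h

theorem Arg.mv_abstrs (n : ℕ) (e : Arg S) : (abstrs n e).mv = e.mv := by
  induction n with
  | zero => rfl
  | succ n ih => exact ih

/-! ### Extending derivable chains along patterns -/

namespace RawTT

variable {T : RawTT.{u, v} S}

theorem getElem?_argInst {P : MCtx S} {n : ℕ} (es : Fin n → Arg S) {k M : ℕ} {B : ABdry S}
    (hP : P[k]? = some (M, B)) (hk : k < n) :
    (argInst P es)[k]? = some (M, es ⟨k, hk⟩) := by
  rw [argInst, List.getElem?_zip_eq_some]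
  exact ⟨by rw [List.getElem?_map, hP]; rfl, by rw [List.getElem?_ofFn, dif_pos hk]⟩

theorem argInst_act (P : MCtx S) {n : ℕ} (es : Fin n → Arg S) (I : Inst S) :
    argInst P (fun j => (es j).act I) = (argInst P es).map fun q => (q.1, q.2.act I) := by
  have : (List.ofFn fun j => (es j).act I) = (List.ofFn es).map (Arg.act I) := by
    rw [List.map_ofFn]; rfl
  rw [argInst, argInst, this, List.zip_map_right]; rfl

theorem getElem?_argInst_inv {P : MCtx S} {n : ℕ} {es : Fin n → Arg S} {k M : ℕ} {e : Arg S}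
    (h : (argInst P es)[k]? = some (M, e)) : ∃ hk : k < n, e = es ⟨k, hk⟩ := by
  rw [argInst, List.getElem?_zip_eq_some] at h
  have h2 := h.2
  rw [List.getElem?_ofFn] at h2
  split at h2
  · next hk => exact ⟨hk, (Option.some.inj h2).symm⟩
  · cases h2

/-- The chain of basic instantiations for a sequence of distinct metavariables is derivable. -/
structure DerivableChain (T : RawTT.{u, v} S) (Ξ Θ : MCtx S) (I : Inst S) (N : List ℕ) : Prop where
  nodup : N.Nodup
  mem : ∀ M ∈ N, M ∈ dom Ξ
  cod : T.MCtxDerivable (chainCod Ξ Θ I N)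
  inst : T.InstDerivable (chainInst Ξ Θ I N) Ξ (chainCod Ξ Θ I N) []

variable {Ξ Θ : MCtx S} {I : Inst S}

/-- Extension of a chain by a metavariable, given by its generic application. -/
theorem DerivableChain.extend_mvar (hΞ : Ξ.Valid) (hΘ : Θ.Valid) (hI : IsInst I Ξ Θ [])
    (hd : Disjoint (dom Ξ) (dom Θ)) {N : List ℕ} (hN : T.DerivableChain Ξ Θ I N) {M n : ℕ}
    {B : ABdry S} (hB : B.Valid Ξ.ar ∅ 0)
    (he : (Arg.abstrs n (.mvar M n fun i => .bvar (Fin.rev i)) : Arg S).Valid Ξ.ar ∅ 0 B.arity)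
    (hmv : B.mv ⊆ {M | M ∈ N})
    (hnat : T.Natural Ξ [] (B.plug (Arg.abstrs n (.mvar M n fun i => .bvar (Fin.rev i)))))
    (hder : T.Derivable (.jdg Θ [] ((B.act I).plug
      ((Arg.abstrs n (.mvar M n fun i => .bvar (Fin.rev i)) : Arg S).act I)))) :
    ∃ N', N <+: N' ∧ {M | M ∈ N'} = {M | M ∈ N} ∪
      (Arg.abstrs n (.mvar M n fun i => .bvar (Fin.rev i)) : Arg S).mv ∧
      T.DerivableChain Ξ Θ I N' := by
  -- By naturality `B` is the boundary of `M` itself, so `hmv` becomes the condition needed to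
  -- append `M`.
  have hM := hnat.lookup_eq hΞ hB he
  have hq : (Arg.abstrs n (.mvar M n fun i => .bvar (Fin.rev i)) : Arg S).mv = {M} := by
    simp [Arg.mv_abstrs, Arg.mv]
  rw [hq]
  by_cases hMN : M ∈ N
  · refine ⟨N, List.prefix_rfl, ?_, hN⟩
    exact (Set.union_eq_left.2 (by rintro _ rfl; exact hMN)).symm
  · obtain ⟨f, hf, hfv⟩ := hI.lookup (MCtx.ar_of_lookup hM)
    obtain ⟨hn, -, hc⟩ := Arg.valid_abstrs_mvar (c := B.arity.1) (m := B.arity.2) he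
    rw [← Arg.genApp_of_isObj hc, ← hn, Arg.act_eq_tr, Arg.genApp_tr hf hfv] at hder
    obtain ⟨h1, h2⟩ := chain_step hΞ hΘ hI hd hN.nodup hN.mem hN.cod hN.inst hMN hM hmv hf hder
    refine ⟨N ++ [M], List.prefix_append _ _, ?_, ?_, ?_, h1, h2⟩
    · ext M'; simp [or_comm]
    · rw [List.nodup_append]
      refine ⟨hN.nodup, by simp, ?_⟩
      rintro x hx y hy rfl
      exact hMN (List.mem_singleton.1 hy ▸ hx)
    · intro M' hM'
      rcases List.mem_append.1 hM' with h | h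
      · exact hN.mem M' h
      · rw [List.mem_singleton.1 h]; exact mem_dom_of_lookup hM

/-- A derivable chain extends along the metavariables of a natural pattern. -/
def ExtendsAlong (T : RawTT.{u, v} S) (Ξ Θ : MCtx S) (I : Inst S) (κ : PatKind) (p : Arg S) :
    Prop :=
  ∀ (B : ABdry S) (N : List ℕ), T.DerivableChain Ξ Θ I N → p.Valid Ξ.ar ∅ 0 B.arity →
    (κ = .arg → B.mv ⊆ {M | M ∈ N}) → T.Natural Ξ [] (B.plug p) →
    T.Derivable (.jdg Ξ [] (B.plug p)) → T.Derivable (.jdg Θ [] ((B.act I).plug (p.act I))) →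
    ∃ N', N <+: N' ∧ {M | M ∈ N'} = {M | M ∈ N} ∪ p.mv ∧ T.DerivableChain Ξ Θ I N'

/-- Inversion reduces the claim to the arguments, treated from left to right, each at its premise
boundary instantiated by the earlier arguments. The boundary of the whole application plays no role,
so every `κ` is allowed. -/
theorem extendsAlong_sym (hT : T.IsStandard) (hI : IsInst I Ξ Θ []) {κ : PatKind}
    {s : S.Sym} {qs : Fin (S.arity s).args.length → Arg S}
    (hqs : ∀ j, IsPattern Ξ .arg (qs j)) (ih : ∀ j, T.ExtendsAlong Ξ Θ I .arg (qs j)) :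
    T.ExtendsAlong Ξ Θ I κ (.sym s qs) := by
  intro B N hN hp _ hnat hder hIder
  obtain ⟨b, rfl⟩ : ∃ b, B = .thesis b := by
    cases B with
    | thesis b => exact ⟨b, rfl⟩
    | abstr A B => obtain ⟨f, h, -⟩ := hp.hasAbs; cases h
  have hb : b.IsObj := by
    have : b.cls = (S.arity s).cls := by
      generalize hc : (ABdry.thesis b).arity = c at hp
      cases hp
      exact congrArg Prod.fst hc
    rw [Bdry.IsObj, this]; exact (S.arity s).isObj
  obtain ⟨i, hi, hK⟩ := Derivable.sym_inv hT hb hder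
  obtain ⟨i₂, hi₂, hnatK⟩ := hnat.sym_inv hb
  obtain ⟨i₃, hi₃, hKI⟩ := Derivable.sym_inv hT (b := b.map (Arg.act I))
    ((Bdry.isObj_map _ _).2 hb) hIder
  obtain rfl := (hT.2.2 s).unique hi hi₂
  obtain rfl := (hT.2.2 s).unique hi hi₃
  have hlen : (T.rule i).prem.length = (S.arity s).args.length := by
    obtain ⟨es, -, hes⟩ := hi.2.2.2
    simpa using (congrArg List.length hes).symm
  rw [argInst_act] at hKI
  have hP := (T.valid i).1.1
  -- After `k` arguments the chain contains exactly the original metavariables and those of the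
  -- first `k` arguments.
  have key : ∀ k ≤ (S.arity s).args.length, ∃ N', N <+: N' ∧
      {M | M ∈ N'} = {M | M ∈ N} ∪ ⋃ (j) (_ : j.val < k), (qs j).mv ∧
      T.DerivableChain Ξ Θ I N' := by
    intro k hk
    induction k with
    | zero => exact ⟨N, List.prefix_rfl, by simp, hN⟩
    | succ k ihk =>
      obtain ⟨N₁, h1, h2, h3⟩ := ihk (by omega)
      have hkP : k < (T.rule i).prem.length := by omega
      obtain ⟨⟨M, B⟩, hMB⟩ : ∃ q, (T.rule i).prem[k]? = some q :=
        ⟨_, List.getElem?_eq_getElem hkP⟩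
      have hKk := getElem?_argInst qs hMB (show k < (S.arity s).args.length by omega)
      set K := argInst (T.rule i).prem qs with hKdef
      set q := qs ⟨k, hk⟩ with hq
      have hqv := (hK.1.getElem? hMB hKk).2
      rw [dom_nil] at hqv
      have hBobj : B.IsObj := (hqs _).isObj hqv
      -- This is where the order of the arguments matters: the boundary of the `k`-th premise is
      -- instantiated by earlier arguments only, whose metavariables are already in the chain.
      have hmv : (B.act (K.take k)).mv ⊆ {M | M ∈ N₁} := by
        refine (hP.2 _ _ _ hMB).mv_act fun M' c hM' => ?_
        obtain ⟨f, hf, -⟩ := (hK.1.take k).lookup hM'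
        refine ⟨f, hf, ?_⟩
        obtain ⟨k', hk'⟩ := exists_getElem?_of_lookup hf
        have hkk : k' < k := by
          by_contra hkk
          rw [List.getElem?_take_eq_none (by omega)] at hk'
          cases hk'
        rw [List.getElem?_take_of_lt hkk] at hk'
        obtain ⟨hkn, rfl⟩ := getElem?_argInst_inv hk'
        rw [h2]
        exact Set.subset_union_of_subset_right
          (Set.subset_iUnion₂ (s := fun (j : Fin _) (_ : j.val < k) => (qs j).mv) ⟨k', hkn⟩ hkk) _
      -- Inversion over `Θ` concerns the composite of `I` with `K`; associativity of the actions
      -- turns its `k`-th premise into the instance under `I` of the `k`-th premise over `Ξ`.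
      have hIk : T.Derivable (.jdg Θ [] (((B.act (K.take k)).act I).plug (q.act I))) := by
        have := hKI.2 k M B (q.act I) hMB (by rw [List.getElem?_map, hKk]; rfl)
        rwa [Arg.act_eq_tr', ← hK.1.act_tr hP hI.closed hMB, ← ABdry.act_eq_tr,
          ← Arg.act_eq_tr'] at this
      obtain ⟨N₂, h4, h5, h6⟩ := ih ⟨k, hk⟩ (B.act (K.take k)) N₁ h3
        (by rwa [ABdry.arity_act]) (fun _ => hmv) (hnatK k M B q hMB hBobj hKk)
        (hK.2 k M B q hMB hKk) hIk
      refine ⟨N₂, h1.trans h4, ?_, h6⟩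
      rw [h5, h2, Set.union_assoc]
      congr 1
      ext M'
      simp only [Set.mem_union, Set.mem_iUnion, exists_prop]
      constructor
      · rintro (⟨j, hj, hM'⟩ | hM')
        · exact ⟨j, by omega, hM'⟩
        · exact ⟨⟨k, hk⟩, Nat.lt_succ_self k, hM'⟩
      · rintro ⟨j, hj, hM'⟩
        rcases Nat.lt_succ_iff_lt_or_eq.1 hj with hj | rfl
        · exact .inl ⟨j, hj, hM'⟩
        · exact .inr hM'
  obtain ⟨N', h1, h2, h3⟩ := key _ le_rfl
  refine ⟨N', h1, ?_, h3⟩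
  rw [h2, Arg.mv]
  congr 1
  ext M
  simp

theorem extendsAlong_of_isPattern (hT : T.IsStandard) (hI : IsInst I Ξ Θ [])
    (hd : Disjoint (dom Ξ) (dom Θ)) {κ : PatKind} {p : Arg S} (hp : IsPattern Ξ κ p) :
    T.ExtendsAlong Ξ Θ I κ p := by
  induction hp with
  | @tyMVar M ts hM =>
    intro B N hN he _ hnat hder hIder
    obtain rfl : ts = fun i => .bvar (Fin.rev i) := Subsingleton.elim _ _
    have hBv := hder.valid.2.2
    rw [dom_nil] at hBv
    refine hN.extend_mvar (n := 0) hder.valid.1 hIder.valid.1 hI hd (ABdry.valid_of_plug hBv) he ?_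
      hnat hIder
    obtain ⟨hn, hM', -⟩ := Arg.valid_abstrs_mvar (n := 0) (c := B.arity.1) (m := B.arity.2) he
    -- `M` is a type metavariable without arguments, so `B` is `□ type` and contains no
    -- metavariables.
    have hty : B.arity.1 = .ty := by
      rw [hM] at hM'
      exact (congrArg Prod.fst (Option.some.inj hM')).symm
    cases B with
    | thesis b =>
      cases b with
      | ty => exact Set.empty_subset _
      | tm A => cases hty
      | eqTy => cases hty
      | eqTm => cases hty
    | abstr A B => cases hn
  | tySym _ hqs _ ih => exact extendsAlong_sym hT hI hqs ih
  | tmSym _ hqs _ ih => exact extendsAlong_sym hT hI hqs ih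
  | @argMVar M n c hM hc =>
    intro B N hN he hmv hnat hder hIder
    have hBv := hder.valid.2.2
    rw [dom_nil] at hBv
    exact hN.extend_mvar hder.valid.1 hIder.valid.1 hI hd (ABdry.valid_of_plug hBv) he (hmv rfl)
      hnat hIder
  -- For type and term patterns the condition on the metavariables of the boundary is vacuous.
  | argTy _ ih => exact fun B N hN he _ => ih B N hN he (by simp)
  | argTm _ ih => exact fun B N hN he _ => ih B N hN he (by simp)

end RawTT

end FTT

/-! ### The extension lemma -/

theorem mainTheorem8 {S : FTT.Signature.{u}} (T : FTT.RawTT.{u, v} S) (hT : T.IsStandard)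
    (Ξ : FTT.MCtx S) (B : FTT.Bdry S) (p : FTT.Arg S)
    (hB : B.IsObj)
    (hder : T.Derivable (.jdg Ξ [] (.thesis (B.plug p))))
    (hnat : T.Natural Ξ [] (.thesis (B.plug p)))
    (hp : FTT.IsPattern Ξ .ty p ∨ FTT.IsPattern Ξ .tm p)
    (Θ : FTT.MCtx S) (I : FTT.Inst S)
    (hI : FTT.IsInst I Ξ Θ [])
    (hdisj : Disjoint (FTT.dom Ξ) (FTT.dom Θ))
    (hIder : T.Derivable (.jdg Θ [] (.thesis ((B.plug p).map (FTT.Arg.act I)))))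
    (N : List ℕ) (hN : N.Nodup)
    (hNΞ : {M | M ∈ N} ⊆ FTT.dom Ξ)
    (hmv : B.mv ⊆ {M | M ∈ N} ∪ p.mv)
    (hcod : T.MCtxDerivable (FTT.chainCod Ξ Θ I N))
    (hinst : T.InstDerivable (FTT.chainInst Ξ Θ I N) Ξ (FTT.chainCod Ξ Θ I N) []) :
    ∃ N' : List ℕ, N <+: N' ∧ N'.Nodup ∧
      {M | M ∈ N'} = {M | M ∈ N} ∪ p.mv ∧
      T.MCtxDerivable (FTT.chainCod Ξ Θ I N') ∧
      T.InstDerivable (FTT.chainInst Ξ Θ I N') Ξ (FTT.chainCod Ξ Θ I N') [] := by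
  have hpv : p.Valid Ξ.ar ∅ 0 (B.cls, 0) := by
    have := hder.valid.2.2
    rw [FTT.dom_nil] at this
    exact FTT.Bdry.valid_head_of_plug hB this
  -- At the root the kind is never `arg`, so `ExtendsAlong` imposes no condition on the
  -- metavariables of `B`.
  have hpat : ∃ κ, κ ≠ FTT.PatKind.arg ∧ FTT.IsPattern Ξ κ p := by
    rcases hp with hp | hp
    · exact ⟨_, by simp, hp⟩
    · exact ⟨_, by simp, hp⟩
  obtain ⟨κ, hκ, hp⟩ := hpat
  rw [FTT.Bdry.map_plug] at hIder
  obtain ⟨N', h1, h2, h3⟩ := FTT.RawTT.extendsAlong_of_isPattern hT hI hdisj hp (.thesis B) N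
    ⟨hN, fun M hM => hNΞ hM, hcod, hinst⟩ hpv (fun h => (hκ h).elim) hnat hder hIder
  exact ⟨N', h1, h3.nodup, h2, h3.cod, h3.inst⟩
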